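/- **Setting.** Let $n\ge 2$ and work in $\mathbb R^{n+1}$ with coordinates $x^\alpha$. On an open set $U$ let $g$ be a $C^2$ Lorentzian metric and let $\hat g$ (the target metric) be a $C^2$ pseudo-Riemannian metric. Let $S_{\alpha\beta}=R_{\alpha\beta}-\frac12 R\,g_{\alpha\beta}$ be the Einstein tensor of $g$, $W^\lambda=g^{\alpha\beta}\hat\Gamma^\lambda_{\alpha\beta}$, and $H^\lambda=g^{\alpha\beta}\Gamma^\lambda_{\alpha\beta}-W^\lambda$ the wave-gauge vector; $\hat D$ is the covariant derivative of $\hat g$. The reduced Ricci tensor $R^{(H)}_{\alpha\beta}$ is given by $R_{\alpha\beta}=R^{(H)}_{\alpha\beta}+\frac12(g_{\alpha\lambda}\hat D_\beta H^\lambda+g_{\beta\lambda}\hat D_\alpha H^\lambda)$, and $S^{(H)}_{\alpha\beta}=R^{(H)}_{\alpha\beta}-\frac12 g_{\alpha\beta}g^{\lambda\mu}R^{(H)}_{\lambda\mu}$. An overbar denotes restriction to a hypersurface $M_0$. **Adapted null coordinates.** $M_0=U\cap\{x^0=0\}$, $\overline g_{11}=\overline g_{1A}=0$ ($A=2,\dots,n$),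 and $\ell=\partial/\partial x^1$. Write $\nu_0=\overline g_{01}=1/\nu^0$, $\nu_A=\overline g_{0A}$, $\nu^A=\overline g^{AB}\nu_B$, with $\overline g^{AB}$ the inverse of $\overline g_{AB}$; then $\overline g^{1A}=-\nu^0\nu^A$. Put $\chi_A{}^B=\frac12\overline g^{BC}\partial_1\overline g_{AC}$, $\tau=\chi_A{}^A$, $\sigma_A{}^B=\chi_A{}^B-\frac{\tau}{n-1}\delta_A^B$, $|\sigma|^2=\sigma_A{}^B\sigma_B{}^A$. Let $\tilde\nabla,\tilde\Gamma,\tilde R$ be the Levi-Civita connection, Christoffel symbols and scalar curvature of the metrics $\overline g_{AB}$ on the sections $x^1=\mathrm{const}$ of $M_0$, and $\tilde\Gamma_A=\overline g_{AD}\overline g^{BC}\tilde\Gamma^D_{BC}$. Put $\overline W_1=\nu_0\overline W^0$, $\overline W_A=\overline g_{AB}\overline W^B$, $\overline H_1=\nu_0\overline H^0$, $\overline H_A=\overline g_{AB}\overline H^B$, $\overline H_0:=\nu_0\overline H^1$, and $$\kappa=\nu^0\partial_1\nu_0-\tfrac12(\overline W_1+\tau),\qquad \xi_A=-2\nu^0\partial_1\nu_A+4\nu^0\nu_B\chi_A{}^B+\nu^0\nu_A\overline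 W_1+\overline W_A-\tilde\Gamma_A .$$ **Theorem.** 1. There are operators $\mathcal C_\alpha$, depending only on a hypersurface $M_0$, the field $\overline g$ on $M_0$, a field $\ell$ on $M_0$ and the field $\overline W$ on $M_0$, and operators $\mathcal L_\alpha$, depending only on these and on $\overline H$, with $\mathcal L_\alpha=0$ when $\overline H=0$, such that for all $U$, $g$, $\hat g$ as above, every embedded $C^2$ hypersurface $M_0\subset U$ which is null for $g$, and every nowhere vanishing field $\ell$ of null normals to $M_0$ (with arbitrary normalisation), $$\overline S_{\alpha\beta}\ell^\beta=\mathcal L_\alpha+\mathcal C_\alpha\quad\text{on } M_0 .$$ In adapted null coordinates these operators are given by $$\mathcal C_1=-\partial_1\tau+\kappa\tau-|\sigma|^2-\tfrac{\tau^2}{n-1},\qquad \mathcal C_A=-\tfrac12(\partial_1\xi_A+\tau\xi_A)+\tilde\nabla_B\chi_A{}^B-\tfrac12\partial_A(\tau-\overline W_1+2\nu^0\partial_1\nu_0),$$ $$-2\nu^0\mathcal C_0=2(\partial_1+\kappa+\tau)\big[(\partial_1+\kappa+\tfrac\tau2)\overline g^{11}+\overline W^1\big]+\tilde R-\tfrac12\overline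 g^{AB}\xi_A\xi_B+\overline g^{AB}\tilde\nabla_A\xi_B+\overline g^{11}\mathcal C_1+2\overline g^{1A}\mathcal C_A,$$ $$\mathcal L_1=-\tfrac12\tau\overline H_1,\qquad \mathcal L_A=-\tfrac12(\partial_1+\tau)(\overline H_A+\nu_A\overline H^0)+\tfrac12\partial_A(\nu_0\overline H^0),$$ $$\begin{aligned}2\nu^0\mathcal L_0={}&-2\overline g^{1A}\mathcal L_A-\overline g^{11}\mathcal L_1-2\partial_1\overline H^1-(\tau+2\nu^0\partial_1\nu_0-\nu_0\overline W^0)\overline H^1-\tilde\nabla_A\overline H^A+\xi_A\overline H^A+\nu_0\overline g^{11}\partial_1\overline H^0-\nu^A\partial_A\overline H^0\\&+\big(\overline g_{00}\overline W^0+\nu_0\overline W^1+\nu_A\overline W^A+\tfrac12\nu_0\tau\overline g^{11}-\overline g^{11}\partial_1\nu_0-2\nu^0\partial_1\overline g_{00}-\overline g^{AB}\partial_A\nu_B+2\nu^0\nu^A\partial_1\nu_A\big)\overline H^0+\tfrac12\overline g_{\mu\nu}\overline H^\mu\overline H^\nu .\end{aligned}$$ 2. Consider adapted null coordinates. (a)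 If also $\hat g_{11}=\hat g_{1A}=0$ on $M_0$, the $\mathcal C_\alpha$ form a hierarchy of ordinary differential operators along the generators. First, with only $\overline g_{AB}$ and $\nu_0$ occurring, $$\mathcal C_1=\tau\nu^0\partial_1\nu_0-\tfrac12\tau\,\overline g^{AB}\hat\Gamma^0_{AB}\,\nu_0-\Big(\partial_1\tau+\tau\hat\Gamma^0_{01}+\tfrac12\tau^2+|\sigma|^2+\tfrac{\tau^2}{n-1}\Big).$$ Next, $\mathcal C_A=\nu^0\partial_1^2\nu_A+a_A{}^B\partial_1\nu_B+b_A{}^B\nu_B+c_A$, where $a,b,c$ are explicit expressions in $\overline g_{AB},\nu_0,\hat\Gamma$ and their derivatives tangent to $M_0$; that is, once $\overline g_{AB},\nu_0$ are known from the first constraint, $\mathcal C_A$ is a linear (affine) second-order operator in $\nu_A$. Finally $\overline g^{11}=(\nu^0)^2(\nu^A\nu_A-\overline g_{00})$ and $-2\nu^0\mathcal C_0=2\partial_1^2\overline g^{11}+a\,\partial_1\overline g^{11}+b\,\overline g^{11}+c$, where $a,b$ are explicit expressions in $\overline g_{AB},\nu_0,\hat\Gamma$, and $c$ in $\overline g_{AB},\nu_0,\nu_A,\hat\Gamma$,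 and their derivatives tangent to $M_0$. (b) Let $g$ satisfy the reduced Einstein equations $S^{(H)}_{\alpha\beta}=T_{\alpha\beta}$ on $M_0$, for some tensor $T$. Then on $M_0$ $$T_{\alpha1}-\mathcal C_\alpha=\mathcal L_\alpha-\tfrac12\big(g_{\alpha\lambda}\hat D_1H^\lambda+g_{1\lambda}\hat D_\alpha H^\lambda-g_{\alpha1}\hat D_\lambda H^\lambda\big).$$ If also $\hat g_{11}=\hat g_{1A}=0$ on $M_0$, this is a hierarchy of homogeneous first-order linear ordinary differential operators along the generators: $$T_{11}-\mathcal C_1=-\nu_0\big(\partial_1\overline H^0+(\tfrac12\tau+\hat\Gamma^0_{01})\overline H^0\big);$$ $$\begin{aligned}T_{A1}-\mathcal C_A={}&-\partial_1\overline H_A-\tfrac12\tau\overline H_A+\chi_A{}^B\overline H_B-\tfrac12\nu_0\hat\Gamma^0_{AB}\overline H^B-\tfrac12\overline g_{AB}\hat\Gamma^B_{1D}\overline H^D-\nu_A\partial_1\overline H^0\\&+\tfrac12\big(\partial_A\nu_0-\partial_1\nu_A-\tau\nu_A-\nu_0\hat\Gamma^0_{0A}-\nu_A\hat\Gamma^0_{01}-\overline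 g_{AB}\hat\Gamma^B_{01}\big)\overline H^0 ;\end{aligned}$$ and, if $\overline H^0=\overline H^A=0$ on $M_0$, $$T_{01}-\mathcal C_0=-\partial_1\overline H_0+\tfrac12\big(\overline W_1-\tau+\hat\Gamma^A_{A1}\big)\overline H_0 .$$ In particular, when the constraints $\mathcal C_\alpha=T_{\alpha1}$ hold, the left-hand sides vanish. -/

import Mathlib

noncomputable section

namespace NullConstraints

/-! ## Pseudo-Riemannian geometry in coordinates

`e : ι → X` lists the coordinate directions along which one differentiates. With `ι = Fin (m + 2)`
and the full coordinate basis this is space-time geometry; with `ι = Fin m` and the angular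
coordinate directions it is the geometry of the sections `x⁰ = 0`, `x¹ = const` of a null
hypersurface. -/

section Geometry

variable {X ι : Type*} [AddCommGroup X] [Module ℝ X] [Fintype ι] [DecidableEq ι]

/-- The Christoffel symbol `Γ^l_{ab}` of the metric with components `g`. -/
def christoffel (e : ι → X) (g : X → Matrix ι ι ℝ) (x : X) (l a b : ι) : ℝ :=
  ∑ k, (g x)⁻¹ l k * ((1 / 2) * (lineDeriv ℝ (fun y => g y b k) x (e a)
    + lineDeriv ℝ (fun y => g y a k) x (e b) - lineDeriv ℝ (fun y => g y a b) x (e k)))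

/-- The Ricci tensor
`R_{ab} = ∂_l Γ^l_{ab} - ∂_a Γ^l_{bl} + Γ^l_{ab} Γ^k_{lk} - Γ^l_{ak} Γ^k_{bl}`. -/
def ricci (e : ι → X) (g : X → Matrix ι ι ℝ) (x : X) (a b : ι) : ℝ :=
  (∑ l, lineDeriv ℝ (fun y => christoffel e g y l a b) x (e l))
    - (∑ l, lineDeriv ℝ (fun y => christoffel e g y l b l) x (e a))
    + (∑ l, ∑ k, christoffel e g x l a b * christoffel e g x k l k)
    - ∑ l, ∑ k, christoffel e g x l a k * christoffel e g x k b l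

/-- The scalar curvature `g^{ab} R_{ab}`. -/
def scalarCurv (e : ι → X) (g : X → Matrix ι ι ℝ) (x : X) : ℝ :=
  ∑ a, ∑ b, (g x)⁻¹ a b * ricci e g x a b

/-- The Einstein tensor `S_{ab} = R_{ab} - ½ R g_{ab}`. -/
def einstein (e : ι → X) (g : X → Matrix ι ι ℝ) (x : X) (a b : ι) : ℝ :=
  ricci e g x a b - (1 / 2) * g x a b * scalarCurv e g x

/-- `W^l = g^{ab} Γ̂^l_{ab}`, with `Γ̂` the Christoffel symbols of the target metric `gh`. -/
def gaugeW (e : ι → X) (g gh : X → Matrix ι ι ℝ) (x : X) (l : ι) : ℝ :=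
  ∑ a, ∑ b, (g x)⁻¹ a b * christoffel e gh x l a b

/-- The wave-gauge vector `H^l = g^{ab} Γ^l_{ab} - W^l`. -/
def gaugeH (e : ι → X) (g gh : X → Matrix ι ι ℝ) (x : X) (l : ι) : ℝ :=
  (∑ a, ∑ b, (g x)⁻¹ a b * christoffel e g x l a b) - gaugeW e g gh x l

/-- `D̂_b H^l`, with `D̂` the covariant derivative of the target metric `gh`. -/
def gaugeDH (e : ι → X) (g gh : X → Matrix ι ι ℝ) (x : X) (b l : ι) : ℝ :=
  lineDeriv ℝ (fun y => gaugeH e g gh y l) x (e b)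
    + ∑ k, christoffel e gh x l b k * gaugeH e g gh x k

/-- The reduced Ricci tensor in `gh`-wave-map gauge, i.e. `R^{(H)}` with
`R_{ab} = R^{(H)}_{ab} + ½ (g_{al} D̂_b H^l + g_{bl} D̂_a H^l)`. -/
def reducedRicci (e : ι → X) (g gh : X → Matrix ι ι ℝ) (x : X) (a b : ι) : ℝ :=
  ricci e g x a b
    - (1 / 2) * ∑ l, (g x a l * gaugeDH e g gh x b l + g x b l * gaugeDH e g gh x a l)

/-- The reduced Einstein tensor `S^{(H)}_{ab} = R^{(H)}_{ab} - ½ g_{ab} g^{kl} R^{(H)}_{kl}`. -/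
def reducedEinstein (e : ι → X) (g gh : X → Matrix ι ι ℝ) (x : X) (a b : ι) : ℝ :=
  reducedRicci e g gh x a b
    - (1 / 2) * g x a b * ∑ k, ∑ l, (g x)⁻¹ k l * reducedRicci e g gh x k l

end Geometry

/-! ## Space-time, dimension `m + 2 = n + 1`, coordinates `x⁰, x¹, x^A` with `A : Fin m` -/

/-- Coordinate space `ℝ^{n+1}`, `n = m + 1`. -/
abbrev Pt (m : ℕ) := Fin (m + 2) → ℝ

/-- Symmetric tensors etc. by components. -/
abbrev Comp (m : ℕ) := Matrix (Fin (m + 2)) (Fin (m + 2)) ℝ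

/-- The coordinate basis vectors `∂/∂x^i`. -/
def basis (m : ℕ) (i : Fin (m + 2)) : Pt m := Pi.single i 1

/-- The index of the coordinate `x^A`. -/
def ang {m : ℕ} (A : Fin m) : Fin (m + 2) := A.succ.succ

/-- The coordinate basis vectors `∂/∂x^A`. -/
def angBasis (m : ℕ) (A : Fin m) : Pt m := basis m (ang A)

/-- Signature `(-, +, …, +)`. -/
def IsLorentzian {m : ℕ} (A : Comp m) : Prop :=
  A.IsSymm ∧ ∃ P : Comp m, IsUnit P.det ∧
    P.transpose * A * P = Matrix.diagonal (fun i => if i = 0 then -1 else 1)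

/-- A `C²` Lorentzian metric on `U`. -/
structure IsLorentzMetric {m : ℕ} (U : Set (Pt m)) (g : Pt m → Comp m) : Prop where
  contDiffOn : ∀ i j, ContDiffOn ℝ 2 (fun x => g x i j) U
  lorentzian : ∀ x ∈ U, IsLorentzian (g x)

/-- A `C²` pseudo-Riemannian metric (of any signature) on `U`. -/
structure IsPseudoMetric {m : ℕ} (U : Set (Pt m)) (g : Pt m → Comp m) : Prop where
  contDiffOn : ∀ i j, ContDiffOn ℝ 2 (fun x => g x i j) U
  symm : ∀ x ∈ U, (g x).IsSymm
  nondegenerate : ∀ x ∈ U, (g x).det ≠ 0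

/-- `M` is an embedded `C²` hypersurface, null for `g`, and `l` is a field of non-zero null
normals: near each of its points `M` is a regular level set `φ = 0`, and there `l` is both tangent
to `M` and `g`-orthogonal to all vectors tangent to `M` (hence null). No regularity of the field
`l`, i.e. of the normalisation, is required. -/
def IsNullHypersurface {m : ℕ} (g : Pt m → Comp m) (M : Set (Pt m)) (l : Pt m → Pt m) : Prop :=
  ∀ p ∈ M, l p ≠ 0 ∧ ∃ (V : Set (Pt m)) (φ : Pt m → ℝ), IsOpen V ∧ p ∈ V ∧
    ContDiffOn ℝ 2 φ V ∧ (∀ x ∈ V, x ∈ M ↔ φ x = 0) ∧ (∀ x ∈ V, fderiv ℝ φ x ≠ 0) ∧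
    fderiv ℝ φ p (l p) = 0 ∧
    ∀ v : Pt m, fderiv ℝ φ p v = 0 → ∑ i, ∑ j, g p i j * l p i * v j = 0

/-- The hypersurface `x⁰ = 0` in the coordinate domain `U`. -/
def slice {m : ℕ} (U : Set (Pt m)) : Set (Pt m) := {x | x ∈ U ∧ x 0 = 0}

/-- `g_{11} = 0` and `g_{1A} = 0` on `M`. -/
def IsAdapted {m : ℕ} (g : Pt m → Comp m) (M : Set (Pt m)) : Prop :=
  ∀ x ∈ M, g x 1 1 = 0 ∧ ∀ A : Fin m, g x 1 (ang A) = 0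

/-- Components of the metric on the null hypersurface: `g_{AB}`. -/
def angMetric {m : ℕ} (g : Pt m → Comp m) (x : Pt m) : Matrix (Fin m) (Fin m) ℝ :=
  Matrix.of fun A B => g x (ang A) (ang B)

/-- `ν₀ = g_{01}`. -/
def nuZero {m : ℕ} (g : Pt m → Comp m) (x : Pt m) : ℝ := g x 0 1

/-- `ν_A = g_{0A}`. -/
def nuAng {m : ℕ} (g : Pt m → Comp m) (x : Pt m) (A : Fin m) : ℝ := g x 0 (ang A)

/-- `g^{11}`. -/
def gUp {m : ℕ} (g : Pt m → Comp m) (x : Pt m) : ℝ := (g x)⁻¹ 1 1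

/-- `H_A = g_{AB} H^B` from the contravariant components, likewise `W_A` from `W^A`. -/
def lowerAng {m : ℕ} (q : Pt m → Matrix (Fin m) (Fin m) ℝ) (W : Pt m → Fin m → ℝ)
    (x : Pt m) (A : Fin m) : ℝ :=
  ∑ B, q x A B * W x B

/-! ## Operators on a null hypersurface in adapted coordinates

The arguments are `q = g_{AB}`, `n0 = ν₀`, `nu = ν_A`, `g11 = g^{11}`, `g00 = g_{00}`, and the
contravariant components `W0, W1, WA` of `W` and `H0, H1, HA` of `H`. Only the derivatives
`∂₁` and `∂_A`, tangent to `x⁰ = 0`, occur. -/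

section Operators

variable {m : ℕ}

/-- `∂₁ f`. -/
def d1 (f : Pt m → ℝ) (x : Pt m) : ℝ := lineDeriv ℝ f x (basis m 1)

/-- `∂_A f`. -/
def dA (A : Fin m) (f : Pt m → ℝ) (x : Pt m) : ℝ := lineDeriv ℝ f x (angBasis m A)

variable (q : Pt m → Matrix (Fin m) (Fin m) ℝ) (n0 : Pt m → ℝ) (nu : Pt m → Fin m → ℝ)
  (g11 g00 : Pt m → ℝ) (W0 W1 : Pt m → ℝ) (WA : Pt m → Fin m → ℝ)
  (H0 H1 : Pt m → ℝ) (HA : Pt m → Fin m → ℝ)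

/-- The null extrinsic curvature `χ_A^B = ½ g^{BC} ∂₁ g_{AC}`. -/
def chi (x : Pt m) (A B : Fin m) : ℝ :=
  (1 / 2) * ∑ C, (q x)⁻¹ B C * d1 (fun y => q y A C) x

/-- `τ = χ_A^A`. -/
def tau (x : Pt m) : ℝ := ∑ A, chi q x A A

/-- The trace-free part `σ_A^B = χ_A^B - δ_A^B τ / (n - 1)`. -/
def sigma (x : Pt m) (A B : Fin m) : ℝ :=
  chi q x A B - (if A = B then tau q x / m else 0)

/-- `|σ|² = σ_A^B σ_B^A`. -/
def sigmaSq (x : Pt m) : ℝ := ∑ A, ∑ B, sigma q x A B * sigma q x B A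

/-- `Γ̃^C_{AB}`, the Christoffel symbols of the metrics `g_{AB}` on the sections. -/
def chrS (x : Pt m) (C A B : Fin m) : ℝ := christoffel (angBasis m) q x C A B

/-- `Γ̃_A = g_{AD} g^{BC} Γ̃^D_{BC}`. -/
def chrTrace (x : Pt m) (A : Fin m) : ℝ :=
  ∑ D, ∑ B, ∑ C, q x A D * (q x)⁻¹ B C * chrS q x D B C

/-- `ν^A = g^{AB} ν_B`. -/
def nuUp (x : Pt m) (A : Fin m) : ℝ := ∑ B, (q x)⁻¹ A B * nu x B

/-- `∇̃_B χ_A^B`. -/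
def divChi (x : Pt m) (A : Fin m) : ℝ :=
  ∑ B, (dA B (fun y => chi q y A B) x
    + ∑ C, (chrS q x B B C * chi q x A C - chrS q x C B A * chi q x C B))

/-- `κ = ν⁰ ∂₁ν₀ - ½ (W₁ + τ)`, with `W₁ = ν₀ W⁰`. -/
def kappa (x : Pt m) : ℝ :=
  (n0 x)⁻¹ * d1 n0 x - (1 / 2) * (n0 x * W0 x + tau q x)

/-- `C₁ = -∂₁τ + (ν⁰ ∂₁ν₀ - ½ (W₁ + τ)) τ - |σ|² - τ² / (n - 1)`. -/
def opC1 (x : Pt m) : ℝ :=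
  -d1 (tau q) x + kappa q n0 W0 x * tau q x - sigmaSq q x - tau q x ^ 2 / m

/-- `ξ_A = -2 ν⁰ ∂₁ν_A + 4 ν⁰ ν_B χ_A^B + ν⁰ ν_A W₁ + W_A - Γ̃_A`. -/
def xi (x : Pt m) (A : Fin m) : ℝ :=
  -2 * (n0 x)⁻¹ * d1 (fun y => nu y A) x + 4 * (n0 x)⁻¹ * (∑ B, nu x B * chi q x A B)
    + (n0 x)⁻¹ * nu x A * (n0 x * W0 x) + lowerAng q WA x A - chrTrace q x A

/-- `C_A = -½ (∂₁ξ_A + τ ξ_A) + ∇̃_B χ_A^B - ½ ∂_A (τ - W₁ + 2 ν⁰ ∂₁ν₀)`. -/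
def opCA (x : Pt m) (A : Fin m) : ℝ :=
  -(1 / 2) * (d1 (fun y => xi q n0 nu W0 WA y A) x + tau q x * xi q n0 nu W0 WA x A)
    + divChi q x A
    - (1 / 2) * dA A (fun y => tau q y - n0 y * W0 y + 2 * (n0 y)⁻¹ * d1 n0 y) x

/-- `g^{AB} ∇̃_A ξ_B`. -/
def divXi (x : Pt m) : ℝ :=
  ∑ A, ∑ B, (q x)⁻¹ A B * (dA A (fun y => xi q n0 nu W0 WA y B) x
    - ∑ C, chrS q x C A B * xi q n0 nu W0 WA x C)

/-- `g^{AB} ξ_A ξ_B`. -/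
def xiSq (x : Pt m) : ℝ :=
  ∑ A, ∑ B, (q x)⁻¹ A B * xi q n0 nu W0 WA x A * xi q n0 nu W0 WA x B

/-- `-2 ν⁰ C₀ = 2 (∂₁ + κ + τ) [(∂₁ + κ + τ/2) g^{11} + W¹] + R̃ - ½ g^{AB} ξ_A ξ_B
  + g^{AB} ∇̃_A ξ_B + g^{11} C₁ + 2 g^{1A} C_A`, where `g^{1A} = -ν⁰ ν^A`. -/
def opC0 (x : Pt m) : ℝ :=
  -(1 / 2) * n0 x *
    (2 * (d1 (fun y => d1 g11 y + (kappa q n0 W0 y + tau q y / 2) * g11 y + W1 y) x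
        + (kappa q n0 W0 x + tau q x)
          * (d1 g11 x + (kappa q n0 W0 x + tau q x / 2) * g11 x + W1 x))
      + scalarCurv (angBasis m) q x
      - (1 / 2) * xiSq q n0 nu W0 WA x + divXi q n0 nu W0 WA x
      + g11 x * opC1 q n0 W0 x
      + 2 * ∑ A, (-(n0 x)⁻¹ * nuUp q nu x A) * opCA q n0 nu W0 WA x A)

/-- `L₁ = -½ H₁ τ`, with `H₁ = ν₀ H⁰`. -/
def opL1 (x : Pt m) : ℝ := -(1 / 2) * (n0 x * H0 x) * tau q x

/-- `L_A = -½ ∂₁ (H_A + ν_A H⁰) - ½ τ (H_A + ν_A H⁰) + ½ ∂_A (ν₀ H⁰)`. -/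
def opLA (x : Pt m) (A : Fin m) : ℝ :=
  -(1 / 2) * d1 (fun y => lowerAng q HA y A + nu y A * H0 y) x
    - (1 / 2) * tau q x * (lowerAng q HA x A + nu x A * H0 x)
    + (1 / 2) * dA A (fun y => n0 y * H0 y) x

/-- `∇̃_A H^A`. -/
def divHA (x : Pt m) : ℝ :=
  ∑ A, (dA A (fun y => HA y A) x + ∑ C, chrS q x A A C * HA x C)

/-- `L₀`, given by
`2 ν⁰ L₀ = -2 g^{1A} L_A - g^{11} L₁ - 2 ∂₁H¹ - (τ + 2 ν⁰ ∂₁ν₀ - ν₀ W⁰) H¹ - ∇̃_A H^A + ξ_A H^A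
  + ν₀ g^{11} ∂₁H⁰ - ν^A ∂_A H⁰
  + (g_{00} W⁰ + ν₀ W¹ + ν_A W^A + ½ ν₀ τ g^{11} - g^{11} ∂₁ν₀ - 2 ν⁰ ∂₁g_{00}
      - g^{AB} ∂_A ν_B + 2 ν⁰ ν^A ∂₁ν_A) H⁰
  + ½ (g_{00} H⁰ H⁰ + 2 ν₀ H⁰ H¹ + 2 ν_A H⁰ H^A + g_{AB} H^A H^B)`. -/
def opL0 (x : Pt m) : ℝ :=
  (1 / 2) * n0 x *
    (-2 * (∑ A, (-(n0 x)⁻¹ * nuUp q nu x A) * opLA q n0 nu H0 HA x A)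
      - g11 x * opL1 q n0 H0 x
      - 2 * d1 H1 x
      - (tau q x + 2 * (n0 x)⁻¹ * d1 n0 x - n0 x * W0 x) * H1 x
      - divHA q HA x
      + (∑ A, xi q n0 nu W0 WA x A * HA x A)
      + n0 x * g11 x * d1 H0 x
      - (∑ A, nuUp q nu x A * dA A H0 x)
      + (g00 x * W0 x + n0 x * W1 x + (∑ A, nu x A * WA x A)
          + (1 / 2) * n0 x * tau q x * g11 x - g11 x * d1 n0 x
          - 2 * (n0 x)⁻¹ * d1 g00 x
          - (∑ A, ∑ B, (q x)⁻¹ A B * dA A (fun y => nu y B) x)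
          + 2 * (n0 x)⁻¹ * ∑ A, nuUp q nu x A * d1 (fun y => nu y A) x) * H0 x
      + (1 / 2) * (g00 x * H0 x ^ 2 + 2 * n0 x * H0 x * H1 x
          + 2 * (∑ A, nu x A * H0 x * HA x A)
          + ∑ A, ∑ B, q x A B * HA x A * HA x B))

end Operators

/-- The covector `(C₀, C₁, C_A)` for the metric components `g` and the vector field `W`. -/
def constraintC {m : ℕ} (g : Pt m → Comp m) (W : Pt m → Pt m) (x : Pt m) : Pt m :=
  Fin.cons
    (opC0 (angMetric g) (nuZero g) (nuAng g) (gUp g) (fun y => W y 0) (fun y => W y 1)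
      (fun y A => W y (ang A)) x)
    (Fin.cons (opC1 (angMetric g) (nuZero g) (fun y => W y 0) x)
      (opCA (angMetric g) (nuZero g) (nuAng g) (fun y => W y 0) (fun y A => W y (ang A)) x))

/-- The covector `(L₀, L₁, L_A)` for the metric components `g` and the vector fields `W`, `H`. -/
def constraintL {m : ℕ} (g : Pt m → Comp m) (W H : Pt m → Pt m) (x : Pt m) : Pt m :=
  Fin.cons
    (opL0 (angMetric g) (nuZero g) (nuAng g) (gUp g) (fun y => g y 0 0)
      (fun y => W y 0) (fun y => W y 1) (fun y A => W y (ang A))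
      (fun y => H y 0) (fun y => H y 1) (fun y A => H y (ang A)) x)
    (Fin.cons (opL1 (angMetric g) (nuZero g) (fun y => H y 0) x)
      (opLA (angMetric g) (nuZero g) (nuAng g) (fun y => H y 0) (fun y A => H y (ang A)) x))

/-! ## Coefficients of the hierarchy of ordinary differential operators

`Γ` stands for the Christoffel symbols `Γ̂^l_{ab}` of a target metric which is adapted to the
same null hypersurface. -/

section Hierarchy

variable {m : ℕ} (Γ : Pt m → Fin (m + 2) → Fin (m + 2) → Fin (m + 2) → ℝ)
  (q : Pt m → Matrix (Fin m) (Fin m) ℝ) (n0 : Pt m → ℝ) (nu : Pt m → Fin m → ℝ)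

/-- `W⁰ = 2 ν⁰ Γ̂⁰_{01} + g^{AB} Γ̂⁰_{AB}`. -/
def targetW0 (x : Pt m) : ℝ :=
  2 * (n0 x)⁻¹ * Γ x 0 0 1 + ∑ A, ∑ B, (q x)⁻¹ A B * Γ x 0 (ang A) (ang B)

/-- `W^A = 2 ν⁰ Γ̂^A_{01} - 2 ν⁰ ν^B Γ̂^A_{1B} + g^{BC} Γ̂^A_{BC}`. -/
def targetWA (x : Pt m) (A : Fin m) : ℝ :=
  2 * (n0 x)⁻¹ * Γ x (ang A) 0 1
    - 2 * (n0 x)⁻¹ * (∑ B, nuUp q nu x B * Γ x (ang A) 1 (ang B))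
    + ∑ B, ∑ C, (q x)⁻¹ B C * Γ x (ang A) (ang B) (ang C)

/-- `w = 2 ν⁰ Γ̂¹_{01} - 2 ν⁰ ν^B Γ̂¹_{1B} + g^{BC} Γ̂¹_{BC}`, so that `W¹ = Γ̂¹_{11} g^{11} + w`. -/
def targetW1 (x : Pt m) : ℝ :=
  2 * (n0 x)⁻¹ * Γ x 1 0 1 - 2 * (n0 x)⁻¹ * (∑ B, nuUp q nu x B * Γ x 1 1 (ang B))
    + ∑ B, ∑ C, (q x)⁻¹ B C * Γ x 1 (ang B) (ang C)

/-- `P_A^B = 4 ν⁰ χ_A^B + δ_A^B W⁰ - 2 ν⁰ g_{AC} Γ̂^C_{1D} g^{DB}`. -/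
def shiftP (x : Pt m) (A B : Fin m) : ℝ :=
  4 * (n0 x)⁻¹ * chi q x A B + (if A = B then targetW0 Γ q n0 x else 0)
    - 2 * (n0 x)⁻¹ * ∑ C, ∑ D, q x A C * Γ x (ang C) 1 (ang D) * (q x)⁻¹ D B

/-- `Q_A = 2 ν⁰ g_{AB} Γ̂^B_{01} + g_{AB} g^{CD} Γ̂^B_{CD} - Γ̃_A`. -/
def shiftQ (x : Pt m) (A : Fin m) : ℝ :=
  (∑ B, q x A B * (2 * (n0 x)⁻¹ * Γ x (ang B) 0 1
    + ∑ C, ∑ D, (q x)⁻¹ C D * Γ x (ang B) (ang C) (ang D))) - chrTrace q x A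

/-- Coefficient of `∂₁ν_B` in `C_A`. -/
def coeffA1 (x : Pt m) (A B : Fin m) : ℝ :=
  (if A = B then d1 (fun y => (n0 y)⁻¹) x + tau q x * (n0 x)⁻¹ else 0)
    - (1 / 2) * shiftP Γ q n0 x A B

/-- Coefficient of `ν_B` in `C_A`. -/
def coeffA0 (x : Pt m) (A B : Fin m) : ℝ :=
  -(1 / 2) * (d1 (fun y => shiftP Γ q n0 y A B) x + tau q x * shiftP Γ q n0 x A B)

/-- The part of `C_A` which does not involve `ν`. -/
def sourceA (x : Pt m) (A : Fin m) : ℝ :=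
  -(1 / 2) * (d1 (fun y => shiftQ Γ q n0 y A) x + tau q x * shiftQ Γ q n0 x A)
    + divChi q x A
    - (1 / 2) * dA A (fun y => tau q y - n0 y * targetW0 Γ q n0 y + 2 * (n0 y)⁻¹ * d1 n0 y) x

/-- `κ + τ`. -/
def outerK (x : Pt m) : ℝ := kappa q n0 (targetW0 Γ q n0) x + tau q x

/-- `κ + τ/2 + Γ̂¹_{11}`. -/
def innerJ (x : Pt m) : ℝ := kappa q n0 (targetW0 Γ q n0) x + tau q x / 2 + Γ x 1 1 1

/-- Coefficient of `∂₁g^{11}` in `-2 ν⁰ C₀`. -/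
def coeffZ1 (x : Pt m) : ℝ := 2 * (innerJ Γ q n0 x + outerK Γ q n0 x)

/-- Coefficient of `g^{11}` in `-2 ν⁰ C₀`. -/
def coeffZ0 (x : Pt m) : ℝ :=
  2 * (d1 (innerJ Γ q n0) x + outerK Γ q n0 x * innerJ Γ q n0 x)
    + opC1 q n0 (targetW0 Γ q n0) x

/-- The part of `-2 ν⁰ C₀` which does not involve `g^{11}`. -/
def sourceZ (x : Pt m) : ℝ :=
  2 * (d1 (targetW1 Γ q n0 nu) x + outerK Γ q n0 x * targetW1 Γ q n0 nu x)
    + scalarCurv (angBasis m) q x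
    - (1 / 2) * xiSq q n0 nu (targetW0 Γ q n0) (targetWA Γ q n0 nu) x
    + divXi q n0 nu (targetW0 Γ q n0) (targetWA Γ q n0 nu) x
    - 2 * (n0 x)⁻¹ * ∑ A, nuUp q nu x A
        * opCA q n0 nu (targetW0 Γ q n0) (targetWA Γ q n0 nu) x A

end Hierarchy

end NullConstraints

open NullConstraints

/-! Put `V = W + H`. By definition `V^λ = g^{αβ} Γ^λ_{αβ}` (`christoffelTrace`), so the target
metric drops out. The theorem rests on one fact: along a null hypersurface the covector `S_{αβ} ℓ^β`
is a function `E(V)` of the values of `g`, `ℓ` and `V` on the hypersurface alone. One takes `C =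
E(W)` and `L = E(W + H) - E(W)`; the sum telescopes to `E(V)`, and `L` vanishes for `H = 0`.

In adapted coordinates `E` is computed. Since `g₁₁` and `g_{1A}` vanish on the slice, few
Christoffel symbols survive, and `R₁₁`, `R_{A1}` contain only tangential derivatives of them
(`ricci11`, `ricciA1`). In `S₀₁ = R₀₁ - ½ ν₀ R` the component `R₀₁` cancels, because `R` contains `2
ν⁰ R₀₁`; what remains is the trace `g^{AB} R_{AB}`, found from a Gauss equation (`gauss`,
`trace_ricci`). The transversal derivatives of the metric that are left sit in `Γ¹₁₁`, `Γ¹_{A1}` and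
`g^{AB} Γ¹_{AB}`, and the components of `V` determine exactly these three: with `V` in the role of
`W`, `κ = Γ¹₁₁`, `ξ_A = -2 Γ¹_{A1}`, and the bracket in `C₀` is `g^{AB} Γ¹_{AB} + ½ τ g^{11}`. Hence
`S_{α1}` is `constraintC` evaluated at `V` (`AdaptedMetric.einstein_eq`), and expanding it at `W +
H` produces `constraintL` (`AdaptedMetric.constraintC_add`).

For a general null hypersurface, straightening a `C²` hypersurface would cost the metric a
derivative, so two metrics with the same data are compared directly. A function vanishing on the
level set `φ = 0` has first derivatives `φ_c k` there, and second derivatives governed by the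
Hessian of `φ`, the gradient of `k` and one further scalar (`exists_hessian_of_vanishing`). Equality
of the two vectors `V` forces `n^b k_{ab} = ½ (tr k) n_a` for `n = dφ`. This relation and the
nullity of `n` may be differentiated along the hypersurface, and with the results the jump of
`S_{ab} n^b` cancels identically (`jumpEinstein_eq_zero`, `MetricPair.einstein_jump`). So `E` may be
evaluated on any metric realising the data (`nullEinstein`).

Part 2 is substitution. A target metric adapted to the slice has `Γ̂⁰₁₁ = Γ̂⁰_{1A} = Γ̂^A₁₁ = 0`,
which makes `W`, and with it the system, triangular. The equations for `H` follow on subtracting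
from the splitting the difference of the Einstein and reduced Einstein tensors
(`MetricAt.reducedEinstein_eq`). -/

namespace NullConstraints

open Filter Topology

/-! ### Rules for directional derivatives. -/

section Calculus

variable {X ι : Type*} [NormedAddCommGroup X] [NormedSpace ℝ X] [Fintype ι]
  {f h : X → ℝ} {x : X} (v : X)

theorem lineDeriv_fun_add (hf : DifferentiableAt ℝ f x) (hh : DifferentiableAt ℝ h x) :
    lineDeriv ℝ (fun y => f y + h y) x v = lineDeriv ℝ f x v + lineDeriv ℝ h x v :=
  HasLineDerivAt.lineDeriv
    (HasDerivAt.fun_add (hf.lineDifferentiableAt.hasLineDerivAt)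
      (hh.lineDifferentiableAt.hasLineDerivAt))

theorem lineDeriv_fun_sub (hf : DifferentiableAt ℝ f x) (hh : DifferentiableAt ℝ h x) :
    lineDeriv ℝ (fun y => f y - h y) x v = lineDeriv ℝ f x v - lineDeriv ℝ h x v :=
  HasLineDerivAt.lineDeriv
    (HasDerivAt.fun_sub (hf.lineDifferentiableAt.hasLineDerivAt)
      (hh.lineDifferentiableAt.hasLineDerivAt))

theorem lineDeriv_fun_mul (hf : DifferentiableAt ℝ f x) (hh : DifferentiableAt ℝ h x) :
    lineDeriv ℝ (fun y => f y * h y) x v = lineDeriv ℝ f x v * h x + f x * lineDeriv ℝ h x v := by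
  refine HasLineDerivAt.lineDeriv ?_
  have := HasDerivAt.fun_mul (hf.lineDifferentiableAt.hasLineDerivAt (v := v))
      (hh.lineDifferentiableAt.hasLineDerivAt (v := v))
  simpa [HasLineDerivAt] using this

theorem lineDeriv_const_fun_mul (c : ℝ) (f : X → ℝ) :
    lineDeriv ℝ (fun y => c * f y) x v = c * lineDeriv ℝ f x v := by
  simp only [lineDeriv]
  exact deriv_const_mul_field c

theorem lineDeriv_fun_sum {F : ι → X → ℝ} (hF : ∀ i, DifferentiableAt ℝ (F i) x) :
    lineDeriv ℝ (fun y => ∑ i, F i y) x v = ∑ i, lineDeriv ℝ (F i) x v :=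
  HasLineDerivAt.lineDeriv
    (HasDerivAt.fun_sum fun i _ => (hF i).lineDifferentiableAt.hasLineDerivAt)

theorem lineDeriv_fun_const (c : ℝ) : lineDeriv ℝ (fun _ : X => c) x v = 0 := by
  simp [lineDeriv]

theorem ContDiffAt.lineDeriv_right {n k : ℕ∞} (hf : ContDiffAt ℝ n f x) (hk : k + 1 ≤ n)
    (hn : n ≠ ⊤) : ContDiffAt ℝ k (fun y => lineDeriv ℝ f y v) x := by
  have h1 : ContDiffAt ℝ k (fun y => fderiv ℝ f y v) x :=
    (hf.fderiv_right (m := k) (by exact_mod_cast hk)).clm_apply contDiffAt_const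
  refine h1.congr_of_eventuallyEq ?_
  -- For `n ≠ ⊤`, being `C^n` at a point persists nearby, so there the line derivative is the
  -- Fréchet derivative.
  filter_upwards [hf.eventually (by exact_mod_cast hn)] with y hy
  exact (hy.differentiableAt (fun h0 => by
    have : n = 0 := by exact_mod_cast h0
    simp [this] at hk)).lineDeriv_eq_fderiv

theorem lineDeriv_comm (hf : ContDiffAt ℝ 2 f x) (v w : X) :
    lineDeriv ℝ (fun y => lineDeriv ℝ f y v) x w
      = lineDeriv ℝ (fun y => lineDeriv ℝ f y w) x v := by
  have key : ∀ v w : X, lineDeriv ℝ (fun y => lineDeriv ℝ f y v) x w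
      = fderiv ℝ (fderiv ℝ f) x w v := by
    intro v w
    have h1 : (fun y => lineDeriv ℝ f y v) =ᶠ[𝓝 x] fun y => fderiv ℝ f y v := by
      filter_upwards [hf.eventually (by decide)] with y hy
      exact (hy.differentiableAt (by decide)).lineDeriv_eq_fderiv
    have h2 : DifferentiableAt ℝ (fderiv ℝ f) x :=
      (hf.fderiv_right (m := 1) (by norm_num)).differentiableAt (by decide)
    rw [h1.lineDeriv_eq, (h2.clm_apply (differentiableAt_const v)).lineDeriv_eq_fderiv,
      fderiv_clm_apply h2 (differentiableAt_const v)]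
    simp
  rw [key, key]
  exact (hf.isSymmSndFDerivAt (by simp)).eq w v

end Calculus

/-! ### Christoffel symbols and the curvature tensor of a `C²` metric in coordinates. -/

section Curvature

variable {X ι : Type*} [NormedAddCommGroup X] [NormedSpace ℝ X] [Fintype ι] [DecidableEq ι]

/-- Near `x`, the components `g` form a `C²` field of symmetric nondegenerate matrices. -/
structure MetricAt (g : X → Matrix ι ι ℝ) (x : X) : Prop where
  smooth : ∀ i j, ContDiffAt ℝ 2 (fun y => g y i j) x
  symm : ∀ᶠ y in 𝓝 x, (g y).IsSymm
  det_ne : (g x).det ≠ 0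

theorem ContDiffAt.det {n : WithTop ℕ∞} {g : X → Matrix ι ι ℝ} {x : X}
    (h : ∀ i j, ContDiffAt ℝ n (fun y => g y i j) x) : ContDiffAt ℝ n (fun y => (g y).det) x := by
  simp only [Matrix.det_apply]
  refine ContDiffAt.sum fun σ _ => ?_
  exact ContDiffAt.const_smul _ (contDiffAt_prod fun i _ => h _ _)

namespace MetricAt

variable {g : X → Matrix ι ι ℝ} {x : X} (hg : MetricAt g x)
include hg

theorem symm_at : (g x).IsSymm := hg.symm.self_of_nhds

theorem comm_at (i j : ι) : g x i j = g x j i := hg.symm_at.apply j i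

theorem eventually : ∀ᶠ y in 𝓝 x, MetricAt g y := by
  have h1 : ∀ᶠ y in 𝓝 x, ∀ i j, ContDiffAt ℝ 2 (fun y => g y i j) y :=
    eventually_all.2 fun i => eventually_all.2 fun j => (hg.smooth i j).eventually (by decide)
  have h2 : ∀ᶠ y in 𝓝 x, (g y).det ≠ 0 :=
    (ContDiffAt.det hg.smooth).continuousAt.eventually_ne hg.det_ne
  filter_upwards [h1, h2, hg.symm.eventually_nhds] with y h1 h2 h3
  exact ⟨h1, h3, h2⟩

theorem isUnit_det : IsUnit (g x).det := isUnit_iff_ne_zero.2 hg.det_ne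

/-- Cramer's rule: the inverse is the adjugate divided by the determinant, and both are polynomial
in the entries. -/
theorem inv_smooth (i j : ι) : ContDiffAt ℝ 2 (fun y => (g y)⁻¹ i j) x := by
  simp only [Matrix.inv_def, Matrix.smul_apply, smul_eq_mul, Ring.inverse_eq_inv']
  refine ((ContDiffAt.det hg.smooth).inv hg.det_ne).mul ?_
  simp only [Matrix.adjugate_apply]
  refine ContDiffAt.det fun a b => ?_
  by_cases ha : a = j
  · subst ha
    simp only [Matrix.updateRow_self]
    exact contDiffAt_const
  · simpa only [Matrix.updateRow_ne ha] using hg.smooth a b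

theorem differentiableAt (i j : ι) : DifferentiableAt ℝ (fun y => g y i j) x :=
  (hg.smooth i j).differentiableAt (by decide)

theorem inv_differentiableAt (i j : ι) : DifferentiableAt ℝ (fun y => (g y)⁻¹ i j) x :=
  (hg.inv_smooth i j).differentiableAt (by decide)

theorem lineDeriv_smooth (i j : ι) (v : X) :
    ContDiffAt ℝ 1 (fun y => lineDeriv ℝ (fun z => g z i j) y v) x :=
  ContDiffAt.lineDeriv_right (n := 2) (k := 1) v (hg.smooth i j) (by norm_num) (by decide)

theorem inv_comm_at (i j : ι) : (g x)⁻¹ i j = (g x)⁻¹ j i := by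
  have := hg.symm_at.inv
  exact this.apply j i

theorem mul_inv_apply (i j : ι) : ∑ k, g x i k * (g x)⁻¹ k j = if i = j then 1 else 0 := by
  rw [← Matrix.mul_apply, Matrix.mul_nonsing_inv _ hg.isUnit_det, Matrix.one_apply]

theorem inv_mul_apply (i j : ι) : ∑ k, (g x)⁻¹ i k * g x k j = if i = j then 1 else 0 := by
  rw [← Matrix.mul_apply, Matrix.nonsing_inv_mul _ hg.isUnit_det, Matrix.one_apply]

theorem lineDeriv_comm_at (i j : ι) (v : X) :
    lineDeriv ℝ (fun y => g y i j) x v = lineDeriv ℝ (fun y => g y j i) x v := by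
  refine EventuallyEq.lineDeriv_eq ?_
  filter_upwards [hg.symm] with y hy
  exact hy.apply j i

/-- Differentiate `g⁻¹ g = 1`, which holds on a neighbourhood, and multiply by `g⁻¹` on the right.
-/
theorem lineDeriv_inv (i j : ι) (v : X) :
    lineDeriv ℝ (fun y => (g y)⁻¹ i j) x v
      = -∑ k, ∑ l, (g x)⁻¹ i k * lineDeriv ℝ (fun y => g y k l) x v * (g x)⁻¹ l j := by
  have h0 : ∀ k, ∑ l, (lineDeriv ℝ (fun y => (g y)⁻¹ i l) x v * g x l k
      + (g x)⁻¹ i l * lineDeriv ℝ (fun y => g y l k) x v) = 0 := by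
    intro k
    have h1 : (fun y => ∑ l, (g y)⁻¹ i l * g y l k) =ᶠ[𝓝 x] fun _ => if i = k then 1 else 0 := by
      filter_upwards [hg.eventually] with y hy
      exact hy.inv_mul_apply i k
    have h2 := h1.lineDeriv_eq (𝕜 := ℝ) (v := v)
    rw [lineDeriv_fun_const, lineDeriv_fun_sum v
      fun l => (hg.inv_differentiableAt i l).fun_mul (hg.differentiableAt l k)] at h2
    rw [← h2]
    exact Finset.sum_congr rfl fun l _ => (lineDeriv_fun_mul v (hg.inv_differentiableAt i l)
      (hg.differentiableAt l k)).symm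
  have h3 : ∑ k, (∑ l, (lineDeriv ℝ (fun y => (g y)⁻¹ i l) x v * g x l k
      + (g x)⁻¹ i l * lineDeriv ℝ (fun y => g y l k) x v)) * (g x)⁻¹ k j = 0 := by
    simp [h0]
  simp only [Finset.sum_add_distrib, add_mul, Finset.sum_mul] at h3
  have h4 : ∑ k, ∑ l, lineDeriv ℝ (fun y => (g y)⁻¹ i l) x v * g x l k * (g x)⁻¹ k j
      = lineDeriv ℝ (fun y => (g y)⁻¹ i j) x v := by
    rw [Finset.sum_comm]
    simp only [mul_assoc, ← Finset.mul_sum, hg.mul_inv_apply]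
    simp
  rw [h4, Finset.sum_comm] at h3
  linarith

end MetricAt

/-- The Christoffel symbols of the first kind, `[ab, k]`. -/
def christoffelLow (e : ι → X) (g : X → Matrix ι ι ℝ) (x : X) (a b k : ι) : ℝ :=
  (1 / 2) * (lineDeriv ℝ (fun y => g y b k) x (e a)
    + lineDeriv ℝ (fun y => g y a k) x (e b) - lineDeriv ℝ (fun y => g y a b) x (e k))

theorem christoffel_eq (e : ι → X) (g : X → Matrix ι ι ℝ) (x : X) (l a b : ι) :
    christoffel e g x l a b = ∑ k, (g x)⁻¹ l k * christoffelLow e g x a b k := rfl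

/-- The curvature tensor `R^c_{adb} = ∂_d Γ^c_{ba} - ∂_b Γ^c_{da} + Γ^c_{dl} Γ^l_{ba}
- Γ^c_{bl} Γ^l_{da}`. -/
def riemann (e : ι → X) (g : X → Matrix ι ι ℝ) (x : X) (c a d b : ι) : ℝ :=
  lineDeriv ℝ (fun y => christoffel e g y c b a) x (e d)
    - lineDeriv ℝ (fun y => christoffel e g y c d a) x (e b)
    + (∑ l, christoffel e g x c d l * christoffel e g x l b a)
    - ∑ l, christoffel e g x c b l * christoffel e g x l d a

/-- The curvature tensor `R_{kadb}` with all indices down. -/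
def riemannLow (e : ι → X) (g : X → Matrix ι ι ℝ) (x : X) (k a d b : ι) : ℝ :=
  lineDeriv ℝ (fun y => christoffelLow e g y b a k) x (e d)
    - lineDeriv ℝ (fun y => christoffelLow e g y d a k) x (e b)
    - (∑ l, christoffelLow e g x d k l * christoffel e g x l b a)
    + ∑ l, christoffelLow e g x b k l * christoffel e g x l d a

theorem riemannLow_antisymm_right (e : ι → X) (g : X → Matrix ι ι ℝ) (x : X) (k a d b : ι) :
    riemannLow e g x k a d b = -riemannLow e g x k a b d := by
  rw [riemannLow, riemannLow]
  ring

namespace MetricAt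

variable {g : X → Matrix ι ι ℝ} {x : X} (hg : MetricAt g x) (e : ι → X)
include hg

theorem christoffelLow_smooth (a b k : ι) :
    ContDiffAt ℝ 1 (fun y => christoffelLow e g y a b k) x :=
  contDiffAt_const.mul (((hg.lineDeriv_smooth _ _ _).add (hg.lineDeriv_smooth _ _ _)).sub
    (hg.lineDeriv_smooth _ _ _))

theorem christoffel_smooth (l a b : ι) :
    ContDiffAt ℝ 1 (fun y => christoffel e g y l a b) x := by
  simp only [christoffel_eq]
  exact ContDiffAt.sum fun k _ =>
    ((hg.inv_smooth l k).of_le (by norm_num)).mul (hg.christoffelLow_smooth e a b k)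

theorem christoffelLow_differentiableAt (a b k : ι) :
    DifferentiableAt ℝ (fun y => christoffelLow e g y a b k) x :=
  (hg.christoffelLow_smooth e a b k).differentiableAt (by decide)

theorem christoffel_differentiableAt (a b k : ι) :
    DifferentiableAt ℝ (fun y => christoffel e g y a b k) x :=
  (hg.christoffel_smooth e a b k).differentiableAt (by decide)

theorem christoffelLow_comm (a b k : ι) :
    christoffelLow e g x a b k = christoffelLow e g x b a k := by
  simp only [christoffelLow, hg.lineDeriv_comm_at a b]
  ring

theorem christoffel_comm (l a b : ι) : christoffel e g x l a b = christoffel e g x l b a := by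
  simp only [christoffel_eq, hg.christoffelLow_comm e a b]

theorem lineDeriv_eq_christoffelLow (a b c : ι) :
    lineDeriv ℝ (fun y => g y a b) x (e c)
      = christoffelLow e g x c a b + christoffelLow e g x c b a := by
  simp only [christoffelLow, hg.lineDeriv_comm_at b a, hg.lineDeriv_comm_at c a,
    hg.lineDeriv_comm_at c b]
  ring

/-- Both sides equal `g^{lm} [ab,l] [cd,m]`, and `g⁻¹` is symmetric. -/
theorem sum_christoffelLow_mul_comm (a b c d : ι) :
    ∑ l, christoffelLow e g x a b l * christoffel e g x l c d
      = ∑ l, christoffelLow e g x c d l * christoffel e g x l a b := by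
  simp only [christoffel_eq, Finset.mul_sum]
  rw [Finset.sum_comm]
  refine Finset.sum_congr rfl fun i _ => Finset.sum_congr rfl fun j _ => ?_
  rw [hg.inv_comm_at j i]
  ring

theorem lineDeriv_christoffelLow (a b k d : ι) :
    lineDeriv ℝ (fun y => christoffelLow e g y a b k) x (e d)
      = (1 / 2) * (lineDeriv ℝ (fun y => lineDeriv ℝ (fun z => g z b k) y (e a)) x (e d)
        + lineDeriv ℝ (fun y => lineDeriv ℝ (fun z => g z a k) y (e b)) x (e d)
        - lineDeriv ℝ (fun y => lineDeriv ℝ (fun z => g z a b) y (e k)) x (e d)) := by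
  have h : ∀ i j v, DifferentiableAt ℝ (fun y => lineDeriv ℝ (fun z => g z i j) y v) x :=
    fun i j v => (hg.lineDeriv_smooth i j v).differentiableAt (by decide)
  simp only [christoffelLow]
  rw [lineDeriv_const_fun_mul, lineDeriv_fun_sub _ ((h _ _ _).fun_add (h _ _ _)) (h _ _ _),
    lineDeriv_fun_add _ (h _ _ _) (h _ _ _)]

theorem lineDeriv_lineDeriv_comm (i j : ι) (v w : X) :
    lineDeriv ℝ (fun y => lineDeriv ℝ (fun z => g z i j) y v) x w
      = lineDeriv ℝ (fun y => lineDeriv ℝ (fun z => g z j i) y v) x w := by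
  refine EventuallyEq.lineDeriv_eq ?_
  filter_upwards [hg.eventually] with y hy
  exact hy.lineDeriv_comm_at i j v

/-- Of the six second derivatives in the definition, the two of `g_{ak}` cancel by commutation. The
four that are left display the algebraic symmetries of the tensor. -/
theorem riemannLow_eq (k a d b : ι) :
    riemannLow e g x k a d b
      = (1 / 2) * (lineDeriv ℝ (fun y => lineDeriv ℝ (fun z => g z b k) y (e a)) x (e d)
          + lineDeriv ℝ (fun y => lineDeriv ℝ (fun z => g z d a) y (e k)) x (e b)
          - lineDeriv ℝ (fun y => lineDeriv ℝ (fun z => g z b a) y (e k)) x (e d)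
          - lineDeriv ℝ (fun y => lineDeriv ℝ (fun z => g z d k) y (e a)) x (e b))
        - (∑ l, christoffelLow e g x d k l * christoffel e g x l b a)
        + ∑ l, christoffelLow e g x b k l * christoffel e g x l d a := by
  rw [riemannLow, hg.lineDeriv_christoffelLow, hg.lineDeriv_christoffelLow,
    lineDeriv_comm (hg.smooth a k) (e b) (e d)]
  ring

theorem riemannLow_antisymm_left (k a d b : ι) :
    riemannLow e g x k a d b = -riemannLow e g x a k d b := by
  rw [hg.riemannLow_eq, hg.riemannLow_eq, hg.sum_christoffelLow_mul_comm e d k b a,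
    hg.sum_christoffelLow_mul_comm e b k d a]
  ring

theorem riemannLow_self (a d b : ι) : riemannLow e g x a a d b = 0 := by
  linarith [hg.riemannLow_antisymm_left e a a d b]

theorem riemannLow_pair (k a d b : ι) :
    riemannLow e g x k a d b = riemannLow e g x d b k a := by
  rw [hg.riemannLow_eq, hg.riemannLow_eq, hg.lineDeriv_lineDeriv_comm b k,
    hg.lineDeriv_lineDeriv_comm a d, lineDeriv_comm (hg.smooth k b) (e a) (e d),
    lineDeriv_comm (hg.smooth d a) (e k) (e b), hg.lineDeriv_lineDeriv_comm b a,
    hg.lineDeriv_lineDeriv_comm k d,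
    lineDeriv_comm (hg.smooth a b) (e k) (e d), lineDeriv_comm (hg.smooth d k) (e a) (e b)]
  simp only [hg.christoffelLow_comm e d k, hg.christoffel_comm e _ b a,
    hg.christoffelLow_comm e b k, hg.christoffel_comm e _ d a,
    hg.sum_christoffelLow_mul_comm e k b a d]
  ring

/-- Pulling `g⁻¹` out of `∂Γ` costs a derivative of `g⁻¹`. By metric compatibility this has two
parts: one cancels the quadratic term `Γ Γ`, the other is the quadratic term of `riemannLow`, with
the opposite sign. -/
theorem riemann_eq (c a d b : ι) :
    riemann e g x c a d b = ∑ k, (g x)⁻¹ c k * riemannLow e g x k a d b := by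
  have key : ∀ a b d, lineDeriv ℝ (fun y => christoffel e g y c b a) x (e d)
      + ∑ l, christoffel e g x c d l * christoffel e g x l b a
      = ∑ k, (g x)⁻¹ c k * (lineDeriv ℝ (fun y => christoffelLow e g y b a k) x (e d)
        - ∑ l, christoffelLow e g x d k l * christoffel e g x l b a) := by
    intro a b d
    simp only [christoffel_eq e g _ c b a]
    rw [lineDeriv_fun_sum _ fun k => (hg.inv_differentiableAt c k).fun_mul
      (hg.christoffelLow_differentiableAt e b a k)]
    have h1 : ∀ k, lineDeriv ℝ (fun y => (g y)⁻¹ c k * christoffelLow e g y b a k) x (e d)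
        = lineDeriv ℝ (fun y => (g y)⁻¹ c k) x (e d) * christoffelLow e g x b a k
          + (g x)⁻¹ c k * lineDeriv ℝ (fun y => christoffelLow e g y b a k) x (e d) := fun k =>
      lineDeriv_fun_mul _ (hg.inv_differentiableAt c k) (hg.christoffelLow_differentiableAt e b a k)
    simp only [h1, Finset.sum_add_distrib, mul_sub, Finset.sum_sub_distrib]
    -- Here `∂g⁻¹ = -g⁻¹ (∂g) g⁻¹` and `∂_d g_{ij} = [di,j] + [dj,i]`.
    have h2 : ∑ k, lineDeriv ℝ (fun y => (g y)⁻¹ c k) x (e d) * christoffelLow e g x b a k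
        = -∑ i, ∑ j, (g x)⁻¹ c i * (christoffelLow e g x d i j + christoffelLow e g x d j i)
            * christoffel e g x j b a := by
      simp only [hg.lineDeriv_inv, ← hg.lineDeriv_eq_christoffelLow, christoffel_eq e g x _ b a,
        neg_mul, Finset.sum_mul, Finset.mul_sum, Finset.sum_neg_distrib]
      congr 1
      rw [Finset.sum_comm]
      refine Finset.sum_congr rfl fun i _ => ?_
      rw [Finset.sum_comm]
      exact Finset.sum_congr rfl fun i _ => Finset.sum_congr rfl fun j _ => by ring
    have h3 : ∑ l, christoffel e g x c d l * christoffel e g x l b a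
        = ∑ i, ∑ j, (g x)⁻¹ c i * christoffelLow e g x d j i * christoffel e g x j b a := by
      simp only [christoffel_eq e g x c, Finset.sum_mul]
      exact Finset.sum_comm
    rw [h2, h3]
    simp only [mul_add, add_mul, Finset.sum_add_distrib, Finset.mul_sum, mul_assoc]
    ring
  rw [riemann]
  have h1 := key a b d
  have h2 := key a d b
  have h3 : ∀ k, (g x)⁻¹ c k * riemannLow e g x k a d b
    = (g x)⁻¹ c k * (lineDeriv ℝ (fun y => christoffelLow e g y b a k) x (e d)
        - ∑ l, christoffelLow e g x d k l * christoffel e g x l b a)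
      - (g x)⁻¹ c k * (lineDeriv ℝ (fun y => christoffelLow e g y d a k) x (e b)
        - ∑ l, christoffelLow e g x b k l * christoffel e g x l d a) := fun k => by
    rw [riemannLow]; ring
  simp only [h3, Finset.sum_sub_distrib, ← h1, ← h2]
  ring

theorem ricci_eq (a b : ι) : ricci e g x a b = ∑ c, riemann e g x c b c a := by
  have h : ∀ l, lineDeriv ℝ (fun y => christoffel e g y l b l) x (e a)
      = lineDeriv ℝ (fun y => christoffel e g y l l b) x (e a) := fun l => by
    refine EventuallyEq.lineDeriv_eq ?_
    filter_upwards [hg.eventually] with y hy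
    exact hy.christoffel_comm e l b l
  simp only [ricci, riemann, h, Finset.sum_add_distrib, Finset.sum_sub_distrib]
  congr 1
  · congr 1
    rw [Finset.sum_comm]
    exact Finset.sum_congr rfl fun i _ => Finset.sum_congr rfl fun j _ => by
      rw [hg.christoffel_comm e i j i]; ring
  · exact Finset.sum_congr rfl fun i _ => Finset.sum_congr rfl fun j _ => by
      rw [hg.christoffel_comm e j b i]

theorem ricci_eq_low (a b : ι) :
    ricci e g x a b = ∑ c, ∑ d, (g x)⁻¹ c d * riemannLow e g x d b c a := by
  simp only [hg.ricci_eq, hg.riemann_eq]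

end MetricAt

end Curvature

/-! ### Adapted coordinates: tangential derivatives, the inverse metric and the Christoffel symbols
on the slice. -/

section Slice

variable {m : ℕ}

theorem sum_univ_ang (f : Fin (m + 2) → ℝ) : ∑ i, f i = f 0 + f 1 + ∑ A, f (ang A) := by
  simp [Fin.sum_univ_succ, ang, add_assoc]

theorem zero_ne_ang (A : Fin m) : (0 : Fin (m + 2)) ≠ ang A := (Fin.succ_ne_zero _).symm

theorem one_ne_ang (A : Fin m) : (1 : Fin (m + 2)) ≠ ang A := fun h => by
  have := congrArg Fin.val h
  simp [ang] at this

theorem ang_inj {A B : Fin m} : ang A = ang B ↔ A = B := by simp [ang]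

theorem basis_one_zero : basis m 1 0 = 0 := by simp [basis]

theorem angBasis_zero (A : Fin m) : angBasis m A 0 = 0 := by
  simp [basis, angBasis, zero_ne_ang]

/-- A line whose direction has no `0`-component stays in `x⁰ = 0`, and for small parameters in `U`.
Only the values on the slice enter, and no differentiability is needed. -/
theorem lineDeriv_congr_slice {U : Set (Pt m)} (hU : IsOpen U) {f h : Pt m → ℝ}
    (hfh : ∀ y ∈ slice U, f y = h y) {x : Pt m} (hx : x ∈ slice U) {v : Pt m} (hv : v 0 = 0) :
    lineDeriv ℝ f x v = lineDeriv ℝ h x v := by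
  refine EventuallyEq.deriv_eq ?_
  have hc : ContinuousAt (fun t : ℝ => x + t • v) 0 := by fun_prop
  have : ∀ᶠ t in 𝓝 (0 : ℝ), x + t • v ∈ U :=
    hc.eventually_mem (by simpa using hU.mem_nhds hx.1)
  filter_upwards [this] with t ht
  exact hfh _ ⟨ht, by simp [hv, hx.2]⟩

theorem d1_congr_slice {U : Set (Pt m)} (hU : IsOpen U) {f h : Pt m → ℝ}
    (hfh : ∀ y ∈ slice U, f y = h y) {x : Pt m} (hx : x ∈ slice U) : d1 f x = d1 h x :=
  lineDeriv_congr_slice hU hfh hx basis_one_zero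

theorem dA_congr_slice {U : Set (Pt m)} (hU : IsOpen U) {f h : Pt m → ℝ}
    (hfh : ∀ y ∈ slice U, f y = h y) {x : Pt m} (hx : x ∈ slice U) (A : Fin m) :
    dA A f x = dA A h x :=
  lineDeriv_congr_slice hU hfh hx (angBasis_zero A)

theorem d1_eq_zero_slice {U : Set (Pt m)} (hU : IsOpen U) {f : Pt m → ℝ}
    (hf : ∀ y ∈ slice U, f y = 0) {x : Pt m} (hx : x ∈ slice U) : d1 f x = 0 := by
  rw [d1_congr_slice hU hf hx]; exact lineDeriv_fun_const _ 0

theorem dA_eq_zero_slice {U : Set (Pt m)} (hU : IsOpen U) {f : Pt m → ℝ}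
    (hf : ∀ y ∈ slice U, f y = 0) {x : Pt m} (hx : x ∈ slice U) (A : Fin m) : dA A f x = 0 := by
  rw [dA_congr_slice hU hf hx]; exact lineDeriv_fun_const _ 0

section Rules

variable {f h : Pt m → ℝ} {x : Pt m}

theorem d1_fun_add (hf : DifferentiableAt ℝ f x) (hh : DifferentiableAt ℝ h x) :
    d1 (fun y => f y + h y) x = d1 f x + d1 h x := lineDeriv_fun_add _ hf hh

theorem d1_fun_sub (hf : DifferentiableAt ℝ f x) (hh : DifferentiableAt ℝ h x) :
    d1 (fun y => f y - h y) x = d1 f x - d1 h x := lineDeriv_fun_sub _ hf hh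

theorem d1_fun_mul (hf : DifferentiableAt ℝ f x) (hh : DifferentiableAt ℝ h x) :
    d1 (fun y => f y * h y) x = d1 f x * h x + f x * d1 h x :=
  lineDeriv_fun_mul _ hf hh

theorem d1_const_mul (c : ℝ) (f : Pt m → ℝ) : d1 (fun y => c * f y) x = c * d1 f x :=
  lineDeriv_const_fun_mul _ c f

theorem d1_fun_sum {F : Fin m → Pt m → ℝ} (hF : ∀ i, DifferentiableAt ℝ (F i) x) :
    d1 (fun y => ∑ i, F i y) x = ∑ i, d1 (F i) x := lineDeriv_fun_sum _ hF

theorem dA_fun_add (hf : DifferentiableAt ℝ f x) (hh : DifferentiableAt ℝ h x) (A : Fin m) :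
    dA A (fun y => f y + h y) x = dA A f x + dA A h x :=
  lineDeriv_fun_add _ hf hh

theorem dA_fun_sub (hf : DifferentiableAt ℝ f x) (hh : DifferentiableAt ℝ h x) (A : Fin m) :
    dA A (fun y => f y - h y) x = dA A f x - dA A h x :=
  lineDeriv_fun_sub _ hf hh

theorem dA_fun_mul (hf : DifferentiableAt ℝ f x) (hh : DifferentiableAt ℝ h x) (A : Fin m) :
    dA A (fun y => f y * h y) x = dA A f x * h x + f x * dA A h x := lineDeriv_fun_mul _ hf hh

theorem dA_const_mul (A : Fin m) (c : ℝ) (f : Pt m → ℝ) :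
    dA A (fun y => c * f y) x = c * dA A f x := lineDeriv_const_fun_mul _ c f

theorem dA_fun_sum (A : Fin m) {F : Fin m → Pt m → ℝ} (hF : ∀ i, DifferentiableAt ℝ (F i) x) :
    dA A (fun y => ∑ i, F i y) x = ∑ i, dA A (F i) x := lineDeriv_fun_sum _ hF

end Rules

/-- A `C²` pseudo-Riemannian metric on an open set `U`, in coordinates adapted to the null
hypersurface `x⁰ = 0`. -/
structure AdaptedMetric (U : Set (Pt m)) (g : Pt m → Comp m) : Prop where
  isOpen : IsOpen U
  metric : IsPseudoMetric U g
  adapted : IsAdapted g (slice U)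

theorem IsPseudoMetric.metricAt {U : Set (Pt m)} {g : Pt m → Comp m} (hg : IsPseudoMetric U g)
    (hU : IsOpen U) {x : Pt m} (hx : x ∈ U) : MetricAt g x where
  smooth i j := (hg.contDiffOn i j).contDiffAt (hU.mem_nhds hx)
  symm := by
    filter_upwards [hU.mem_nhds hx] with y hy
    exact hg.symm y hy
  det_ne := hg.nondegenerate x hx

theorem IsLorentzMetric.isPseudoMetric {U : Set (Pt m)} {g : Pt m → Comp m}
    (hg : IsLorentzMetric U g) : IsPseudoMetric U g where
  contDiffOn := hg.contDiffOn
  symm x hx := (hg.lorentzian x hx).1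
  nondegenerate x hx h0 := by
    obtain ⟨-, P, -, hP⟩ := hg.lorentzian x hx
    have h1 := congrArg Matrix.det hP
    rw [Matrix.det_mul, Matrix.det_mul, h0, Matrix.det_diagonal] at h1
    have h2 : ∏ i : Fin (m + 2), (if i = 0 then (-1 : ℝ) else 1) ≠ 0 :=
      Finset.prod_ne_zero_iff.2 fun i _ => by split_ifs <;> norm_num
    exact h2 (by simpa using h1.symm)

namespace AdaptedMetric

variable {U : Set (Pt m)} {g : Pt m → Comp m} (hg : AdaptedMetric U g) {x : Pt m}
  (hx : x ∈ slice U)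
include hg hx

theorem metricAt : MetricAt g x := hg.metric.metricAt hg.isOpen hx.1

theorem g11 : g x 1 1 = 0 := (hg.adapted x hx).1
theorem g1A (A : Fin m) : g x 1 (ang A) = 0 := (hg.adapted x hx).2 A
theorem gA1 (A : Fin m) : g x (ang A) 1 = 0 := by
  rw [(hg.metricAt hx).comm_at, hg.g1A hx]

/-- On the slice row `1` of `g` is `(ν₀, 0, …, 0)`, so row `1` of `g g⁻¹ = 1` gives all of row `0`
of the inverse; it also shows `ν₀ ≠ 0`. -/
theorem nuZero_mul_inv (j : Fin (m + 2)) : nuZero g x * (g x)⁻¹ 0 j = if 1 = j then 1 else 0 := by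
  have h := (hg.metricAt hx).mul_inv_apply 1 j
  rw [sum_univ_ang] at h
  simp only [hg.g11 hx, hg.g1A hx, zero_mul, add_zero, Finset.sum_const_zero] at h
  rwa [(hg.metricAt hx).comm_at] at h

theorem nuZero_ne : nuZero g x ≠ 0 := fun h => by
  have := hg.nuZero_mul_inv hx 1
  simp [h] at this

theorem inv00 : (g x)⁻¹ 0 0 = 0 := by
  have := hg.nuZero_mul_inv hx 0
  simpa [hg.nuZero_ne hx] using this

theorem inv01 : (g x)⁻¹ 0 1 = (nuZero g x)⁻¹ := by
  have := hg.nuZero_mul_inv hx 1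
  rw [if_pos rfl] at this
  exact eq_inv_of_mul_eq_one_right this

theorem inv10 : (g x)⁻¹ 1 0 = (nuZero g x)⁻¹ := by
  rw [(hg.metricAt hx).inv_comm_at, hg.inv01 hx]

theorem inv0A (A : Fin m) : (g x)⁻¹ 0 (ang A) = 0 := by
  have := hg.nuZero_mul_inv hx (ang A)
  rw [if_neg (one_ne_ang A)] at this
  exact (mul_eq_zero.1 this).resolve_left (hg.nuZero_ne hx)

theorem invA0 (A : Fin m) : (g x)⁻¹ (ang A) 0 = 0 := by
  rw [(hg.metricAt hx).inv_comm_at, hg.inv0A hx]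

/-- Since `g_{A1} = 0` and `g^{0B} = 0`, the `(A,B)` entry of `g g⁻¹ = 1` involves only the angular
blocks. -/
theorem angMetric_mul : angMetric g x * (Matrix.of fun A B => (g x)⁻¹ (ang A) (ang B)) = 1 := by
  ext A B
  have h := (hg.metricAt hx).mul_inv_apply (ang A) (ang B)
  rw [sum_univ_ang, hg.inv0A hx, hg.gA1 hx] at h
  simpa [Matrix.mul_apply, Matrix.one_apply, angMetric, ang_inj] using h

theorem angMetric_det_ne : (angMetric g x).det ≠ 0 :=
  (Matrix.isUnit_det_of_right_inverse (hg.angMetric_mul hx)).ne_zero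

theorem angMetricAt : MetricAt (angMetric g) x where
  smooth A B := (hg.metricAt hx).smooth (ang A) (ang B)
  symm := by
    filter_upwards [(hg.metricAt hx).symm] with y hy
    exact Matrix.IsSymm.ext fun A B => hy.apply (ang A) (ang B)
  det_ne := hg.angMetric_det_ne hx

theorem invAB (A B : Fin m) : (g x)⁻¹ (ang A) (ang B) = (angMetric g x)⁻¹ A B := by
  rw [Matrix.inv_eq_right_inv (hg.angMetric_mul hx)]
  rfl

/-- The entry `(B,1)` of `g g⁻¹ = 1` reads `g_{BC} g^{C1} = -ν⁰ ν_B`, to be solved with the inverse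
angular block. -/
theorem invA1 (A : Fin m) :
    (g x)⁻¹ (ang A) 1 = -(nuZero g x)⁻¹ * nuUp (angMetric g) (nuAng g) x A := by
  have h : ∀ B, ∑ C, angMetric g x B C * (g x)⁻¹ (ang C) 1 = -(nuZero g x)⁻¹ * nuAng g x B := by
    intro B
    have h := (hg.metricAt hx).mul_inv_apply (ang B) 1
    rw [sum_univ_ang, hg.inv01 hx, hg.gA1 hx, if_neg (one_ne_ang B).symm,
      (hg.metricAt hx).comm_at] at h
    simp only [angMetric, Matrix.of_apply, nuAng]
    linarith
  have h2 : ∑ B, (angMetric g x)⁻¹ A B * ∑ C, angMetric g x B C * (g x)⁻¹ (ang C) 1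
      = (g x)⁻¹ (ang A) 1 := by
    simp only [Finset.mul_sum, ← mul_assoc]
    rw [Finset.sum_comm]
    simp only [← Finset.sum_mul, (hg.angMetricAt hx).inv_mul_apply]
    simp
  rw [← h2]
  simp only [h, nuUp, Finset.mul_sum]
  exact Finset.sum_congr rfl fun B _ => by ring

theorem inv1A (A : Fin m) :
    (g x)⁻¹ 1 (ang A) = -(nuZero g x)⁻¹ * nuUp (angMetric g) (nuAng g) x A := by
  rw [(hg.metricAt hx).inv_comm_at, hg.invA1 hx]

theorem gUp_eq : gUp g x = ((nuZero g x)⁻¹) ^ 2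
    * ((∑ A, nuUp (angMetric g) (nuAng g) x A * nuAng g x A) - g x 0 0) := by
  have h := (hg.metricAt hx).mul_inv_apply 0 1
  rw [sum_univ_ang, hg.inv01 hx, if_neg zero_ne_one] at h
  simp only [hg.invA1 hx] at h
  have h0 := hg.nuZero_ne hx
  have h1 : ∑ A, g x 0 (ang A) * (-(nuZero g x)⁻¹ * nuUp (angMetric g) (nuAng g) x A)
      = -(nuZero g x)⁻¹ * ∑ A, nuUp (angMetric g) (nuAng g) x A * nuAng g x A := by
    rw [Finset.mul_sum]
    exact Finset.sum_congr rfl fun A _ => by rw [nuAng]; ring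
  rw [h1] at h
  change g x 0 0 * _ + nuZero g x * gUp g x + _ = 0 at h
  field_simp at h ⊢
  linarith

/-- Contraction with the inverse metric in adapted coordinates. -/
theorem sum_inv_mul_mul (f : Fin (m + 2) → Fin (m + 2) → ℝ) (hf : ∀ a b, f a b = f b a) :
    ∑ a, ∑ b, (g x)⁻¹ a b * f a b = 2 * (nuZero g x)⁻¹ * f 0 1 + gUp g x * f 1 1
      - 2 * (nuZero g x)⁻¹ * (∑ A, nuUp (angMetric g) (nuAng g) x A * f 1 (ang A))
      + ∑ A, ∑ B, (angMetric g x)⁻¹ A B * f (ang A) (ang B) := by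
  simp only [sum_univ_ang, hg.inv00 hx, hg.inv01 hx, hg.inv10 hx, hg.inv0A hx, hg.invA0 hx,
    hg.inv1A hx, hg.invA1 hx, hg.invAB hx, Finset.sum_add_distrib, zero_mul,
    Finset.sum_const_zero, hf 1 0, hf (ang _) 1, Finset.mul_sum, gUp]
  have : ∀ A, 2 * (nuZero g x)⁻¹ * (nuUp (angMetric g) (nuAng g) x A * f 1 (ang A))
    = -(-(nuZero g x)⁻¹ * nuUp (angMetric g) (nuAng g) x A * f 1 (ang A))
      -(-(nuZero g x)⁻¹ * nuUp (angMetric g) (nuAng g) x A * f 1 (ang A)) := fun A => by ring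
  simp only [this, Finset.sum_sub_distrib, Finset.sum_neg_distrib]
  ring

/-! ### The connection on the hypersurface -/

/-- A symbol of the first kind without the index `0` contains tangential derivatives only, so every
contribution of `g₁₁` and `g_{1A}` to it vanishes on the slice. This and the next four lemmas list
what survives. -/
theorem low111 : christoffelLow (basis m) g x 1 1 1 = 0 := by
  have h : d1 (fun y => g y 1 1) x = 0 := d1_eq_zero_slice hg.isOpen (fun y hy => hg.g11 hy) hx
  rw [d1] at h
  simp [christoffelLow, h]

theorem low11A (A : Fin m) : christoffelLow (basis m) g x 1 1 (ang A) = 0 := by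
  have h : d1 (fun y => g y 1 (ang A)) x = 0 :=
    d1_eq_zero_slice hg.isOpen (fun y hy => hg.g1A hy A) hx
  have h2 : dA A (fun y => g y 1 1) x = 0 :=
    dA_eq_zero_slice hg.isOpen (fun y hy => hg.g11 hy) hx A
  simp only [d1, dA, angBasis] at h h2
  simp [christoffelLow, h, h2]

theorem low1A1 (A : Fin m) : christoffelLow (basis m) g x 1 (ang A) 1 = 0 := by
  have h : d1 (fun y => g y 1 (ang A)) x = 0 :=
    d1_eq_zero_slice hg.isOpen (fun y hy => hg.g1A hy A) hx
  have h1 : d1 (fun y => g y (ang A) 1) x = 0 :=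
    d1_eq_zero_slice hg.isOpen (fun y hy => hg.gA1 hy A) hx
  have h2 : dA A (fun y => g y 1 1) x = 0 :=
    dA_eq_zero_slice hg.isOpen (fun y hy => hg.g11 hy) hx A
  simp only [d1, dA, angBasis] at h h1 h2
  simp [christoffelLow, h, h1, h2]

theorem low1AB (A B : Fin m) : christoffelLow (basis m) g x 1 (ang A) (ang B)
    = (1 / 2) * d1 (fun y => angMetric g y A B) x := by
  have h1 : dA A (fun y => g y 1 (ang B)) x = 0 :=
    dA_eq_zero_slice hg.isOpen (fun y hy => hg.g1A hy B) hx A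
  have h2 : dA B (fun y => g y 1 (ang A)) x = 0 :=
    dA_eq_zero_slice hg.isOpen (fun y hy => hg.g1A hy A) hx B
  simp only [dA, angBasis] at h1 h2
  simp [christoffelLow, h1, h2, d1, angMetric]

theorem lowAB1 (A B : Fin m) : christoffelLow (basis m) g x (ang A) (ang B) 1
    = -((1 / 2) * d1 (fun y => angMetric g y A B) x) := by
  have h1 : dA A (fun y => g y (ang B) 1) x = 0 :=
    dA_eq_zero_slice hg.isOpen (fun y hy => hg.gA1 hy B) hx A
  have h2 : dA B (fun y => g y (ang A) 1) x = 0 :=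
    dA_eq_zero_slice hg.isOpen (fun y hy => hg.gA1 hy A) hx B
  simp only [dA, angBasis] at h1 h2
  simp [christoffelLow, h1, h2, d1, angMetric]

theorem chr0 (a b : Fin (m + 2)) : christoffel (basis m) g x 0 a b
    = (nuZero g x)⁻¹ * christoffelLow (basis m) g x a b 1 := by
  rw [christoffel_eq, sum_univ_ang, hg.inv00 hx, hg.inv01 hx]
  simp [hg.inv0A hx]

theorem chr1 (a b : Fin (m + 2)) : christoffel (basis m) g x 1 a b
    = (nuZero g x)⁻¹ * christoffelLow (basis m) g x a b 0
      + gUp g x * christoffelLow (basis m) g x a b 1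
      - (nuZero g x)⁻¹ * ∑ A, nuUp (angMetric g) (nuAng g) x A
          * christoffelLow (basis m) g x a b (ang A) := by
  rw [christoffel_eq, sum_univ_ang, hg.inv10 hx]
  simp only [hg.inv1A hx, gUp, Finset.mul_sum, neg_mul, Finset.sum_neg_distrib, mul_assoc,
    sub_eq_add_neg]

theorem chrA (C : Fin m) (a b : Fin (m + 2)) : christoffel (basis m) g x (ang C) a b
    = -(nuZero g x)⁻¹ * nuUp (angMetric g) (nuAng g) x C * christoffelLow (basis m) g x a b 1
      + ∑ D, (angMetric g x)⁻¹ C D * christoffelLow (basis m) g x a b (ang D) := by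
  rw [christoffel_eq, sum_univ_ang, hg.invA0 hx, hg.invA1 hx]
  simp only [hg.invAB hx, zero_mul, zero_add]

theorem chr011 : christoffel (basis m) g x 0 1 1 = 0 := by
  rw [hg.chr0 hx, hg.low111 hx, mul_zero]

theorem chr01A (A : Fin m) : christoffel (basis m) g x 0 1 (ang A) = 0 := by
  rw [hg.chr0 hx, hg.low1A1 hx, mul_zero]

theorem chr0AB (A B : Fin m) : christoffel (basis m) g x 0 (ang A) (ang B)
    = -(nuZero g x)⁻¹ * ((1 / 2) * d1 (fun y => angMetric g y A B) x) := by
  rw [hg.chr0 hx, hg.lowAB1 hx]; ring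

theorem chrA11 (A : Fin m) : christoffel (basis m) g x (ang A) 1 1 = 0 := by
  simp [hg.chrA hx, hg.low111 hx, hg.low11A hx]

theorem chrA1B (A B : Fin m) :
    christoffel (basis m) g x (ang A) 1 (ang B) = chi (angMetric g) x B A := by
  rw [hg.chrA hx, hg.low1A1 hx, chi, Finset.mul_sum, mul_zero, zero_add]
  exact Finset.sum_congr rfl fun C _ => by rw [hg.low1AB hx]; ring

theorem chrCAB (C A B : Fin m) : christoffel (basis m) g x (ang C) (ang A) (ang B)
    = chrS (angMetric g) x C A B + (nuZero g x)⁻¹ * nuUp (angMetric g) (nuAng g) x C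
        * ((1 / 2) * d1 (fun y => angMetric g y A B) x) := by
  rw [hg.chrA hx, hg.lowAB1 hx, chrS, christoffel_eq]
  have : ∀ D, christoffelLow (basis m) g x (ang A) (ang B) (ang D)
    = christoffelLow (angBasis m) (angMetric g) x A B D := fun D => rfl
  simp only [this]
  ring

end AdaptedMetric

end Slice

theorem sum_rotate {ι : Type*} [Fintype ι] (F : ι → ι → ι → ℝ) :
    ∑ a, ∑ b, ∑ c, F a b c = ∑ c, ∑ a, ∑ b, F a b c :=
  (Finset.sum_congr rfl fun _ _ => Finset.sum_comm).trans Finset.sum_comm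

/-! ### Curvature of the null hypersurface: Raychaudhuri, Codazzi and Gauss. -/

section Slice

variable {m : ℕ}

namespace MetricAt

variable {q : Pt m → Matrix (Fin m) (Fin m) ℝ} {x : Pt m} (hq : MetricAt q x)
include hq

theorem chi_smooth (A B : Fin m) : ContDiffAt ℝ 1 (fun y => chi q y A B) x :=
  contDiffAt_const.mul (ContDiffAt.sum fun C _ =>
    ((hq.inv_smooth B C).of_le (by norm_num)).mul (hq.lineDeriv_smooth A C _))

theorem tau_smooth : ContDiffAt ℝ 1 (tau q) x := ContDiffAt.sum fun A _ => hq.chi_smooth A A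

theorem chi_differentiableAt (A B : Fin m) : DifferentiableAt ℝ (fun y => chi q y A B) x :=
  (hq.chi_smooth A B).differentiableAt (by decide)

theorem tau_differentiableAt : DifferentiableAt ℝ (tau q) x :=
  hq.tau_smooth.differentiableAt (by decide)

theorem lineDeriv_tau (v : Pt m) :
    lineDeriv ℝ (tau q) x v = ∑ A, lineDeriv ℝ (fun y => chi q y A A) x v :=
  lineDeriv_fun_sum v fun A => hq.chi_differentiableAt A A

omit hq in
theorem sum_inv_mul_d1 (A C : Fin m) :
    ∑ D, (q x)⁻¹ C D * ((1 / 2) * d1 (fun y => q y A D) x) = chi q x A C := by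
  rw [chi, Finset.mul_sum]
  exact Finset.sum_congr rfl fun D _ => by ring

omit hq in
theorem trace_d1 : ∑ A, ∑ B, (q x)⁻¹ A B * ((1 / 2) * d1 (fun y => q y A B) x) = tau q x := by
  simp only [sum_inv_mul_d1, tau]

theorem d1_comm (A B : Fin m) : d1 (fun y => q y A B) x = d1 (fun y => q y B A) x :=
  hq.lineDeriv_comm_at A B _

/-- With `k = ½ ∂₁q`, both sides are entries of `k q⁻¹ kᵀ`, which is symmetric because `q⁻¹` is. -/
theorem d1_mul_chi_comm (A C : Fin m) :
    ∑ D, (1 / 2) * d1 (fun y => q y C D) x * chi q x A D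
      = ∑ D, (1 / 2) * d1 (fun y => q y A D) x * chi q x C D := by
  simp only [← sum_inv_mul_d1 (q := q), Finset.mul_sum]
  rw [Finset.sum_comm]
  exact Finset.sum_congr rfl fun D _ => Finset.sum_congr rfl fun E _ => by
    rw [hq.inv_comm_at E D]; ring

omit hq in
-- In `|χ - τ/m|²` the cross term is `-2τ²/m` and the identity contributes `τ²/m`.
theorem sigmaSq_eq (hm : 1 ≤ m) :
    sigmaSq q x + tau q x ^ 2 / m = ∑ A, ∑ B, chi q x A B * chi q x B A := by
  have h0 : (m : ℝ) ≠ 0 := by positivity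
  have h : ∀ A B, sigma q x A B * sigma q x B A = chi q x A B * chi q x B A
      - (if A = B then 2 * chi q x A A * (tau q x / m) - (tau q x / m) ^ 2 else 0) := by
    intro A B
    by_cases hAB : A = B
    · subst hAB; simp only [sigma, if_true]; ring
    · simp [sigma, hAB, Ne.symm hAB]
  simp only [sigmaSq, h, Finset.sum_sub_distrib, Finset.sum_ite_eq, Finset.mem_univ, if_true]
  rw [← Finset.sum_mul, ← Finset.mul_sum]
  simp only [Finset.sum_const, Finset.card_univ, Fintype.card_fin, nsmul_eq_mul]
  change _ - (2 * tau q x * _ - _) + _ = _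
  field_simp
  ring

end MetricAt

namespace AdaptedMetric

variable {U : Set (Pt m)} {g : Pt m → Comp m} (hg : AdaptedMetric U g) {x : Pt m}
  (hx : x ∈ slice U)
include hg hx

theorem chr0A1 (A : Fin m) : christoffel (basis m) g x 0 (ang A) 1 = 0 := by
  rw [(hg.metricAt hx).christoffel_comm, hg.chr01A hx]

theorem chrAB1 (A B : Fin m) :
    christoffel (basis m) g x (ang A) (ang B) 1 = chi (angMetric g) x B A := by
  rw [(hg.metricAt hx).christoffel_comm, hg.chrA1B hx]

/-- Only `g^{01}` survives in row `0` of the inverse, and it multiplies `R_{11db} = 0`. Hence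
`R_{α1}` is a sum over the indices `1` and `A`, where no `∂₀` occurs outside the Christoffel
symbols. -/
theorem riemann01 (d b : Fin (m + 2)) : riemann (basis m) g x 0 1 d b = 0 := by
  rw [(hg.metricAt hx).riemann_eq, sum_univ_ang, hg.inv00 hx, (hg.metricAt hx).riemannLow_self]
  simp [hg.inv0A hx]

theorem d1_chrAB1 (A B : Fin m) :
    lineDeriv ℝ (fun y => christoffel (basis m) g y (ang A) (ang B) 1) x (basis m 1)
      = d1 (fun y => chi (angMetric g) y B A) x :=
  d1_congr_slice hg.isOpen (fun _ hy => hg.chrAB1 hy A B) hx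

theorem dA_chrAB1 (A B C : Fin m) :
    lineDeriv ℝ (fun y => christoffel (basis m) g y (ang A) (ang B) 1) x (basis m (ang C))
      = dA C (fun y => chi (angMetric g) y B A) x :=
  dA_congr_slice hg.isOpen (fun _ hy => hg.chrAB1 hy A B) hx C

/-- The Raychaudhuri equation. -/
theorem ricci11 : ricci (basis m) g x 1 1 = -d1 (tau (angMetric g)) x
    + christoffel (basis m) g x 1 1 1 * tau (angMetric g) x
    - ∑ A, ∑ B, chi (angMetric g) x A B * chi (angMetric g) x B A := by
  have h1 : riemann (basis m) g x 1 1 1 1 = 0 := by rw [riemann]; ring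
  have h2 : ∀ C, riemann (basis m) g x (ang C) 1 (ang C) 1
      = -d1 (fun y => chi (angMetric g) y C C) x
        + christoffel (basis m) g x 1 1 1 * chi (angMetric g) x C C
        - ∑ B, chi (angMetric g) x C B * chi (angMetric g) x B C := by
    intro C
    have h3 : lineDeriv ℝ (fun y => christoffel (basis m) g y (ang C) 1 1) x (basis m (ang C))
        = 0 :=
      dA_eq_zero_slice hg.isOpen (fun y hy => hg.chrA11 hy C) hx C
    rw [riemann, hg.d1_chrAB1 hx, h3, sum_univ_ang, sum_univ_ang]
    simp only [hg.chr011 hx, hg.chrAB1 hx, hg.chrA11 hx, hg.chr0A1 hx, hg.chrA1B hx,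
      mul_zero, zero_mul, Finset.sum_const_zero]
    simp only [mul_comm (chi _ _ _ C)]
    ring
  rw [(hg.metricAt hx).ricci_eq, sum_univ_ang, hg.riemann01 hx, h1]
  simp only [h2, Finset.sum_add_distrib, Finset.sum_sub_distrib, Finset.sum_neg_distrib,
    ← Finset.mul_sum]
  rw [d1, (hg.angMetricAt hx).lineDeriv_tau]
  simp only [tau, d1]
  ring

/-- The Codazzi-type equation for the null hypersurface. -/
theorem ricciA1 (A : Fin m) : ricci (basis m) g x (ang A) 1
    = d1 (fun y => christoffel (basis m) g y 1 (ang A) 1) x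
      + tau (angMetric g) x * christoffel (basis m) g x 1 (ang A) 1
      + divChi (angMetric g) x A
      - dA A (fun y => christoffel (basis m) g y 1 1 1) x
      - dA A (tau (angMetric g)) x := by
  have h1 : riemann (basis m) g x 1 1 1 (ang A)
      = d1 (fun y => christoffel (basis m) g y 1 (ang A) 1) x
        - dA A (fun y => christoffel (basis m) g y 1 1 1) x
        + ∑ C, christoffel (basis m) g x 1 (ang C) 1 * chi (angMetric g) x A C := by
    rw [riemann, sum_univ_ang, sum_univ_ang]
    simp only [hg.chr011 hx, hg.chrAB1 hx, hg.chrA11 hx, hg.chr0A1 hx,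
      mul_zero, Finset.sum_const_zero, d1, dA, angBasis,
      (hg.metricAt hx).christoffel_comm (basis m) 1 1 (ang _)]
    ring
  have h2 : ∀ C, riemann (basis m) g x (ang C) 1 (ang C) (ang A)
      = dA C (fun y => chi (angMetric g) y A C) x - dA A (fun y => chi (angMetric g) y C C) x
        + chi (angMetric g) x C C * christoffel (basis m) g x 1 (ang A) 1
        - chi (angMetric g) x A C * christoffel (basis m) g x 1 (ang C) 1
        + ∑ D, (chrS (angMetric g) x C C D * chi (angMetric g) x A D
            - chrS (angMetric g) x C A D * chi (angMetric g) x C D) := by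
    intro C
    rw [riemann, hg.dA_chrAB1 hx, hg.dA_chrAB1 hx, sum_univ_ang, sum_univ_ang]
    simp only [hg.chr0A1 hx, hg.chrAB1 hx, mul_zero, hg.chrCAB hx, add_mul,
      Finset.sum_add_distrib, Finset.sum_sub_distrib]
    -- The `ν⁰ ν^C` corrections by which `Γ^C_{AB}` differs from the intrinsic symbols cancel by
    -- this symmetry.
    have h3 := (hg.angMetricAt hx).d1_mul_chi_comm A C
    simp only [mul_assoc, ← Finset.mul_sum] at h3 ⊢
    rw [h3]
    ring
  rw [(hg.metricAt hx).ricci_eq, sum_univ_ang, hg.riemann01 hx, h1]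
  simp only [h2, divChi, Finset.sum_add_distrib, Finset.sum_sub_distrib, ← Finset.sum_mul]
  have h4 : ∀ B C, chrS (angMetric g) x C B A = chrS (angMetric g) x C A B := fun B C =>
    (hg.angMetricAt hx).christoffel_comm _ C B A
  have h5 : ∑ B, ∑ C, chrS (angMetric g) x C A B * chi (angMetric g) x C B
    = ∑ C, ∑ B, chrS (angMetric g) x C A B * chi (angMetric g) x C B := Finset.sum_comm
  rw [dA, dA, (hg.angMetricAt hx).lineDeriv_tau]
  simp only [h4, h5, tau, dA, mul_comm (chi (angMetric g) x A _)]
  ring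

/-- First-kind symbols with three angular indices are those of the sections, so the derivative terms
agree with the intrinsic ones. The difference comes only from the quadratic terms, where the
summation index may also be `0` or `1`. -/
theorem gauss (A B C D : Fin m) :
    riemannLow (basis m) g x (ang D) (ang B) (ang C) (ang A)
      = riemannLow (angBasis m) (angMetric g) x D B C A
        + (1 / 2) * d1 (fun y => angMetric g y C D) x * christoffel (basis m) g x 1 (ang A) (ang B)
        + (1 / 2) * d1 (fun y => angMetric g y A B) x * christoffel (basis m) g x 1 (ang C) (ang D)
        + gUp g x * ((1 / 2) * d1 (fun y => angMetric g y C D) x)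
          * ((1 / 2) * d1 (fun y => angMetric g y A B) x)
        - (1 / 2) * d1 (fun y => angMetric g y A D) x * christoffel (basis m) g x 1 (ang C) (ang B)
        - (1 / 2) * d1 (fun y => angMetric g y C B) x * christoffel (basis m) g x 1 (ang A) (ang D)
        - gUp g x * ((1 / 2) * d1 (fun y => angMetric g y A D) x)
          * ((1 / 2) * d1 (fun y => angMetric g y C B) x) := by
  have hl : ∀ (y : Pt m) (A B D : Fin m), christoffelLow (basis m) g y (ang A) (ang B) (ang D)
    = christoffelLow (angBasis m) (angMetric g) y A B D := fun y A B D => rfl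
  have key : ∀ A B C D : Fin m,
      ∑ l, christoffelLow (basis m) g x (ang A) (ang B) l
          * christoffel (basis m) g x l (ang C) (ang D)
        = (∑ l, christoffelLow (angBasis m) (angMetric g) x A B l
            * christoffel (angBasis m) (angMetric g) x l C D)
          - (1 / 2) * d1 (fun y => angMetric g y A B) x
            * christoffel (basis m) g x 1 (ang C) (ang D)
          - (1 / 2) * d1 (fun y => angMetric g y C D) x
            * christoffel (basis m) g x 1 (ang A) (ang B)
          - gUp g x * ((1 / 2) * d1 (fun y => angMetric g y A B) x)
            * ((1 / 2) * d1 (fun y => angMetric g y C D) x) := by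
    intro A B C D
    -- The transversal symbol `[AB,0]` enters with the summation index `0`; it is traded for
    -- `Γ¹_{AB}`, which contains it with coefficient `ν⁰`.
    rw [sum_univ_ang, hg.lowAB1 hx, hg.chr0AB hx, hg.chr1 hx (ang A), hg.lowAB1 hx]
    simp only [hg.chrCAB hx, hl, chrS, mul_add, Finset.sum_add_distrib]
    have : ∑ E, christoffelLow (angBasis m) (angMetric g) x A B E * ((nuZero g x)⁻¹
          * nuUp (angMetric g) (nuAng g) x E * ((1 / 2) * d1 (fun y => angMetric g y C D) x))
        = (nuZero g x)⁻¹ * (∑ E, nuUp (angMetric g) (nuAng g) x E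
          * christoffelLow (angBasis m) (angMetric g) x A B E)
            * ((1 / 2) * d1 (fun y => angMetric g y C D) x) := by
      simp only [Finset.mul_sum, Finset.sum_mul]
      exact Finset.sum_congr rfl fun E _ => by ring
    rw [this]
    ring
  rw [riemannLow, riemannLow, key, key]
  simp only [hl, angBasis]
  ring

/-- Both derivatives in `R¹_{A1B}`, namely `∂₁` and `∂_B`, are tangential. After tracing they become
`∂₁` of `g^{AB} Γ¹_{AB}` and the divergence of `Γ¹_{A1}`, the combinations found in `C₀`. -/
theorem sum_inv_mul_riemann1 :
    ∑ A, ∑ B, (angMetric g x)⁻¹ A B * riemann (basis m) g x 1 (ang A) 1 (ang B)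
      = d1 (fun y => ∑ A, ∑ B, (angMetric g y)⁻¹ A B
            * christoffel (basis m) g y 1 (ang A) (ang B)) x
        + (∑ A, ∑ B, ∑ C, (angMetric g x)⁻¹ A B * (christoffel (basis m) g x 1 (ang B) (ang C)
            * chi (angMetric g) x A C))
        - (∑ A, ∑ B, (angMetric g x)⁻¹ A B
            * (dA B (fun y => christoffel (basis m) g y 1 (ang A) 1) x
              - ∑ C, chrS (angMetric g) x C B A * christoffel (basis m) g x 1 (ang C) 1))
        + (nuZero g x)⁻¹ * tau (angMetric g) x
          * (∑ C, nuUp (angMetric g) (nuAng g) x C * christoffel (basis m) g x 1 (ang C) 1)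
        - (nuZero g x)⁻¹ * tau (angMetric g) x * christoffel (basis m) g x 1 0 1
        + christoffel (basis m) g x 1 1 1 * (∑ A, ∑ B, (angMetric g x)⁻¹ A B
            * christoffel (basis m) g x 1 (ang A) (ang B))
        - ∑ A, ∑ B, (angMetric g x)⁻¹ A B * christoffel (basis m) g x 1 (ang A) 1
            * christoffel (basis m) g x 1 (ang B) 1 := by
  have hM := hg.metricAt hx
  have hq := hg.angMetricAt hx
  have hc : ∀ l, christoffel (basis m) g x 1 1 l = christoffel (basis m) g x 1 l 1 :=
    fun l => hM.christoffel_comm _ _ _ _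
  have h1 : ∀ A B, (angMetric g x)⁻¹ A B * riemann (basis m) g x 1 (ang A) 1 (ang B)
      = (angMetric g x)⁻¹ A B
          * lineDeriv ℝ (fun y => christoffel (basis m) g y 1 (ang A) (ang B)) x (basis m 1)
        - (angMetric g x)⁻¹ A B
            * (dA B (fun y => christoffel (basis m) g y 1 (ang A) 1) x
              - ∑ C, chrS (angMetric g) x C B A * christoffel (basis m) g x 1 (ang C) 1)
        + (nuZero g x)⁻¹ * ((angMetric g x)⁻¹ A B * ((1 / 2) * d1 (fun y => angMetric g y A B) x))
          * (∑ C, nuUp (angMetric g) (nuAng g) x C * christoffel (basis m) g x 1 (ang C) 1)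
        - (nuZero g x)⁻¹ * ((angMetric g x)⁻¹ A B * ((1 / 2) * d1 (fun y => angMetric g y A B) x))
          * christoffel (basis m) g x 1 0 1
        + christoffel (basis m) g x 1 1 1 * ((angMetric g x)⁻¹ A B
            * christoffel (basis m) g x 1 (ang A) (ang B))
        - (angMetric g x)⁻¹ A B * christoffel (basis m) g x 1 (ang A) 1
            * christoffel (basis m) g x 1 (ang B) 1
        - ∑ C, (angMetric g x)⁻¹ A B * (christoffel (basis m) g x 1 (ang B) (ang C)
            * chi (angMetric g) x A C) := by
    intro A B
    have h2 : lineDeriv ℝ (fun y => christoffel (basis m) g y 1 (ang B) (ang A)) x (basis m 1)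
        = lineDeriv ℝ (fun y => christoffel (basis m) g y 1 (ang A) (ang B)) x (basis m 1) := by
      refine EventuallyEq.lineDeriv_eq ?_
      filter_upwards [hM.eventually] with y hy
      exact hy.christoffel_comm _ _ _ _
    have h2' : lineDeriv ℝ (fun y => christoffel (basis m) g y 1 1 (ang A)) x (basis m (ang B))
        = dA B (fun y => christoffel (basis m) g y 1 (ang A) 1) x := by
      refine EventuallyEq.lineDeriv_eq ?_
      filter_upwards [hM.eventually] with y hy
      exact hy.christoffel_comm _ _ _ _
    have h3 : ∑ C, christoffel (basis m) g x 1 (ang C) 1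
          * christoffel (basis m) g x (ang C) (ang B) (ang A)
        = (∑ C, chrS (angMetric g) x C B A * christoffel (basis m) g x 1 (ang C) 1)
          + (nuZero g x)⁻¹ * ((1 / 2) * d1 (fun y => angMetric g y A B) x)
            * ∑ C, nuUp (angMetric g) (nuAng g) x C * christoffel (basis m) g x 1 (ang C) 1 := by
      simp only [hg.chrCAB hx, Finset.mul_sum, ← Finset.sum_add_distrib, hq.d1_comm B A]
      exact Finset.sum_congr rfl fun C _ => by ring
    rw [riemann, sum_univ_ang, sum_univ_ang, h2, h2']
    simp only [hg.chrA1B hx, hg.chr01A hx, hc, h3, hg.chr0AB hx, hq.d1_comm B A,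
      hM.christoffel_comm _ 1 (ang B) (ang A), ← Finset.mul_sum]
    ring
  have hd : ∀ A B, DifferentiableAt ℝ (fun y => christoffel (basis m) g y 1 (ang A) (ang B)) x :=
    fun A B => hM.christoffel_differentiableAt _ _ _ _
  -- Taking `∂₁` outside the trace produces `∂₁ g^{AB} = -2 χ^{AB}`.
  have h4 : d1 (fun y => ∑ A, ∑ B, (angMetric g y)⁻¹ A B
            * christoffel (basis m) g y 1 (ang A) (ang B)) x
      = (∑ A, ∑ B, (angMetric g x)⁻¹ A B
          * lineDeriv ℝ (fun y => christoffel (basis m) g y 1 (ang A) (ang B)) x (basis m 1))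
        - 2 * (∑ A, ∑ B, ∑ C, (angMetric g x)⁻¹ A B * (christoffel (basis m) g x 1 (ang B) (ang C)
            * chi (angMetric g) x A C)) := by
    rw [d1, lineDeriv_fun_sum _ fun A => DifferentiableAt.fun_sum fun B _ =>
      (hq.inv_differentiableAt A B).fun_mul (hd A B)]
    simp only [lineDeriv_fun_sum (basis m 1) fun B =>
      (hq.inv_differentiableAt _ B).fun_mul (hd _ B),
      lineDeriv_fun_mul (basis m 1) (hq.inv_differentiableAt _ _) (hd _ _), hq.lineDeriv_inv,
      Finset.sum_add_distrib]
    have h5 : ∑ A, ∑ B, (∑ C, ∑ D, (angMetric g x)⁻¹ A C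
          * lineDeriv ℝ (fun y => angMetric g y C D) x (basis m 1) * (angMetric g x)⁻¹ D B)
          * christoffel (basis m) g x 1 (ang A) (ang B)
        = 2 * (∑ A, ∑ B, ∑ C, (angMetric g x)⁻¹ A B * (christoffel (basis m) g x 1 (ang B) (ang C)
            * chi (angMetric g) x A C)) := by
      simp only [← MetricAt.sum_inv_mul_d1 (q := angMetric g), Finset.mul_sum, Finset.sum_mul]
      rw [sum_rotate]
      refine Finset.sum_congr rfl fun C _ => Finset.sum_congr rfl fun A _ =>
        Finset.sum_congr rfl fun B _ => Finset.sum_congr rfl fun D _ => ?_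
      rw [hq.inv_comm_at A C, hq.inv_comm_at D B, d1]
      ring
    simp only [neg_mul, Finset.sum_neg_distrib, h5]
    ring
  simp only [h1, Finset.sum_add_distrib, Finset.sum_sub_distrib, ← Finset.sum_mul,
    ← Finset.mul_sum, MetricAt.trace_d1]
  simp only [← Finset.mul_sum] at h4
  rw [h4]
  ring

/-- The trace in `R_{AB}` is split by the block form of `g⁻¹`. The blocks with an index `0` or `1`
give `R¹_{A1B}` and `R_{1A1B}`, whose trace is `R₁₁`; the angular block is evaluated by `gauss`. -/
theorem trace_ricci : ∑ A, ∑ B, (angMetric g x)⁻¹ A B * ricci (basis m) g x (ang A) (ang B)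
    = 2 * (∑ A, ∑ B, (angMetric g x)⁻¹ A B * riemann (basis m) g x 1 (ang A) 1 (ang B))
      - gUp g x * ricci (basis m) g x 1 1
      + scalarCurv (angBasis m) (angMetric g) x
      + 2 * tau (angMetric g) x * (∑ A, ∑ B, (angMetric g x)⁻¹ A B
            * christoffel (basis m) g x 1 (ang A) (ang B))
      + gUp g x * tau (angMetric g) x ^ 2
      - 2 * (∑ A, ∑ B, ∑ C, (angMetric g x)⁻¹ A B * (christoffel (basis m) g x 1 (ang B) (ang C)
            * chi (angMetric g) x A C))
      - gUp g x * ∑ A, ∑ B, chi (angMetric g) x A B * chi (angMetric g) x B A := by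
  have hM := hg.metricAt hx
  have hq := hg.angMetricAt hx
  -- By pair symmetry the part with index `0` and the mixed `1C` part assemble into a second copy of
  -- `R¹_{A1B}`. The `g^{11}` term is then counted twice, whence the subtraction.
  have h1 : ∀ A B, ricci (basis m) g x (ang A) (ang B)
      = riemann (basis m) g x 1 (ang A) 1 (ang B) + riemann (basis m) g x 1 (ang B) 1 (ang A)
        - gUp g x * riemannLow (basis m) g x 1 (ang A) 1 (ang B)
        + ∑ C, ∑ D, (angMetric g x)⁻¹ C D
            * riemannLow (basis m) g x (ang D) (ang B) (ang C) (ang A) := by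
    intro A B
    have h2 : riemann (basis m) g x 0 (ang B) 0 (ang A)
        = (nuZero g x)⁻¹ * riemannLow (basis m) g x 0 (ang A) 1 (ang B) := by
      rw [hM.riemann_eq, sum_univ_ang, hg.inv00 hx, hg.inv01 hx,
        hM.riemannLow_pair (basis m) 1]
      simp [hg.inv0A hx]
    have h3 : ∀ C, riemann (basis m) g x (ang C) (ang B) (ang C) (ang A)
        = (g x)⁻¹ 1 (ang C) * riemannLow (basis m) g x (ang C) (ang A) 1 (ang B)
          + ∑ D, (angMetric g x)⁻¹ C D
              * riemannLow (basis m) g x (ang D) (ang B) (ang C) (ang A) := by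
      intro C
      rw [hM.riemann_eq, sum_univ_ang, hg.invA0 hx, hM.riemannLow_pair _ 1, hM.inv_comm_at _ 1]
      simp only [hg.invAB hx]
      ring
    rw [hM.ricci_eq, sum_univ_ang, h2]
    simp only [h3, Finset.sum_add_distrib]
    rw [hM.riemann_eq _ 1 (ang A), sum_univ_ang, hg.inv10 hx, gUp]
    ring
  have h4 : ricci (basis m) g x 1 1 = ∑ A, ∑ B, (angMetric g x)⁻¹ A B
      * riemannLow (basis m) g x 1 (ang A) 1 (ang B) := by
    have h5 : riemann (basis m) g x 1 1 1 1 = 0 := by rw [riemann]; ring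
    rw [hM.ricci_eq, sum_univ_ang, hg.riemann01 hx, h5, zero_add, zero_add]
    refine Finset.sum_congr rfl fun A _ => ?_
    rw [hM.riemann_eq, sum_univ_ang, hg.invA0 hx, hM.riemannLow_self]
    simp only [zero_mul, mul_zero, zero_add, hg.invAB hx]
    exact Finset.sum_congr rfl fun B _ => by
      rw [hM.riemannLow_antisymm_left, riemannLow_antisymm_right, neg_neg, hM.riemannLow_pair]
  have h6 : ∑ A, ∑ B, (angMetric g x)⁻¹ A B * riemann (basis m) g x 1 (ang B) 1 (ang A)
      = ∑ A, ∑ B, (angMetric g x)⁻¹ A B * riemann (basis m) g x 1 (ang A) 1 (ang B) := by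
    rw [Finset.sum_comm]
    simp only [hq.inv_comm_at]
  -- The three patterns of double trace in Gauss's formula: `factor` for products of traces, `cross`
  -- for chained contractions, `swap` for renaming one chain into the other.
  have factor : ∀ a b c : Fin m → Fin m → ℝ, ∑ A, ∑ B, a A B * ∑ C, ∑ D, a C D * (b C D * c A B)
      = (∑ A, ∑ B, a A B * b A B) * ∑ A, ∑ B, a A B * c A B := by
    intro a b c
    rw [mul_comm]
    simp only [Finset.sum_mul]
    refine Finset.sum_congr rfl fun A _ => Finset.sum_congr rfl fun B _ => ?_
    simp only [Finset.mul_sum]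
    exact Finset.sum_congr rfl fun C _ => Finset.sum_congr rfl fun D _ => by ring
  have cross : ∀ b : Fin m → Fin m → ℝ,
      ∑ A, ∑ B, (angMetric g x)⁻¹ A B * ∑ C, ∑ D, (angMetric g x)⁻¹ C D
        * ((1 / 2) * d1 (fun y => angMetric g y A D) x * b C B)
      = ∑ A, ∑ B, ∑ C, (angMetric g x)⁻¹ A B * (b C B * chi (angMetric g) x A C) := by
    intro b
    simp only [← MetricAt.sum_inv_mul_d1 (q := angMetric g), Finset.mul_sum]
    exact Finset.sum_congr rfl fun A _ => Finset.sum_congr rfl fun B _ =>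
      Finset.sum_congr rfl fun C _ => Finset.sum_congr rfl fun D _ => by ring
  have hsymm : ∀ A B, christoffel (basis m) g x 1 (ang A) (ang B)
      = christoffel (basis m) g x 1 (ang B) (ang A) := fun A B => hM.christoffel_comm _ _ _ _
  have swap : ∀ b : Fin m → Fin m → ℝ,
      ∑ A, ∑ B, (angMetric g x)⁻¹ A B * ∑ C, ∑ D, (angMetric g x)⁻¹ C D
        * ((1 / 2) * d1 (fun y => angMetric g y C B) x * b A D)
      = ∑ A, ∑ B, (angMetric g x)⁻¹ A B * ∑ C, ∑ D, (angMetric g x)⁻¹ C D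
        * ((1 / 2) * d1 (fun y => angMetric g y A D) x * b C B) := by
    intro b
    simp only [Finset.mul_sum]
    rw [sum_rotate]
    refine Finset.sum_congr rfl fun C _ => ?_
    have h0 : ∀ F : Fin m → Fin m → Fin m → ℝ, ∑ a, ∑ b, ∑ d, F a b d = ∑ d, ∑ a, ∑ b, F a b d :=
      sum_rotate
    rw [h0]
    exact Finset.sum_congr rfl fun D _ => Finset.sum_congr rfl fun A _ =>
      Finset.sum_congr rfl fun B _ => by ring
  have h7 : ∑ A, ∑ B, (angMetric g x)⁻¹ A B * ∑ C, ∑ D, (angMetric g x)⁻¹ C D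
        * riemannLow (basis m) g x (ang D) (ang B) (ang C) (ang A)
      = scalarCurv (angBasis m) (angMetric g) x
        + 2 * tau (angMetric g) x * (∑ A, ∑ B, (angMetric g x)⁻¹ A B
            * christoffel (basis m) g x 1 (ang A) (ang B))
        + gUp g x * tau (angMetric g) x ^ 2
        - 2 * (∑ A, ∑ B, ∑ C, (angMetric g x)⁻¹ A B
            * (christoffel (basis m) g x 1 (ang B) (ang C) * chi (angMetric g) x A C))
        - gUp g x * ∑ A, ∑ B, chi (angMetric g) x A B * chi (angMetric g) x B A := by
    have e1 := factor (fun A B => (angMetric g x)⁻¹ A B)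
        (fun A B => (1 / 2) * d1 (fun y => angMetric g y A B) x)
      (fun A B => christoffel (basis m) g x 1 (ang A) (ang B))
    have e2 := factor (fun A B => (angMetric g x)⁻¹ A B)
        (fun A B => christoffel (basis m) g x 1 (ang A) (ang B))
      (fun A B => (1 / 2) * d1 (fun y => angMetric g y A B) x)
    have e3 := factor (fun A B => (angMetric g x)⁻¹ A B)
        (fun A B => (1 / 2) * d1 (fun y => angMetric g y A B) x)
      (fun A B => (1 / 2) * d1 (fun y => angMetric g y A B) x)
    have e4 := cross (fun C B => christoffel (basis m) g x 1 (ang C) (ang B))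
    have e5 := swap (fun C B => christoffel (basis m) g x 1 (ang C) (ang B))
    have e6 := cross (fun A B => (1 / 2) * d1 (fun y => angMetric g y A B) x)
    have e7 : ∑ A, ∑ B, ∑ C, (angMetric g x)⁻¹ A B
        * ((1 / 2) * d1 (fun y => angMetric g y C B) x * chi (angMetric g) x A C)
        = ∑ A, ∑ B, chi (angMetric g) x A B * chi (angMetric g) x B A := by
      refine Finset.sum_congr rfl fun A _ => ?_
      rw [Finset.sum_comm]
      refine Finset.sum_congr rfl fun C _ => ?_
      rw [← MetricAt.sum_inv_mul_d1 (q := angMetric g) C A, Finset.mul_sum]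
      exact Finset.sum_congr rfl fun B _ => by ring
    have e8 : ∑ A, ∑ B, ∑ C, (angMetric g x)⁻¹ A B
        * (christoffel (basis m) g x 1 (ang C) (ang B) * chi (angMetric g) x A C)
        = ∑ A, ∑ B, ∑ C, (angMetric g x)⁻¹ A B
        * (christoffel (basis m) g x 1 (ang B) (ang C) * chi (angMetric g) x A C) := by
      simp only [hsymm (_ : Fin m)]
    have expand : ∀ A B C D, (angMetric g x)⁻¹ C D
          * riemannLow (basis m) g x (ang D) (ang B) (ang C) (ang A)
        = (angMetric g x)⁻¹ C D * riemannLow (angBasis m) (angMetric g) x D B C A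
          + (angMetric g x)⁻¹ C D * ((1 / 2) * d1 (fun y => angMetric g y C D) x
              * christoffel (basis m) g x 1 (ang A) (ang B))
          + (angMetric g x)⁻¹ C D * (christoffel (basis m) g x 1 (ang C) (ang D)
              * ((1 / 2) * d1 (fun y => angMetric g y A B) x))
          + gUp g x * ((angMetric g x)⁻¹ C D * ((1 / 2) * d1 (fun y => angMetric g y C D) x
              * ((1 / 2) * d1 (fun y => angMetric g y A B) x)))
          - (angMetric g x)⁻¹ C D * ((1 / 2) * d1 (fun y => angMetric g y A D) x
              * christoffel (basis m) g x 1 (ang C) (ang B))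
          - (angMetric g x)⁻¹ C D * ((1 / 2) * d1 (fun y => angMetric g y C B) x
              * christoffel (basis m) g x 1 (ang A) (ang D))
          - gUp g x * ((angMetric g x)⁻¹ C D * ((1 / 2) * d1 (fun y => angMetric g y A D) x
              * ((1 / 2) * d1 (fun y => angMetric g y C B) x))) := by
      intro A B C D
      rw [hg.gauss hx]
      ring
    simp only [expand, Finset.sum_add_distrib, Finset.sum_sub_distrib, mul_add, mul_sub,
      ← Finset.mul_sum (a := gUp g x), mul_left_comm _ (gUp g x)]
    rw [e1, e2, e3, e5, e4, e6, e7, e8, MetricAt.trace_d1]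
    simp only [scalarCurv, hq.ricci_eq_low]
    ring
  simp only [h1, mul_add, mul_sub, Finset.sum_add_distrib, Finset.sum_sub_distrib, h6, h7,
    mul_left_comm _ (gUp g x), ← Finset.mul_sum (a := gUp g x), ← h4]
  ring

end AdaptedMetric

end Slice

/-- The contracted Christoffel symbols `g^{ab} Γ^l_{ab}`. -/
def christoffelTrace {m : ℕ} (g : Pt m → Comp m) (x : Pt m) (l : Fin (m + 2)) : ℝ :=
  ∑ a, ∑ b, (g x)⁻¹ a b * christoffel (basis m) g x l a b

section General

variable {X ι : Type*} [NormedAddCommGroup X] [NormedSpace ℝ X] [Fintype ι] [DecidableEq ι]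

namespace MetricAt

variable {g : X → Matrix ι ι ℝ} {x : X} (hg : MetricAt g x) (e : ι → X)
include hg

theorem ricci_comm (a b : ι) : ricci e g x a b = ricci e g x b a := by
  rw [hg.ricci_eq_low, hg.ricci_eq_low, Finset.sum_comm]
  exact Finset.sum_congr rfl fun c _ => Finset.sum_congr rfl fun d _ => by
    rw [hg.inv_comm_at d c, hg.riemannLow_pair]

theorem sum_mul_christoffel (k a b : ι) :
    ∑ l, g x k l * christoffel e g x l a b = christoffelLow e g x a b k := by
  simp only [christoffel_eq, Finset.mul_sum, ← mul_assoc]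
  rw [Finset.sum_comm]
  simp only [← Finset.sum_mul, hg.mul_inv_apply]
  simp

end MetricAt

end General

/-! ### The Einstein tensor on the slice through the contracted Christoffel symbols. -/

section Slice

variable {m : ℕ}

namespace AdaptedMetric

variable {U : Set (Pt m)} {g : Pt m → Comp m} (hg : AdaptedMetric U g) {x : Pt m}
  (hx : x ∈ slice U)
include hg hx

/-- Metric compatibility, `∂₁g₀₁ = [10,1] + [11,0]`: a symbol in `Γ¹₁₁` is traded for the one
occurring in `V⁰`. -/
theorem low110 : christoffelLow (basis m) g x 1 1 0
    = d1 (nuZero g) x - christoffelLow (basis m) g x 0 1 1 := by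
  simp only [christoffelLow, (hg.metricAt hx).lineDeriv_comm_at 1 0]
  change _ = lineDeriv ℝ (fun y => g y 0 1) x (basis m 1) - _
  ring

theorem low1A0 (A : Fin m) : christoffelLow (basis m) g x 1 (ang A) 0
    = d1 (fun y => nuAng g y A) x - christoffelLow (basis m) g x 0 1 (ang A) := by
  simp only [christoffelLow, (hg.metricAt hx).lineDeriv_comm_at (ang A) 0,
    (hg.metricAt hx).lineDeriv_comm_at 1 0]
  change _ = lineDeriv ℝ (fun y => g y 0 (ang A)) x (basis m 1) - _
  ring

theorem chr111 : christoffel (basis m) g x 1 1 1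
    = (nuZero g x)⁻¹ * christoffelLow (basis m) g x 1 1 0 := by
  simp [hg.chr1 hx, hg.low111 hx, hg.low11A hx]

theorem chr1A1 (A : Fin m) : christoffel (basis m) g x 1 (ang A) 1
    = (nuZero g x)⁻¹ * christoffelLow (basis m) g x 1 (ang A) 0
      - (nuZero g x)⁻¹ * ∑ B, nuAng g x B * chi (angMetric g) x A B := by
  have h : ∑ B, nuUp (angMetric g) (nuAng g) x B * christoffelLow (basis m) g x 1 (ang A) (ang B)
      = ∑ B, nuAng g x B * chi (angMetric g) x A B := by
    simp only [hg.low1AB hx, nuUp, ← MetricAt.sum_inv_mul_d1 (q := angMetric g), Finset.sum_mul,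
      Finset.mul_sum]
    rw [Finset.sum_comm]
    exact Finset.sum_congr rfl fun B _ => Finset.sum_congr rfl fun C _ => by
      rw [(hg.angMetricAt hx).inv_comm_at C B]; ring
  rw [(hg.metricAt hx).christoffel_comm, hg.chr1 hx, hg.low1A1 hx, h]
  ring

/-- The only transversal derivative in `Γ¹₁₁` is `∂₀g₁₁`, through `[01,1]`, and `V⁰ = 2 (ν⁰)² [01,1]
- ν⁰ τ` can be solved for it. -/
theorem kappa_christoffelTrace :
    kappa (angMetric g) (nuZero g) (fun y => christoffelTrace g y 0) x
      = christoffel (basis m) g x 1 1 1 := by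
  have h0 := hg.nuZero_ne hx
  have hV : christoffelTrace g x 0 = 2 * (nuZero g x)⁻¹ * ((nuZero g x)⁻¹
      * christoffelLow (basis m) g x 0 1 1) - (nuZero g x)⁻¹ * tau (angMetric g) x := by
    rw [christoffelTrace, hg.sum_inv_mul_mul hx _ fun a b =>
        (hg.metricAt hx).christoffel_comm _ _ _ _]
    simp only [hg.chr011 hx, hg.chr01A hx, hg.chr0AB hx, hg.chr0 hx 0 1]
    rw [← MetricAt.trace_d1]
    simp only [mul_zero, Finset.sum_const_zero, mul_left_comm ((angMetric g x)⁻¹ _ _),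
      ← Finset.mul_sum]
    ring
  rw [kappa, hV, hg.chr111 hx, hg.low110 hx]
  field_simp
  ring

theorem chrTrace_eq (A : Fin m) : chrTrace (angMetric g) x A
    = ∑ B, ∑ C, (angMetric g x)⁻¹ B C
        * christoffelLow (basis m) g x (ang B) (ang C) (ang A) := by
  have hl : ∀ (A B D : Fin m), christoffelLow (basis m) g x (ang A) (ang B) (ang D)
    = christoffelLow (angBasis m) (angMetric g) x A B D := fun A B D => rfl
  simp only [hl, ← (hg.angMetricAt hx).sum_mul_christoffel, chrTrace, chrS, Finset.mul_sum]
  rw [← sum_rotate]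
  refine Finset.sum_congr rfl fun B _ => Finset.sum_congr rfl fun C _ =>
    Finset.sum_congr rfl fun D _ => by ring

/-- In the same way the lowered component of `V` along `x^A` can be solved for `[01,A]`, the symbol
in `Γ¹_{A1}` with transversal derivatives. -/
theorem xi_christoffelTrace (A : Fin m) :
    xi (angMetric g) (nuZero g) (nuAng g) (fun y => christoffelTrace g y 0)
      (fun y B => christoffelTrace g y (ang B)) x A
      = -2 * christoffel (basis m) g x 1 (ang A) 1 := by
  have h0 := hg.nuZero_ne hx
  have hM := hg.metricAt hx
  -- Lowering the index of `V` gives `g_{Al} V^l = g^{ab} [ab,A]`; the component `V¹` drops out as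
  -- `g_{A1} = 0`.
  have h1 : nuAng g x A * christoffelTrace g x 0
      + lowerAng (angMetric g) (fun y B => christoffelTrace g y (ang B)) x A
      = ∑ a, ∑ b, (g x)⁻¹ a b * christoffelLow (basis m) g x a b (ang A) := by
    have h2 : ∑ l, g x (ang A) l * christoffelTrace g x l
        = ∑ a, ∑ b, (g x)⁻¹ a b * christoffelLow (basis m) g x a b (ang A) := by
      simp only [← hM.sum_mul_christoffel, christoffelTrace, Finset.mul_sum]
      rw [← sum_rotate]
      exact Finset.sum_congr rfl fun B _ => Finset.sum_congr rfl fun C _ =>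
        Finset.sum_congr rfl fun D _ => by ring
    rw [← h2, sum_univ_ang, hg.gA1 hx, hM.comm_at, lowerAng]
    simp [nuAng, angMetric]
  have h3 : ∑ B, nuUp (angMetric g) (nuAng g) x B * christoffelLow (basis m) g x 1 (ang B) (ang A)
      = ∑ B, nuAng g x B * chi (angMetric g) x A B := by
    simp only [hg.low1AB hx, nuUp, ← MetricAt.sum_inv_mul_d1 (q := angMetric g), Finset.sum_mul,
      Finset.mul_sum]
    rw [Finset.sum_comm]
    exact Finset.sum_congr rfl fun B _ => Finset.sum_congr rfl fun C _ => by
      rw [(hg.angMetricAt hx).inv_comm_at C B, (hg.angMetricAt hx).d1_comm C A]; ring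
  rw [hg.sum_inv_mul_mul hx _ fun a b => hM.christoffelLow_comm _ _ _ _, h3, hg.low11A hx,
    ← hg.chrTrace_eq hx] at h1
  rw [xi, hg.chr1A1 hx, hg.low1A0 hx]
  have h4 : (nuZero g x)⁻¹ * nuAng g x A * (nuZero g x * christoffelTrace g x 0)
    = nuAng g x A * christoffelTrace g x 0 := by field_simp
  rw [h4]
  linear_combination h1

/-- Compatibility of the connection with the inverse metric: `∂₁g^{11} = -2 g^{1k} Γ¹_{k1}`, with
`g^{1k}` written out. -/
theorem d1_gUp : d1 (gUp g) x = -2 * ((nuZero g x)⁻¹ * christoffel (basis m) g x 1 0 1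
    + gUp g x * christoffel (basis m) g x 1 1 1
    - (nuZero g x)⁻¹ * ∑ A, nuUp (angMetric g) (nuAng g) x A
        * christoffel (basis m) g x 1 (ang A) 1) := by
  have hM := hg.metricAt hx
  have h1 : d1 (gUp g) x = -2 * ∑ k, (g x)⁻¹ 1 k * christoffel (basis m) g x 1 k 1 := by
    have h2 : ∑ k, ∑ l, (g x)⁻¹ 1 k * christoffelLow (basis m) g x 1 k l * (g x)⁻¹ l 1
        = ∑ k, (g x)⁻¹ 1 k * christoffel (basis m) g x 1 k 1 := by
      refine Finset.sum_congr rfl fun k _ => ?_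
      rw [christoffel_eq, Finset.mul_sum]
      exact Finset.sum_congr rfl fun l _ => by
        rw [hM.inv_comm_at l 1, hM.christoffelLow_comm _ 1 k]; ring
    have h3 : ∑ k, ∑ l, (g x)⁻¹ 1 k * christoffelLow (basis m) g x 1 l k * (g x)⁻¹ l 1
        = ∑ k, (g x)⁻¹ 1 k * christoffel (basis m) g x 1 k 1 := by
      rw [← h2, Finset.sum_comm]
      exact Finset.sum_congr rfl fun l _ => Finset.sum_congr rfl fun k _ => by
        rw [hM.inv_comm_at l 1, hM.inv_comm_at k 1]; ring
    change lineDeriv ℝ (fun y => (g y)⁻¹ 1 1) x (basis m 1) = _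
    rw [hM.lineDeriv_inv]
    simp only [hM.lineDeriv_eq_christoffelLow, mul_add, add_mul, Finset.sum_add_distrib, h2, h3]
    ring
  rw [h1, sum_univ_ang, hg.inv10 hx]
  simp only [hg.inv1A hx, neg_mul, Finset.sum_neg_distrib, mul_assoc, ← Finset.mul_sum, gUp]
  ring

/-- The `01`, `11` and `1A` terms of the trace `V¹` are, by `d1_gUp`, exactly `-∂₁g^{11} - Γ¹₁₁
g^{11}`. This identifies the bracket in `C₀`. -/
theorem christoffelTrace_one : christoffelTrace g x 1 + d1 (gUp g) x
    + christoffel (basis m) g x 1 1 1 * gUp g x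
    = ∑ A, ∑ B, (angMetric g x)⁻¹ A B * christoffel (basis m) g x 1 (ang A) (ang B) := by
  rw [christoffelTrace, hg.sum_inv_mul_mul hx _ fun a b =>
      (hg.metricAt hx).christoffel_comm _ _ _ _,
    hg.d1_gUp hx]
  simp only [(hg.metricAt hx).christoffel_comm _ 1 1 (ang _)]
  ring

theorem einstein11 (hm : 1 ≤ m) :
    einstein (basis m) g x 1 1 = constraintC g (christoffelTrace g) x 1 := by
  have h := MetricAt.sigmaSq_eq (q := angMetric g) (x := x) hm
  rw [einstein, hg.g11 hx, hg.ricci11 hx]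
  change _ = opC1 (angMetric g) (nuZero g) (fun y => christoffelTrace g y 0) x
  rw [opC1, hg.kappa_christoffelTrace hx]
  linear_combination h

theorem einsteinA1 (A : Fin m) :
    einstein (basis m) g x (ang A) 1 = constraintC g (christoffelTrace g) x (ang A) := by
  have hM := hg.metricAt hx
  have hq := hg.angMetricAt hx
  rw [einstein, hg.gA1 hx, hg.ricciA1 hx]
  change _ = opCA (angMetric g) (nuZero g) (nuAng g) (fun y => christoffelTrace g y 0)
    (fun y B => christoffelTrace g y (ang B)) x A
  have h1 : ∀ y ∈ slice U, tau (angMetric g) y - nuZero g y * christoffelTrace g y 0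
      + 2 * (nuZero g y)⁻¹ * d1 (nuZero g) y
      = 2 * (christoffel (basis m) g y 1 1 1 + tau (angMetric g) y) := by
    intro y hy
    rw [← hg.kappa_christoffelTrace hy, kappa]
    ring
  rw [opCA, dA_congr_slice hg.isOpen h1 hx, hg.xi_christoffelTrace hx,
    d1_congr_slice hg.isOpen (fun y hy => hg.xi_christoffelTrace hy A) hx, dA_const_mul,
    d1_const_mul, dA_fun_add (hM.christoffel_differentiableAt _ _ _ _) hq.tau_differentiableAt]
  ring

/-- As `R = 2ν⁰ R₀₁ + g^{11} R₁₁ - 2ν⁰ ν^A R_{1A} + g^{AB} R_{AB}`, the component `R₀₁`, the one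
with second transversal derivatives, cancels in `R₀₁ - ½ ν₀ R`. -/
theorem einstein01 (hm : 1 ≤ m) :
    einstein (basis m) g x 0 1 = constraintC g (christoffelTrace g) x 0 := by
  have hM := hg.metricAt hx
  have hq := hg.angMetricAt hx
  have h0 := hg.nuZero_ne hx
  have hC1 := hg.einstein11 hx hm
  have hCA := hg.einsteinA1 hx
  rw [einstein, hg.g11 hx] at hC1
  simp only [einstein, hg.gA1 hx] at hCA
  change _ = opC1 (angMetric g) (nuZero g) (fun y => christoffelTrace g y 0) x at hC1
  change ∀ A, _ = opCA (angMetric g) (nuZero g) (nuAng g) (fun y => christoffelTrace g y 0)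
    (fun y B => christoffelTrace g y (ang B)) x A at hCA
  -- Known along the whole slice, so that `∂₁` may be applied to it.
  have hB : ∀ y ∈ slice U, d1 (gUp g) y
      + (kappa (angMetric g) (nuZero g) (fun y => christoffelTrace g y 0) y
          + tau (angMetric g) y / 2) * gUp g y + christoffelTrace g y 1
      = (∑ A, ∑ B, (angMetric g y)⁻¹ A B * christoffel (basis m) g y 1 (ang A) (ang B))
        + (1 / 2) * (tau (angMetric g) y * gUp g y) := by
    intro y hy
    rw [← hg.christoffelTrace_one hy, hg.kappa_christoffelTrace hy]
    ring
  have hdB := d1_congr_slice hg.isOpen hB hx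
  have hdiff : DifferentiableAt ℝ (fun y => ∑ A, ∑ B, (angMetric g y)⁻¹ A B
      * christoffel (basis m) g y 1 (ang A) (ang B)) x :=
    DifferentiableAt.fun_sum fun A _ => DifferentiableAt.fun_sum fun B _ =>
      (hq.inv_differentiableAt A B).fun_mul (hM.christoffel_differentiableAt _ _ _ _)
  have hgU : DifferentiableAt ℝ (gUp g) x := hM.inv_differentiableAt 1 1
  rw [d1_fun_add hdiff ((hq.tau_differentiableAt.fun_mul hgU).const_mul _), d1_const_mul,
    d1_fun_mul hq.tau_differentiableAt hgU] at hdB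
  have hdiv : divXi (angMetric g) (nuZero g) (nuAng g) (fun y => christoffelTrace g y 0)
      (fun y B => christoffelTrace g y (ang B)) x
      = -2 * (∑ A, ∑ B, (angMetric g x)⁻¹ A B
            * (dA B (fun y => christoffel (basis m) g y 1 (ang A) 1) x
              - ∑ C, chrS (angMetric g) x C B A * christoffel (basis m) g x 1 (ang C) 1)) := by
    rw [divXi, Finset.sum_comm]
    simp only [dA_congr_slice hg.isOpen (fun y hy => hg.xi_christoffelTrace hy _) hx,
      hg.xi_christoffelTrace hx, Finset.mul_sum]
    refine Finset.sum_congr rfl fun A _ => Finset.sum_congr rfl fun B _ => ?_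
    rw [dA_const_mul, hq.inv_comm_at B A]
    simp only [mul_left_comm _ (-2 : ℝ), ← Finset.mul_sum]
    ring
  have hsq : xiSq (angMetric g) (nuZero g) (nuAng g) (fun y => christoffelTrace g y 0)
      (fun y B => christoffelTrace g y (ang B)) x
      = 4 * ∑ A, ∑ B, (angMetric g x)⁻¹ A B * christoffel (basis m) g x 1 (ang A) 1
            * christoffel (basis m) g x 1 (ang B) 1 := by
    simp only [xiSq, hg.xi_christoffelTrace hx, Finset.mul_sum]
    exact Finset.sum_congr rfl fun A _ => Finset.sum_congr rfl fun B _ => by ring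
  have htr := hg.trace_ricci hx
  rw [hg.sum_inv_mul_riemann1 hx] at htr
  have h1 := hg.christoffelTrace_one hx
  have h2 := hg.d1_gUp hx
  have h3 := hg.ricci11 hx
  have h4 : ∑ A, -(nuZero g x)⁻¹ * nuUp (angMetric g) (nuAng g) x A
        * opCA (angMetric g) (nuZero g) (nuAng g) (fun y => christoffelTrace g y 0)
            (fun y B => christoffelTrace g y (ang B)) x A
      = -(nuZero g x)⁻¹ * ∑ A, nuUp (angMetric g) (nuAng g) x A
        * ricci (basis m) g x 1 (ang A) := by
    rw [Finset.mul_sum]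
    refine Finset.sum_congr rfl fun A _ => ?_
    rw [← hCA, hM.ricci_comm _ 1 (ang A)]
    ring
  change _ = opC0 (angMetric g) (nuZero g) (nuAng g) (gUp g) (fun y => christoffelTrace g y 0)
    (fun y => christoffelTrace g y 1) (fun y B => christoffelTrace g y (ang B)) x
  rw [einstein, scalarCurv, hg.sum_inv_mul_mul hx _ fun a b => hM.ricci_comm _ a b, opC0, ← hC1]
  rw [h4, hdiv, hsq, hdB, hg.kappa_christoffelTrace hx]
  change _ - 1 / 2 * nuZero g x * _ = _
  have hi : nuZero g x * (nuZero g x)⁻¹ = 1 := mul_inv_cancel₀ h0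
  -- The coefficient of `h1` is that of the outer operator `2 (∂₁ + κ + τ)` in `C₀`; `h2` accounts
  -- for the derivative of `½ τ g^{11}`.
  linear_combination (-(1 / 2) * nuZero g x) * (htr - gUp g x * h3
    - 2 * (christoffel (basis m) g x 1 1 1 + tau (angMetric g) x) * h1
    - tau (angMetric g) x * h2) - ricci (basis m) g x 0 1 * hi

end AdaptedMetric

end Slice

/-! ### Contraction of two-index expressions with a matrix. -/

section Contraction

variable {ι : Type*} [Fintype ι]

/-- The contraction `G^{cd} f_{cd}`. -/
def contract (G : Matrix ι ι ℝ) (f : ι → ι → ℝ) : ℝ := ∑ c, ∑ d, G c d * f c d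

variable (G : Matrix ι ι ℝ)

theorem contract_add (f h : ι → ι → ℝ) :
    contract G (fun c d => f c d + h c d) = contract G f + contract G h := by
  simp only [contract, mul_add, Finset.sum_add_distrib]

theorem contract_sub (f h : ι → ι → ℝ) :
    contract G (fun c d => f c d - h c d) = contract G f - contract G h := by
  simp only [contract, mul_sub, Finset.sum_sub_distrib]

theorem contract_mul_left (a : ℝ) (f : ι → ι → ℝ) :
    contract G (fun c d => a * f c d) = a * contract G f := by
  simp only [contract, Finset.mul_sum, mul_left_comm a]

theorem contract_mul_right (a : ℝ) (f : ι → ι → ℝ) :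
    contract G (fun c d => f c d * a) = contract G f * a := by
  simp only [contract, Finset.sum_mul, mul_assoc]

theorem contract_sum (u : ι → ℝ) (f : ι → ι → ι → ℝ) :
    contract G (fun a b => ∑ l, u l * f l a b) = ∑ l, u l * contract G (f l) := by
  simp only [contract, Finset.mul_sum]
  rw [sum_rotate]
  exact Finset.sum_congr rfl fun l _ => Finset.sum_congr rfl fun a _ =>
    Finset.sum_congr rfl fun b _ => by ring

theorem contract_swap (hG : G.IsSymm) (f : ι → ι → ℝ) :
    contract G (fun c d => f d c) = contract G f := by
  rw [contract, contract, Finset.sum_comm]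
  exact Finset.sum_congr rfl fun c _ => Finset.sum_congr rfl fun d _ => by rw [hG.apply]

theorem contract_comm (f : ι → ι → ι → ι → ℝ) :
    contract G (fun a b => contract G (fun c d => f a b c d))
      = contract G (fun c d => contract G (fun a b => f a b c d)) := by
  simp only [contract, Finset.mul_sum]
  rw [sum_rotate]
  refine Finset.sum_congr rfl fun c _ => ?_
  rw [sum_rotate]
  exact Finset.sum_congr rfl fun d _ => Finset.sum_congr rfl fun a _ =>
    Finset.sum_congr rfl fun b _ => by ring

end Contraction

/-! ### Algebra of the curvature jump between two metrics with the same data on a null hypersurface.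
-/

section TransversalJump

variable {ι : Type*} [Fintype ι] (G : Matrix ι ι ℝ) (φ : ι → ℝ) (F k : ι → ι → ℝ)
  (D : ι → ι → ι → ℝ) (r : ι → ι → ℝ)

/-- The jump of the Christoffel symbols `[ab, l]` when the metric jumps by `φ k`. -/
def jumpLow (a b l : ι) : ℝ := (1 / 2) * (φ a * k b l + φ b * k a l - φ l * k a b)

/-- The jump of the second covariant derivatives `∇_d ∇_c g_{ab}`. -/
def jumpHess (d c a b : ι) : ℝ :=
  F d c * k a b + φ c * D a b d + φ d * D a b c + φ c * φ d * r a b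

/-- The jump of the curvature tensor. -/
def jumpRiemann (i a d b : ι) : ℝ :=
  (1 / 2) * (jumpHess φ F k D r d a b i + jumpHess φ F k D r b i d a
      - jumpHess φ F k D r d i b a - jumpHess φ F k D r b a d i)
    - contract G (fun l m => jumpLow φ k d i l * jumpLow φ k b a m)
    + contract G (fun l m => jumpLow φ k b i l * jumpLow φ k d a m)

/-- The jump of the Ricci tensor. -/
def jumpRicci (a b : ι) : ℝ := contract G (fun c d => jumpRiemann G φ F k D r d b c a)

variable {G φ F k D r} (hG : G.IsSymm) (hF : ∀ a b, F a b = F b a) (hk : ∀ a b, k a b = k b a)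
  (hD : ∀ a b d, D a b d = D b a d) (hr : ∀ a b, r a b = r b a)
  (hφ : contract G (fun c d => φ c * φ d) = 0)
  (hnk : ∀ b, contract G (fun c d => φ c * k d b) = (1 / 2) * contract G k * φ b)
include hG hnk

/-- The factor `G^{cd} jumpLow c d l` equals `n^d k_{dl} - ½ (tr k) n_l`, which `hnk` makes zero:
the contracted Christoffel symbols do not jump. -/
theorem contract_jumpLow_trace (a b : ι) :
    contract G (fun c d => contract G (fun l m => jumpLow φ k c d l * jumpLow φ k a b m)) = 0 := by
  rw [contract_comm]
  have h : ∀ l, contract G (fun c d => jumpLow φ k c d l) = 0 := by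
    intro l
    have h1 : contract G (fun c d => φ d * k c l) = (1 / 2) * contract G k * φ l := by
      rw [← hnk, ← contract_swap G hG]
    simp only [jumpLow, contract_mul_left, contract_sub, contract_add, hnk, h1]
    ring
  simp only [contract_mul_right, h, zero_mul]
  simp [contract]

include hk hφ

/-- Of the nine products, those with a contracted `n` are reduced by `hnk`, and `n·n = 0` removes
the others not proportional to `φ a * φ b`. -/
theorem contract_jumpLow_cross (a b : ι) :
    contract G (fun c d => contract G (fun l m => jumpLow φ k a d l * jumpLow φ k c b m))
      = (1 / 4) * φ a * φ b * (contract G (fun c d => contract G (fun l m => k d l * k c m))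
          - (1 / 2) * contract G k ^ 2) := by
  have s1 : ∀ b, contract G (fun c d => φ d * k c b) = (1 / 2) * contract G k * φ b := fun b => by
    rw [← hnk, ← contract_swap G hG]
  have s2 : ∀ b, contract G (fun c d => φ c * k b d) = (1 / 2) * contract G k * φ b := fun b => by
    simp only [hk b, hnk]
  have s3 : ∀ b, contract G (fun c d => φ d * k b c) = (1 / 2) * contract G k * φ b := fun b => by
    simp only [hk b, s1]
  have t1 : ∀ b, contract G (fun c d => φ c * contract G (fun l m => k d l * k b m))
      = (1 / 4) * contract G k ^ 2 * φ b := fun b => by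
    simp only [← contract_mul_left]
    rw [contract_comm]
    simp only [← mul_assoc, contract_mul_right, hnk]
    simp only [mul_assoc, contract_mul_left, s2]
    ring
  have t2 : ∀ a, contract G (fun c d => φ d * contract G (fun l m => k a l * k c m))
      = (1 / 4) * contract G k ^ 2 * φ a := fun a => by
    simp only [← contract_mul_left]
    rw [contract_comm]
    simp only [mul_left_comm (φ _), contract_mul_left, s1]
    simp only [mul_comm (k _ _), contract_mul_left, s3, mul_assoc]
    ring
  have inner : ∀ c d, contract G (fun l m => jumpLow φ k a d l * jumpLow φ k c b m)
      = (1 / 4) * φ a * (φ c * contract G (fun l m => k d l * k b m))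
        + (1 / 4) * φ a * φ b * contract G (fun l m => k d l * k c m)
        - (1 / 8) * φ a * contract G k * (φ d * k c b)
        + (1 / 4) * contract G (fun l m => k a l * k b m) * (φ c * φ d)
        + (1 / 4) * φ b * (φ d * contract G (fun l m => k a l * k c m))
        - (1 / 8) * φ a * contract G k * (φ d * k c b)
        - (1 / 8) * φ b * contract G k * (φ c * k a d)
        - (1 / 8) * φ b * contract G k * (φ c * k a d) := by
    intro c d
    have e : ∀ l m, jumpLow φ k a d l * jumpLow φ k c b m
        = (1 / 4) * φ a * φ c * (k d l * k b m) + (1 / 4) * φ a * φ b * (k d l * k c m)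
          - (1 / 4) * φ a * k c b * (φ m * k d l) + (1 / 4) * φ c * φ d * (k a l * k b m)
          + (1 / 4) * φ b * φ d * (k a l * k c m) - (1 / 4) * φ d * k c b * (φ m * k a l)
          - (1 / 4) * φ c * k a d * (φ l * k b m) - (1 / 4) * φ b * k a d * (φ l * k c m)
          + (1 / 4) * k a d * k c b * (φ l * φ m) := fun l m => by
      simp only [jumpLow]; ring
    simp only [e, contract_add, contract_sub, contract_mul_left, s3, s2, hφ]
    ring
  simp only [inner, contract_add, contract_sub, contract_mul_left, t1, t2, s1, s2, hφ]
  ring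

include hF hD hr

/-- Trace of `jumpRiemann` with equal terms collected. One quadratic part has zero trace, the other
is a multiple of `φ a * φ b`, and the term `r a b` is removed by `n·n = 0`. -/
theorem jumpRicci_eq (a b : ι) : jumpRicci G φ F k D r a b
    = (1 / 2) * (contract G (fun c d => F c b * k d a) + contract G (fun c d => F c a * k d b)
      + φ b * (contract G (fun c d => D d a c) + contract G (fun c d => φ c * r d a))
      + φ a * (contract G (fun c d => D d b c) + contract G (fun c d => φ c * r d b))
      + contract G (fun c d => φ c * D d a b) + contract G (fun c d => φ c * D d b a)
      - contract G F * k a b - 2 * contract G (fun c d => φ c * D a b d)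
      - F a b * contract G k - φ b * contract G (fun c d => D c d a)
      - φ a * contract G (fun c d => D c d b) - φ a * φ b * contract G r)
      + (1 / 4) * φ a * φ b * (contract G (fun c d => contract G (fun l m => k d l * k c m))
          - (1 / 2) * contract G k ^ 2) := by
  rw [← contract_jumpLow_cross hG hk hφ hnk]
  have h0 := contract_jumpLow_trace hG hnk a b
  have e : ∀ c d, jumpRiemann G φ F k D r d b c a
      = (1 / 2) * (F c b * k d a) + (1 / 2) * φ b * D d a c + (1 / 2) * (φ c * D d a b)
        + (1 / 2) * φ b * (φ c * r d a)
        + (1 / 2) * (F d a * k c b) + (1 / 2) * (φ d * D c b a) + (1 / 2) * φ a * D c b d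
        + (1 / 2) * φ a * (φ d * r c b)
        - (1 / 2) * k a b * F c d - (1 / 2) * (φ c * D a b d) - (1 / 2) * (φ d * D a b c)
        - (1 / 2) * r a b * (φ c * φ d)
        - (1 / 2) * F a b * k c d - (1 / 2) * φ b * D c d a - (1 / 2) * φ a * D c d b
        - (1 / 2) * φ a * φ b * r c d
        - contract G (fun l m => jumpLow φ k c d l * jumpLow φ k a b m)
        + contract G (fun l m => jumpLow φ k a d l * jumpLow φ k c b m) := by
    intro c d
    simp only [jumpRiemann, jumpHess, hk a d, hF a d, hr a d, hD a d]
    ring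
  have w1 : contract G (fun c d => F d a * k c b) = contract G (fun c d => F c a * k d b) :=
    contract_swap G hG (fun c d => F c a * k d b)
  have w2 : contract G (fun c d => φ d * D c b a) = contract G (fun c d => φ c * D d b a) :=
    contract_swap G hG (fun c d => φ c * D d b a)
  have w3 : contract G (fun c d => D c b d) = contract G (fun c d => D d b c) :=
    contract_swap G hG (fun c d => D d b c)
  have w4 : contract G (fun c d => φ d * r c b) = contract G (fun c d => φ c * r d b) :=
    contract_swap G hG (fun c d => φ c * r d b)
  have w5 : contract G (fun c d => φ d * D a b c) = contract G (fun c d => φ c * D a b d) :=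
    contract_swap G hG (fun c d => φ c * D a b d)
  have w6 : contract G (fun c d => F c d) = contract G F := rfl
  simp only [jumpRicci, e, contract_add, contract_sub, contract_mul_left, w1, w2, w3, w4,
      w5, hφ, h0]
  ring

/-- The Einstein tensor, contracted with the null normal, does not jump. -/
theorem jumpEinstein_eq_zero {y : ι → ℝ} {μ : ℝ}
    (hFn : ∀ a, contract G (fun c d => φ c * F d a) = μ * φ a)
    (hnD : ∀ a b, contract G (fun c d => φ c * D d a b)
      = (1 / 2) * φ a * contract G (fun c d => D c d b) + (1 / 2) * F a b * contract G k
        - contract G (fun c d => F c b * k d a) + φ b * y a) (a : ι) :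
    contract G (fun c b => φ c * jumpRicci G φ F k D r a b)
      - (1 / 2) * φ a * contract G (jumpRicci G φ F k D r) = 0 := by
  -- Meaning of the two hypotheses: `hFn` is the derivative of `n·n = 0` and `hnD` that of `hnk`.
  -- Both relations hold only on the hypersurface, so their derivatives are known up to multiples of
  -- `φ`, which are `μ` and `y`.
  have s1 : ∀ b, contract G (fun c d => φ d * k c b) = (1 / 2) * contract G k * φ b := fun b => by
    rw [← hnk, ← contract_swap G hG]
  have s2 : ∀ b, contract G (fun c d => φ c * k b d) = (1 / 2) * contract G k * φ b := fun b => by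
    simp only [hk b, hnk]
  have f2 : ∀ b, contract G (fun c d => φ c * F b d) = μ * φ b := fun b => by
    simp only [hF b, hFn]
  have hnD' : ∀ a b, contract G (fun c d => φ c * D a d b)
      = (1 / 2) * φ a * contract G (fun c d => D c d b) + (1 / 2) * F a b * contract G k
        - contract G (fun c d => F c b * k d a) + φ b * y a := fun a b => by
    simp only [hD a, hnD]
  have n1 : contract G (fun c b => φ c * contract G (fun i j => F i b * k j a))
      = (1 / 2) * μ * contract G k * φ a := by
    simp only [← contract_mul_left]
    rw [contract_comm]
    simp only [← mul_assoc, contract_mul_right, f2]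
    simp only [mul_assoc, contract_mul_left, hnk]
    ring
  have n2 : contract G (fun c b => φ c * contract G (fun i j => F i a * k j b))
      = (1 / 2) * μ * contract G k * φ a := by
    simp only [← contract_mul_left]
    rw [contract_comm]
    simp only [mul_left_comm (φ _), contract_mul_left, s2]
    simp only [mul_comm (F _ _), mul_assoc, contract_mul_left]
    rw [contract_swap G hG (fun i j => φ i * F j a), hFn]
    ring
  have n6 : contract G (fun c b => φ c * contract G (fun i j => φ i * D j a b))
      = (1 / 2) * φ a * contract G (fun c b => φ c * contract G (fun i j => D i j b)) := by
    have e : ∀ c b, φ c * contract G (fun i j => φ i * D j a b)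
        = (1 / 2) * φ a * (φ c * contract G (fun i j => D i j b))
          + (1 / 2) * contract G k * (φ c * F a b)
          - φ c * contract G (fun i j => F i b * k j a) + y a * (φ c * φ b) := fun c b => by
      rw [hnD]; ring
    simp only [e, contract_add, contract_sub, contract_mul_left, f2, n1, hφ]
    ring
  have n7 : contract G (fun c b => φ c * contract G (fun i j => φ i * D j b a))
      = φ a * contract G (fun c b => φ c * y b) := by
    have e : ∀ c b, φ c * contract G (fun i j => φ i * D j b a)
        = (1 / 2) * contract G (fun i j => D i j a) * (φ c * φ b)
          + (1 / 2) * contract G k * (φ c * F b a)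
          - φ c * contract G (fun i j => F i a * k j b) + φ a * (φ c * y b) := fun c b => by
      rw [hnD]; ring
    simp only [e, contract_add, contract_sub, contract_mul_left, hFn, n2, hφ]
    ring
  have n9 : contract G (fun c b => φ c * contract G (fun i j => φ i * D a b j))
      = (1 / 2) * φ a * contract G (fun c b => φ c * contract G (fun i j => D i j b)) := by
    rw [← n6]
    simp only [← contract_mul_left]
    rw [contract_comm]
    simp only [mul_left_comm (φ _) (φ _)]
    simp only [contract_mul_left, hnD', hnD]
  have hRic := jumpRicci_eq hG hF hk hD hr hφ hnk
  have e1 : ∀ c b, φ c * jumpRicci G φ F k D r a b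
      = (1 / 2) * (φ c * contract G (fun i j => F i b * k j a))
        + (1 / 2) * (φ c * contract G (fun i j => F i a * k j b))
        + (1 / 2) * (contract G (fun i j => D j a i) + contract G (fun i j => φ i * r j a))
          * (φ c * φ b)
        + (1 / 2) * φ a * (φ c * contract G (fun i j => D j b i))
        + (1 / 2) * φ a * (φ c * contract G (fun i j => φ i * r j b))
        + (1 / 2) * (φ c * contract G (fun i j => φ i * D j a b))
        + (1 / 2) * (φ c * contract G (fun i j => φ i * D j b a))
        - (1 / 2) * contract G F * (φ c * k a b)
        - φ c * contract G (fun i j => φ i * D a b j)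
        - (1 / 2) * contract G k * (φ c * F a b)
        - (1 / 2) * contract G (fun i j => D i j a) * (φ c * φ b)
        - (1 / 2) * φ a * (φ c * contract G (fun i j => D i j b))
        + φ a * (-(1 / 2) * contract G r
          + (1 / 4) * (contract G (fun c d => contract G (fun l m => k d l * k c m))
            - (1 / 2) * contract G k ^ 2)) * (φ c * φ b) := fun c b => by
    rw [hRic]; ring
  have m5 : contract G (fun a b => contract G (fun c d => φ c * D d a b))
      = contract G (fun c b => φ c * contract G (fun i j => D j b i)) := by
    rw [← contract_swap G hG]
    simp only [← contract_mul_left]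
    rw [contract_comm G (fun c b i j => φ c * D j b i)]
    simp only [hnD', hnD]
  -- The double contraction of `m5`, now evaluated through the differentiated condition `hnD`.
  -- Comparing the two values eliminates `φ·y` and the contraction of `F` with `k`, and closes the
  -- identity.
  have m5' : contract G (fun a b => contract G (fun c d => φ c * D d a b))
      = (1 / 2) * contract G (fun c b => φ c * contract G (fun i j => D i j b))
        + (1 / 2) * contract G F * contract G k
        - contract G (fun a b => contract G (fun c d => F c b * k d a))
        + contract G (fun c b => φ c * y b) := by
    simp only [hnD, mul_assoc, contract_add, contract_sub, contract_mul_left, contract_mul_right]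
    rw [contract_swap G hG (fun a b => φ a * y b)]
  have m8 : contract G (fun a b => contract G (fun c d => φ c * D a b d))
      = contract G (fun c b => φ c * contract G (fun i j => D i j b)) := by
    rw [contract_comm]
    simp only [contract_mul_left]
  -- The second transversal derivatives `r` enter this trace and `Ric(·,n)` only through `r(n,n)`,
  -- with coefficients that cancel in the Einstein tensor.
  have e2 : contract G (jumpRicci G φ F k D r)
      = contract G (fun a b => contract G (fun c d => F c b * k d a))
        + 2 * contract G (fun c b => φ c * contract G (fun i j => D j b i))
        + contract G (fun c b => φ c * contract G (fun i j => φ i * r j b))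
        - contract G F * contract G k
        - 2 * contract G (fun c b => φ c * contract G (fun i j => D i j b)) := by
    have e3 : ∀ a b, jumpRicci G φ F k D r a b
        = (1 / 2) * contract G (fun i j => F i b * k j a)
          + (1 / 2) * contract G (fun i j => F i a * k j b)
          + (1 / 2) * (φ b * contract G (fun i j => D j a i))
          + (1 / 2) * (φ b * contract G (fun i j => φ i * r j a))
          + (1 / 2) * (φ a * contract G (fun i j => D j b i))
          + (1 / 2) * (φ a * contract G (fun i j => φ i * r j b))
          + (1 / 2) * contract G (fun i j => φ i * D j a b)
          + (1 / 2) * contract G (fun i j => φ i * D j b a)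
          - (1 / 2) * contract G F * k a b
          - contract G (fun i j => φ i * D a b j)
          - (1 / 2) * contract G k * F a b
          - (1 / 2) * (φ b * contract G (fun i j => D i j a))
          - (1 / 2) * (φ a * contract G (fun i j => D i j b))
          + (-(1 / 2) * contract G r
            + (1 / 4) * (contract G (fun c d => contract G (fun l m => k d l * k c m))
              - (1 / 2) * contract G k ^ 2)) * (φ a * φ b) := fun a b => by
      rw [hRic]; ring
    have hfun : jumpRicci G φ F k D r = fun a b => jumpRicci G φ F k D r a b := rfl
    rw [hfun]
    simp only [e3, contract_add, contract_sub, contract_mul_left, hφ, m8, m5]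
    rw [contract_swap G hG (fun a b => φ a * contract G (fun i j => D j b i)),
      contract_swap G hG (fun a b => φ a * contract G (fun i j => φ i * r j b)),
      contract_swap G hG (fun a b => φ a * contract G (fun i j => D i j b)),
      contract_swap G hG (fun a b => contract G (fun i j => F i b * k j a)),
      contract_swap G hG (fun a b => contract G (fun i j => φ i * D j a b)), m5]
    ring
  simp only [e1, contract_add, contract_sub, contract_mul_left, n1, n2, n6, n7, n9, hφ, s2, f2]
  rw [e2]
  linear_combination (1 / 2) * φ a * (m5 - m5')

end TransversalJump

/-! ### Derivatives of functions that vanish on a regular level set. -/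

section Vanishing

variable {X : Type*} [NormedAddCommGroup X] [NormedSpace ℝ X] [CompleteSpace X]
  {f φ : X → ℝ} {p : X}

/-- A function which vanishes on a regular level set has there a gradient proportional to that of
the defining function. -/
theorem exists_lineDeriv_eq_mul (hf : ContDiffAt ℝ 1 f p) (hφ : ContDiffAt ℝ 1 φ p)
    (hφ0 : fderiv ℝ φ p ≠ 0) (hφp : φ p = 0) (hz : ∀ᶠ y in 𝓝 p, φ y = 0 → f y = 0) :
    ∃ c, ∀ v, lineDeriv ℝ f p v = lineDeriv ℝ φ p v * c := by
  -- Being constant on the level set, `f` has a constrained extremum at `p`, so the Lagrange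
  -- multiplier rule applies.
  have h1 : IsLocalExtrOn f {x | φ x = φ p} p := by
    left
    have : ∀ᶠ y in 𝓝[{x | φ x = φ p}] p, f p ≤ f y := by
      filter_upwards [hz.filter_mono nhdsWithin_le_nhds, self_mem_nhdsWithin] with y hy hy2
      rw [hy (by rw [← hφp]; exact hy2), hz.self_of_nhds hφp]
    exact this
  obtain ⟨a, b, hab, h⟩ := h1.exists_multipliers_of_hasStrictFDerivAt_1d
    (hφ.hasStrictFDerivAt (by decide)) (hf.hasStrictFDerivAt (by decide))
  -- Otherwise a nonzero multiple of the differential of `φ` at `p` would vanish.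
  have hb : b ≠ 0 := by
    rintro rfl
    have ha : a ≠ 0 := fun ha => hab (by simp [ha])
    simp [ha, hφ0] at h
  refine ⟨-(a / b), fun v => ?_⟩
  rw [(hf.differentiableAt (by decide)).lineDeriv_eq_fderiv,
    (hφ.differentiableAt (by decide)).lineDeriv_eq_fderiv]
  have h2 := congrArg (fun L => L v) h
  simp only [add_apply, smul_apply, smul_eq_mul, zero_apply] at h2
  field_simp
  linarith

/-- The derivatives up to second order, on a regular level set, of a function vanishing there. -/
theorem exists_hessian_of_vanishing (hf : ContDiffAt ℝ 2 f p) (hφ : ContDiffAt ℝ 2 φ p)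
    (hφ0 : fderiv ℝ φ p ≠ 0) (hφp : φ p = 0) (hz : ∀ᶠ y in 𝓝 p, φ y = 0 → f y = 0) :
    ∃ (K : X → ℝ) (r : ℝ), ContDiffAt ℝ 1 K p ∧
      (∀ᶠ y in 𝓝 p, φ y = 0 → ∀ v, lineDeriv ℝ f y v = lineDeriv ℝ φ y v * K y) ∧
      ∀ v w, lineDeriv ℝ (fun y => lineDeriv ℝ f y v) p w
        = lineDeriv ℝ (fun y => lineDeriv ℝ φ y v) p w * K p
          + lineDeriv ℝ φ p v * lineDeriv ℝ K p w + lineDeriv ℝ φ p w * lineDeriv ℝ K p v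
          + lineDeriv ℝ φ p v * lineDeriv ℝ φ p w * r := by
  obtain ⟨n, hn⟩ : ∃ n, lineDeriv ℝ φ p n ≠ 0 := by
    by_contra! h
    exact hφ0 (ContinuousLinearMap.ext fun v => by
      rw [← (hφ.differentiableAt (by decide)).lineDeriv_eq_fderiv, h]; rfl)
  have hfs : ∀ v, ContDiffAt ℝ 1 (fun y => lineDeriv ℝ f y v) p := fun v =>
    ContDiffAt.lineDeriv_right (n := 2) (k := 1) v hf (by norm_num) (by decide)
  have hφs : ∀ v, ContDiffAt ℝ 1 (fun y => lineDeriv ℝ φ y v) p := fun v =>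
    ContDiffAt.lineDeriv_right (n := 2) (k := 1) v hφ (by norm_num) (by decide)
  -- The multiplier is read off along one fixed transversal direction `n`; as a quotient of `C¹`
  -- functions it is `C¹`.
  set K : X → ℝ := fun y => lineDeriv ℝ f y n / lineDeriv ℝ φ y n with hK
  have hKs : ContDiffAt ℝ 1 K p := (hfs n).div (hφs n) hn
  have hev : ∀ᶠ y in 𝓝 p, φ y = 0 → ∀ v, lineDeriv ℝ f y v = lineDeriv ℝ φ y v * K y := by
    have hd : ∀ᶠ y in 𝓝 p, fderiv ℝ φ y ≠ 0 :=
      ((hφ.fderiv_right (m := 1) (by norm_num)).continuousAt).eventually_ne hφ0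
    filter_upwards [hf.eventually (by decide), hφ.eventually (by decide), hd,
      (hφs n).continuousAt.eventually_ne hn, hz.eventually_nhds] with y h1 h2 h3 h4 h5 h6 v
    obtain ⟨c, hc⟩ := exists_lineDeriv_eq_mul (h1.of_le (by norm_num)) (h2.of_le (by norm_num))
      h3 h6 h5
    have : K y = c := by rw [hK]; simp only; rw [hc n]; field_simp
    rw [this, hc]
  have hc : ∀ v, ∃ c, ∀ w, lineDeriv ℝ (fun y => lineDeriv ℝ f y v) p w
      = lineDeriv ℝ (fun y => lineDeriv ℝ φ y v) p w * K p
        + lineDeriv ℝ φ p v * lineDeriv ℝ K p w + lineDeriv ℝ φ p w * c := by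
    intro v
    -- The first-order relation again says that a `C¹` function vanishes on the level set, so the
    -- gradient lemma applies once more.
    obtain ⟨c, hc⟩ := exists_lineDeriv_eq_mul (f := fun y => lineDeriv ℝ f y v
      - lineDeriv ℝ φ y v * K y) ((hfs v).sub ((hφs v).mul hKs)) (hφ.of_le (by norm_num)) hφ0 hφp
      (by filter_upwards [hev] with y hy h0; rw [hy h0 v, sub_self])
    refine ⟨c, fun w => ?_⟩
    have h1 := hc w
    have d1 := (hfs v).differentiableAt (by decide)
    have d2 := (hφs v).differentiableAt (by decide)
    have d3 := hKs.differentiableAt (by decide)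
    rw [lineDeriv_fun_sub w d1 (d2.fun_mul d3), lineDeriv_fun_mul w d2 d3] at h1
    linarith
  choose c hc using hc
  -- The value of `r` is forced by comparing the second derivatives in the orders `(v, n)` and `(n,
  -- v)`.
  refine ⟨K, (c n - lineDeriv ℝ K p n) / lineDeriv ℝ φ p n, hKs, hev, fun v w => ?_⟩
  have h1 := hc v n
  have h2 := hc n v
  rw [lineDeriv_comm hf v n, h2, lineDeriv_comm hφ v n] at h1
  rw [hc v w]
  have : c v = lineDeriv ℝ K p v
      + lineDeriv ℝ φ p v * ((c n - lineDeriv ℝ K p n) / lineDeriv ℝ φ p n) := by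
    field_simp
    linarith
  rw [this]
  ring

end Vanishing

/-! ### Comparison of two metrics with the same data on a null hypersurface. -/

section Jump

variable {X ι : Type*} [NormedAddCommGroup X] [NormedSpace ℝ X] [Fintype ι] [DecidableEq ι]

namespace MetricAt

variable {g : X → Matrix ι ι ℝ} {x : X} (hg : MetricAt g x) (e : ι → X)
include hg

theorem lineDeriv_inv_eq_christoffel (a b d : ι) :
    lineDeriv ℝ (fun y => (g y)⁻¹ a b) x (e d)
      = -(∑ i, (g x)⁻¹ a i * christoffel e g x b d i)
        - ∑ i, (g x)⁻¹ i b * christoffel e g x a d i := by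
  rw [hg.lineDeriv_inv]
  simp only [hg.lineDeriv_eq_christoffelLow, mul_add, add_mul, Finset.sum_add_distrib]
  have h1 : ∑ i, ∑ j, (g x)⁻¹ a i * christoffelLow e g x d i j * (g x)⁻¹ j b
      = ∑ i, (g x)⁻¹ a i * christoffel e g x b d i := by
    refine Finset.sum_congr rfl fun i _ => ?_
    rw [christoffel_eq, Finset.mul_sum]
    exact Finset.sum_congr rfl fun j _ => by rw [hg.inv_comm_at j b]; ring
  have h2 : ∑ i, ∑ j, (g x)⁻¹ a i * christoffelLow e g x d j i * (g x)⁻¹ j b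
      = ∑ i, (g x)⁻¹ i b * christoffel e g x a d i := by
    rw [Finset.sum_comm]
    refine Finset.sum_congr rfl fun i _ => ?_
    rw [christoffel_eq, Finset.mul_sum]
    exact Finset.sum_congr rfl fun j _ => by ring
  rw [h1, h2]
  ring

/-- The derivative of a contraction, expressed by covariant derivatives. -/
theorem lineDeriv_contract {f : ι → ι → X → ℝ} (hf : ∀ a b, DifferentiableAt ℝ (f a b) x) (d : ι) :
    lineDeriv ℝ (fun y => contract (g y)⁻¹ (fun a b => f a b y)) x (e d)
      = contract (g x)⁻¹ (fun a b => lineDeriv ℝ (f a b) x (e d)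
          - (∑ l, christoffel e g x l d a * f l b x)
          - ∑ l, christoffel e g x l d b * f a l x) := by
  simp only [contract]
  rw [lineDeriv_fun_sum _ fun a => DifferentiableAt.fun_sum fun b _ =>
    (hg.inv_differentiableAt a b).fun_mul (hf a b)]
  simp only [lineDeriv_fun_sum (e d) fun b => (hg.inv_differentiableAt _ b).fun_mul (hf _ b),
    lineDeriv_fun_mul (e d) (hg.inv_differentiableAt _ _) (hf _ _),
    hg.lineDeriv_inv_eq_christoffel, mul_sub, sub_mul, neg_mul, Finset.sum_add_distrib,
    Finset.sum_sub_distrib, Finset.sum_neg_distrib, Finset.sum_mul, Finset.mul_sum]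
  have h1 : ∑ a, ∑ b, ∑ i, (g x)⁻¹ a i * christoffel e g x b d i * f a b x
      = ∑ a, ∑ b, ∑ l, (g x)⁻¹ a b * (christoffel e g x l d b * f a l x) := by
    refine Finset.sum_congr rfl fun a _ => ?_
    rw [Finset.sum_comm]
    exact Finset.sum_congr rfl fun b _ => Finset.sum_congr rfl fun l _ => by ring
  have h2 : ∑ a, ∑ b, ∑ i, (g x)⁻¹ i b * christoffel e g x a d i * f a b x
      = ∑ a, ∑ b, ∑ l, (g x)⁻¹ a b * (christoffel e g x l d a * f l b x) := by
    rw [sum_rotate]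
    refine Finset.sum_congr rfl fun a _ => ?_
    rw [Finset.sum_comm]
    exact Finset.sum_congr rfl fun b _ => Finset.sum_congr rfl fun l _ => by ring
  rw [h1, h2]
  ring

end MetricAt

omit [DecidableEq ι] in
theorem sum_jumpLow_mul (φ : ι → ℝ) (k : ι → ι → ℝ) (a b : ι) (u : ι → ℝ) :
    ∑ l, jumpLow φ k a b l * u l
      = (1 / 2) * (φ a * (∑ l, k b l * u l) + φ b * (∑ l, k a l * u l)
          - k a b * ∑ l, φ l * u l) := by
  simp only [Finset.mul_sum, ← Finset.sum_add_distrib, ← Finset.sum_sub_distrib]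
  exact Finset.sum_congr rfl fun l _ => by rw [jumpLow]; ring

end Jump

section Jump

variable {X ι : Type*} [NormedAddCommGroup X] [NormedSpace ℝ X] [CompleteSpace X] [Fintype ι]
  [DecidableEq ι]

/-- Two metrics near a point `p` of a regular `C²` hypersurface `φ = 0`, null for `g`, which
agree on
the hypersurface together with their contracted Christoffel symbols. -/
structure MetricPair (e : ι → X) (g g' : X → Matrix ι ι ℝ) (φ : X → ℝ) (p : X) : Prop where
  left : MetricAt g p
  right : MetricAt g' p
  smooth : ContDiffAt ℝ 2 φ p
  regular : fderiv ℝ φ p ≠ 0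
  zero : φ p = 0
  eq_on : ∀ᶠ y in 𝓝 p, φ y = 0 → g' y = g y
  trace_eq : ∀ᶠ y in 𝓝 p, φ y = 0 → ∀ l,
    contract (g' y)⁻¹ (christoffel e g' y l) = contract (g y)⁻¹ (christoffel e g y l)
  null : ∀ᶠ y in 𝓝 p, φ y = 0 →
    contract (g y)⁻¹ (fun a b => lineDeriv ℝ φ y (e a) * lineDeriv ℝ φ y (e b)) = 0

namespace MetricPair

variable {e : ι → X} {g g' : X → Matrix ι ι ℝ} {φ : X → ℝ} {p : X}
  (h : MetricPair e g g' φ p)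
include h

/-- The expansion of `exists_hessian_of_vanishing`, applied to each component of `g' - g`. -/
theorem exists_jump : ∃ (K : ι → ι → X → ℝ) (r : ι → ι → ℝ),
    (∀ a b, K a b = K b a) ∧ (∀ a b, r a b = r b a) ∧ (∀ a b, ContDiffAt ℝ 1 (K a b) p) ∧
    (∀ᶠ y in 𝓝 p, φ y = 0 → ∀ a b v, lineDeriv ℝ (fun z => g' z a b) y v
      = lineDeriv ℝ (fun z => g z a b) y v + lineDeriv ℝ φ y v * K a b y) ∧
    ∀ a b v w, lineDeriv ℝ (fun y => lineDeriv ℝ (fun z => g' z a b) y v) p w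
      = lineDeriv ℝ (fun y => lineDeriv ℝ (fun z => g z a b) y v) p w
        + (lineDeriv ℝ (fun y => lineDeriv ℝ φ y v) p w * K a b p
          + lineDeriv ℝ φ p v * lineDeriv ℝ (K a b) p w
          + lineDeriv ℝ φ p w * lineDeriv ℝ (K a b) p v
          + lineDeriv ℝ φ p v * lineDeriv ℝ φ p w * r a b) := by
  -- The multipliers are chosen as a function of the vanishing function, not of the index pair.
  -- Applied to the symmetrised differences below, equal functions get equal multipliers, so `K` and
  -- `r` come out symmetric in `a` and `b`.
  have key : ∀ f : {f : X → ℝ // ContDiffAt ℝ 2 f p ∧ ∀ᶠ y in 𝓝 p, φ y = 0 → f y = 0}, _ :=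
    fun f => exists_hessian_of_vanishing f.2.1 h.smooth h.regular h.zero f.2.2
  choose K r hK hev hH using key
  have hs : ∀ a b, ContDiffAt ℝ 2 (fun y => (1 / 2) * ((g' y a b - g y a b) + (g' y b a - g y b a)))
      p := fun a b => contDiffAt_const.mul (((h.right.smooth a b).sub (h.left.smooth a b)).add
        ((h.right.smooth b a).sub (h.left.smooth b a)))
  have hz : ∀ a b, ∀ᶠ y in 𝓝 p, φ y = 0 →
      (1 / 2) * ((g' y a b - g y a b) + (g' y b a - g y b a)) = 0 := fun a b => by
    filter_upwards [h.eq_on] with y hy h0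
    rw [hy h0]; ring
  let F : ι → ι → {f : X → ℝ // ContDiffAt ℝ 2 f p ∧ ∀ᶠ y in 𝓝 p, φ y = 0 → f y = 0} :=
    fun a b => ⟨_, hs a b, hz a b⟩
  have hF : ∀ a b, F a b = F b a := fun a b => Subtype.ext (funext fun y => by
    change (1 / 2) * ((g' y a b - g y a b) + (g' y b a - g y b a))
      = (1 / 2) * ((g' y b a - g y b a) + (g' y a b - g y a b))
    ring)
  have hFg : ∀ a b, (F a b).1 =ᶠ[𝓝 p] fun y => g' y a b - g y a b := fun a b => by
    filter_upwards [h.left.symm, h.right.symm] with y h1 h2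
    change (1 / 2) * ((g' y a b - g y a b) + (g' y b a - g y b a)) = _
    rw [h1.apply a b, h2.apply a b]; ring
  have hd : ∀ᶠ y in 𝓝 p, ∀ a b v, lineDeriv ℝ (F a b).1 y v
      = lineDeriv ℝ (fun z => g' z a b) y v - lineDeriv ℝ (fun z => g z a b) y v := by
    refine eventually_all.2 fun a => eventually_all.2 fun b => ?_
    filter_upwards [(hFg a b).eventually_nhds, h.left.eventually, h.right.eventually]
      with y h1 h2 h3 v
    rw [EventuallyEq.lineDeriv_eq h1,
      lineDeriv_fun_sub v (h3.differentiableAt a b) (h2.differentiableAt a b)]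
  refine ⟨fun a b => K (F a b), fun a b => r (F a b), fun a b => by simp only [hF a b],
    fun a b => by simp only [hF a b], fun a b => hK _, ?_, fun a b v w => ?_⟩
  · have : ∀ᶠ y in 𝓝 p, ∀ a b, φ y = 0 → ∀ v, lineDeriv ℝ (F a b).1 y v
        = lineDeriv ℝ φ y v * K (F a b) y :=
      eventually_all.2 fun a => eventually_all.2 fun b => hev (F a b)
    filter_upwards [this, hd] with y h1 h2 h0 a b v
    rw [← h1 a b h0 v, h2]
    ring
  · rw [← hH (F a b) v w]
    have h1 : (fun y => lineDeriv ℝ (F a b).1 y v) =ᶠ[𝓝 p] fun y =>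
        lineDeriv ℝ (fun z => g' z a b) y v - lineDeriv ℝ (fun z => g z a b) y v := by
      filter_upwards [hd] with y hy
      exact hy a b v
    rw [h1.lineDeriv_eq, lineDeriv_fun_sub w
      ((h.right.lineDeriv_smooth a b v).differentiableAt (by decide))
      ((h.left.lineDeriv_smooth a b v).differentiableAt (by decide))]
    ring

/-- On a null hypersurface, the Einstein tensor contracted with the normal is determined by the
metric and the contracted Christoffel symbols on the hypersurface. -/
theorem einstein_jump (a : ι) :
    contract (g p)⁻¹ (fun c b => lineDeriv ℝ φ p (e c) * (ricci e g' p a b - ricci e g p a b))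
      - (1 / 2) * lineDeriv ℝ φ p (e a)
        * contract (g p)⁻¹ (fun b c => ricci e g' p b c - ricci e g p b c) = 0 := by
  obtain ⟨K, r, hKsymm, hr, hKs, hev, hH⟩ := h.exists_jump
  have hg := h.left
  have hg' := h.right
  have hgg : g' p = g p := h.eq_on.self_of_nhds h.zero
  set ψ : ι → ℝ := fun a => lineDeriv ℝ φ p (e a) with hψ
  set k : ι → ι → ℝ := fun a b => K a b p with hk
  -- `F` is the covariant Hessian of `φ` and `D` the covariant derivative of the jump `K`, both with
  -- respect to `g`.
  set F : ι → ι → ℝ := fun d c => lineDeriv ℝ (fun y => lineDeriv ℝ φ y (e c)) p (e d)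
    - ∑ l, ψ l * christoffel e g p l d c with hF
  set D : ι → ι → ι → ℝ := fun a b d => lineDeriv ℝ (K a b) p (e d)
    - (∑ l, k b l * christoffel e g p l d a) - ∑ l, k a l * christoffel e g p l d b with hD
  have hφs : ∀ a, ContDiffAt ℝ 1 (fun y => lineDeriv ℝ φ y (e a)) p := fun a =>
    ContDiffAt.lineDeriv_right (n := 2) (k := 1) _ h.smooth (by norm_num) (by decide)
  have hφd : ∀ a, DifferentiableAt ℝ (fun y => lineDeriv ℝ φ y (e a)) p := fun a =>
    (hφs a).differentiableAt (by decide)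
  have hKd : ∀ a b, DifferentiableAt ℝ (K a b) p := fun a b =>
    (hKs a b).differentiableAt (by decide)
  have hksymm : ∀ a b, k a b = k b a := fun a b => by simp only [hk, hKsymm a b]
  have hFsymm : ∀ a b, F a b = F b a := fun a b => by
    simp only [hF, lineDeriv_comm h.smooth (e b) (e a), hg.christoffel_comm e _ a b]
  have hDsymm : ∀ a b d, D a b d = D b a d := fun a b d => by
    simp only [hD, hKsymm a b]
    ring
  have hnull := h.null.self_of_nhds h.zero
  have hlow : ∀ᶠ y in 𝓝 p, φ y = 0 → ∀ a b l, christoffelLow e g' y a b l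
      = christoffelLow e g y a b l
        + jumpLow (fun a => lineDeriv ℝ φ y (e a)) (fun a b => K a b y) a b l := by
    filter_upwards [hev] with y hy h0 a b l
    simp only [christoffelLow, jumpLow, hy h0]
    ring
  -- Equality of the contracted Christoffel symbols, after lowering the index. It is recorded at all
  -- nearby points of the hypersurface, so that it can be differentiated.
  have hZ : ∀ᶠ y in 𝓝 p, φ y = 0 → ∀ c,
      contract (g y)⁻¹ (fun a b => lineDeriv ℝ φ y (e a) * K b c y
        - (1 / 2) * (lineDeriv ℝ φ y (e c) * K a b y)) = 0 := by
    filter_upwards [hlow, h.trace_eq, h.eq_on, h.left.eventually, h.right.eventually]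
      with y h1 h2 h3 h4 h5 h0 c
    have key : ∀ (G : X → Matrix ι ι ℝ), MetricAt G y →
        ∑ l, G y c l * contract (G y)⁻¹ (christoffel e G y l)
          = contract (G y)⁻¹ (fun a b => christoffelLow e G y a b c) := by
      intro G hG
      simp only [← hG.sum_mul_christoffel, contract, Finset.mul_sum]
      rw [← sum_rotate]
      exact Finset.sum_congr rfl fun a _ => Finset.sum_congr rfl fun b _ =>
        Finset.sum_congr rfl fun l _ => by ring
    have e1 := key g h4
    have e2 := key g' h5
    have h2' := h2 h0
    simp only [h3 h0] at h2' e2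
    simp only [h2'] at e2
    rw [e2] at e1
    simp only [h1 h0, contract_add] at e1
    have e3 : contract (g y)⁻¹ (fun a b => lineDeriv ℝ φ y (e b) * K a c y)
        = contract (g y)⁻¹ (fun a b => lineDeriv ℝ φ y (e a) * K b c y) :=
      contract_swap _ h4.symm_at.inv (fun a b => lineDeriv ℝ φ y (e a) * K b c y)
    simp only [jumpLow, contract_mul_left, contract_sub, contract_add] at e1 ⊢
    linarith
  have hnk : ∀ b, contract (g p)⁻¹ (fun c d => ψ c * k d b)
      = (1 / 2) * contract (g p)⁻¹ k * ψ b := fun b => by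
    have := hZ.self_of_nhds h.zero b
    simp only [contract_mul_left, contract_sub] at this
    change contract (g p)⁻¹ (fun c d => ψ c * k d b) - 1 / 2 * (ψ b * contract (g p)⁻¹ k)
        = 0 at this
    linarith
  have hG := hg.symm_at.inv
  have hcs : ∀ f : ι → ι → X → ℝ, (∀ a b, ContDiffAt ℝ 1 (f a b) p) →
      ContDiffAt ℝ 1 (fun y => contract (g y)⁻¹ (fun a b => f a b y)) p := fun f hf =>
    ContDiffAt.sum fun a _ => ContDiffAt.sum fun b _ =>
      ((hg.inv_smooth a b).of_le (by norm_num)).mul (hf a b)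
  -- The square of `dφ` vanishes on the hypersurface, so its gradient there is a multiple of `dφ`;
  -- that gradient is `2 n^c F_{cd}`.
  obtain ⟨μ, hμ⟩ : ∃ μ, ∀ a, contract (g p)⁻¹ (fun c d => ψ c * F d a) = μ * ψ a := by
    obtain ⟨c, hc⟩ := exists_lineDeriv_eq_mul (hcs _ fun a b => (hφs a).mul (hφs b))
      (h.smooth.of_le (by norm_num)) h.regular h.zero h.null
    refine ⟨(1 / 2) * c, fun d => ?_⟩
    have h1 := hc (e d)
    rw [hg.lineDeriv_contract e fun a b => (hφd a).fun_mul (hφd b)] at h1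
    have h2 : ∀ a b, lineDeriv ℝ (fun y => lineDeriv ℝ φ y (e a) * lineDeriv ℝ φ y (e b)) p (e d)
        - (∑ l, christoffel e g p l d a * (lineDeriv ℝ φ p (e l) * lineDeriv ℝ φ p (e b)))
        - ∑ l, christoffel e g p l d b * (lineDeriv ℝ φ p (e a) * lineDeriv ℝ φ p (e l))
        = ψ b * F a d + ψ a * F b d := by
      intro a b
      rw [lineDeriv_fun_mul _ (hφd a) (hφd b), hFsymm a d, hFsymm b d]
      simp only [hF, mul_sub, Finset.mul_sum]
      have e1 : ∑ l, christoffel e g p l d a * (lineDeriv ℝ φ p (e l) * lineDeriv ℝ φ p (e b))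
        = ∑ l, ψ b * (ψ l * christoffel e g p l d a) :=
        Finset.sum_congr rfl fun l _ => by simp only [hψ]; ring
      have e2 : ∑ l, christoffel e g p l d b * (lineDeriv ℝ φ p (e a) * lineDeriv ℝ φ p (e l))
        = ∑ l, ψ a * (ψ l * christoffel e g p l d b) :=
        Finset.sum_congr rfl fun l _ => by simp only [hψ]; ring
      rw [e1, e2]
      simp only [hψ]
      ring
    simp only [h2, contract_add] at h1
    rw [contract_swap _ hG (fun a b => ψ a * F b d)] at h1
    change _ = ψ d * c at h1
    linarith
  -- The same argument for the relation `hZ`. The Christoffel terms that do not fit into `F` and `D`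
  -- come from its free index `c` and cancel by `hnk`.
  have hy : ∀ a, ∃ y, ∀ b, contract (g p)⁻¹ (fun c d => ψ c * D d a b)
      = (1 / 2) * ψ a * contract (g p)⁻¹ (fun c d => D c d b)
        + (1 / 2) * F a b * contract (g p)⁻¹ k
        - contract (g p)⁻¹ (fun c d => F c b * k d a) + ψ b * y := by
    intro c
    have hfs : ∀ a b, ContDiffAt ℝ 1 (fun y => lineDeriv ℝ φ y (e a) * K b c y
        - (1 / 2) * (lineDeriv ℝ φ y (e c) * K a b y)) p := fun a b =>
      ((hφs a).mul (hKs b c)).sub (contDiffAt_const.mul ((hφs c).mul (hKs a b)))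
    obtain ⟨y, hy⟩ := exists_lineDeriv_eq_mul (hcs _ hfs) (h.smooth.of_le (by norm_num)) h.regular
      h.zero (by filter_upwards [hZ] with y hy h0; exact hy h0 c)
    refine ⟨y, fun d => ?_⟩
    have h1 := hy (e d)
    rw [hg.lineDeriv_contract e fun a b => (hfs a b).differentiableAt (by decide)] at h1
    have h2 : ∀ a b, lineDeriv ℝ (fun y => lineDeriv ℝ φ y (e a) * K b c y
          - (1 / 2) * (lineDeriv ℝ φ y (e c) * K a b y)) p (e d)
        - (∑ l, christoffel e g p l d a * (lineDeriv ℝ φ p (e l) * K b c p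
          - (1 / 2) * (lineDeriv ℝ φ p (e c) * K l b p)))
        - (∑ l, christoffel e g p l d b * (lineDeriv ℝ φ p (e a) * K l c p
          - (1 / 2) * (lineDeriv ℝ φ p (e c) * K a l p)))
        = F a d * k b c + ψ a * D b c d - (1 / 2) * F c d * k a b - (1 / 2) * ψ c * D a b d
          + (∑ l, christoffel e g p l d c * (ψ a * k b l))
          - (1 / 2) * (∑ l, ψ l * christoffel e g p l d c) * k a b := by
      intro a b
      rw [lineDeriv_fun_sub _ ((hφd a).fun_mul (hKd b c)) (((hφd c).fun_mul (hKd a b)).const_mul _),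
        lineDeriv_const_fun_mul, lineDeriv_fun_mul _ (hφd a) (hKd b c),
        lineDeriv_fun_mul _ (hφd c) (hKd a b), hFsymm a d, hFsymm c d]
      have e1 : ∑ l, christoffel e g p l d a * (lineDeriv ℝ φ p (e l) * K b c p
          - (1 / 2) * (lineDeriv ℝ φ p (e c) * K l b p))
          = (∑ l, ψ l * christoffel e g p l d a) * k b c
            - (1 / 2) * ψ c * ∑ l, k b l * christoffel e g p l d a := by
        rw [Finset.sum_mul, Finset.mul_sum, ← Finset.sum_sub_distrib]
        exact Finset.sum_congr rfl fun l _ => by simp only [hψ, hk, hKsymm l b]; ring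
      have e2 : ∑ l, christoffel e g p l d b * (lineDeriv ℝ φ p (e a) * K l c p
          - (1 / 2) * (lineDeriv ℝ φ p (e c) * K a l p))
          = ψ a * (∑ l, k c l * christoffel e g p l d b)
            - (1 / 2) * ψ c * ∑ l, k a l * christoffel e g p l d b := by
        rw [Finset.mul_sum, Finset.mul_sum, ← Finset.sum_sub_distrib]
        exact Finset.sum_congr rfl fun l _ => by simp only [hψ, hk, hKsymm l c]; ring
      have e3 : ∑ l, christoffel e g p l d c * (ψ a * k b l)
          = ψ a * ∑ l, k b l * christoffel e g p l d c := by
        rw [Finset.mul_sum]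
        exact Finset.sum_congr rfl fun l _ => by ring
      rw [e1, e2, e3]
      simp only [hF, hD, hψ, hk]
      ring
    have h3 : contract (g p)⁻¹ (fun a b => ∑ l, christoffel e g p l d c * (ψ a * k b l))
        = (1 / 2) * (∑ l, ψ l * christoffel e g p l d c) * contract (g p)⁻¹ k := by
      rw [contract_sum]
      simp only [hnk, Finset.mul_sum, Finset.sum_mul]
      exact Finset.sum_congr rfl fun l _ => by ring
    simp only [h2, contract_add, contract_sub, contract_mul_left, h3] at h1
    change _ = ψ d * y at h1
    linarith
  choose y hy using hy
  have hlowp : ∀ a b l, christoffelLow e g' p a b l = christoffelLow e g p a b l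
      + jumpLow ψ k a b l := hlow.self_of_nhds h.zero
  have hchr : ∀ l a b, christoffel e g' p l a b = christoffel e g p l a b
      + ∑ n, (g p)⁻¹ l n * jumpLow ψ k a b n := fun l a b => by
    simp only [christoffel_eq, hgg, hlowp, mul_add, Finset.sum_add_distrib]
  have hsum : ∀ a b c d, ∑ l, christoffelLow e g' p a b l * christoffel e g' p l c d
      = (∑ l, christoffelLow e g p a b l * christoffel e g p l c d)
        + (∑ l, jumpLow ψ k c d l * christoffel e g p l a b)
        + (∑ l, jumpLow ψ k a b l * christoffel e g p l c d)
        + contract (g p)⁻¹ (fun l n => jumpLow ψ k a b l * jumpLow ψ k c d n) := by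
    intro a b c d
    have e1 : ∑ l, christoffelLow e g p a b l * ∑ n, (g p)⁻¹ l n * jumpLow ψ k c d n
        = ∑ l, jumpLow ψ k c d l * christoffel e g p l a b := by
      simp only [christoffel_eq, Finset.mul_sum]
      rw [Finset.sum_comm]
      exact Finset.sum_congr rfl fun n _ => Finset.sum_congr rfl fun l _ => by
        rw [hg.inv_comm_at n l]; ring
    have e2 : ∑ l, jumpLow ψ k a b l * ∑ n, (g p)⁻¹ l n * jumpLow ψ k c d n
        = contract (g p)⁻¹ (fun l n => jumpLow ψ k a b l * jumpLow ψ k c d n) := by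
      simp only [contract, Finset.mul_sum]
      exact Finset.sum_congr rfl fun n _ => Finset.sum_congr rfl fun l _ => by ring
    simp only [hlowp, hchr, add_mul, mul_add, Finset.sum_add_distrib, e1, e2]
    ring
  -- The jumps of the second partial derivatives combine with the cross terms of `hsum`, linear in
  -- the jump, into covariant derivatives; what is left is quadratic.
  have hriem : ∀ i a d b, riemannLow e g' p i a d b - riemannLow e g p i a d b
      = jumpRiemann (g p)⁻¹ ψ F k D r i a d b := by
    intro i a d b
    rw [hg'.riemannLow_eq, hg.riemannLow_eq, hsum, hsum]
    simp only [hH, sum_jumpLow_mul, jumpRiemann, jumpHess, hF, hD,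
      hg.christoffel_comm e _ i d, hg.christoffel_comm e _ a b, hg.christoffel_comm e _ i b,
      hg.christoffel_comm e _ a d, hg.christoffel_comm e _ b d, hg.christoffel_comm e _ i a]
    simp only [hψ, hk]
    ring
  have hric : ∀ a b, ricci e g' p a b - ricci e g p a b = jumpRicci (g p)⁻¹ ψ F k D r a b := by
    intro a b
    simp only [hg.ricci_eq_low, hg'.ricci_eq_low, hgg, jumpRicci, contract, ← hriem, mul_sub,
      Finset.sum_sub_distrib]
  simp only [hric]
  exact jumpEinstein_eq_zero hG hFsymm hksymm hDsymm hr hnull hnk hμ hy a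

end MetricPair

end Jump

/-! ### Null normals and the gradient of a defining function. -/

section NullNormal

variable {m : ℕ}

theorem fderiv_eq_sum (φ : Pt m → ℝ) (p v : Pt m) :
    fderiv ℝ φ p v = ∑ i, v i * fderiv ℝ φ p (basis m i) := by
  conv_lhs => rw [pi_eq_sum_univ' v]
  simp [basis]

/-- A null normal is proportional to the gradient of a defining function. -/
theorem exists_eq_mul_gradient {g : Pt m → Comp m} {φ : Pt m → ℝ} {p l : Pt m}
    (hg : MetricAt g p) (hφ : DifferentiableAt ℝ φ p) (hφ0 : fderiv ℝ φ p ≠ 0) (hl : l ≠ 0)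
    (hn : ∀ v : Pt m, fderiv ℝ φ p v = 0 → ∑ i, ∑ j, g p i j * l i * v j = 0) :
    ∃ c, c ≠ 0 ∧ ∀ j, l j = c * ∑ b, (g p)⁻¹ j b * lineDeriv ℝ φ p (basis m b) := by
  have hψ : ∀ v, lineDeriv ℝ φ p v = fderiv ℝ φ p v := fun v => hφ.lineDeriv_eq_fderiv
  obtain ⟨n, hn0⟩ : ∃ n, fderiv ℝ φ p n ≠ 0 := by
    by_contra! h
    exact hφ0 (ContinuousLinearMap.ext h)
  let G : Pt m → ℝ := fun v => ∑ i, ∑ j, g p i j * l i * v j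
  -- Both `G` and the differential of `φ` are linear, and `G` vanishes on the kernel of the latter.
  have hG : ∀ v, G v = G n / fderiv ℝ φ p n * fderiv ℝ φ p v := by
    intro v
    have h1 := hn (v - (fderiv ℝ φ p v / fderiv ℝ φ p n) • n) (by
      simp only [map_sub, map_smul, smul_eq_mul]; field_simp; ring)
    simp only [Pi.sub_apply, Pi.smul_apply, smul_eq_mul, mul_sub, Finset.sum_sub_distrib] at h1
    have h2 : ∑ i, ∑ j, g p i j * l i * (fderiv ℝ φ p v / fderiv ℝ φ p n * n j)
        = fderiv ℝ φ p v / fderiv ℝ φ p n * G n := by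
      simp only [G, Finset.mul_sum]
      exact Finset.sum_congr rfl fun i _ => Finset.sum_congr rfl fun j _ => by ring
    rw [h2] at h1
    have h3 : G v = fderiv ℝ φ p v / fderiv ℝ φ p n * G n := by
      simp only [G] at h1 ⊢; linarith
    rw [h3]; ring
  have hlow : ∀ b, ∑ i, g p b i * l i
      = G n / fderiv ℝ φ p n * lineDeriv ℝ φ p (basis m b) := by
    intro b
    rw [hψ, ← hG]
    simp only [G, basis, Pi.single_apply, mul_ite, mul_one, mul_zero, Finset.sum_ite_eq',
      Finset.mem_univ, if_true, hg.comm_at b]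
  have hup : ∀ j, l j = G n / fderiv ℝ φ p n
      * ∑ b, (g p)⁻¹ j b * lineDeriv ℝ φ p (basis m b) := by
    intro j
    have h1 : ∑ b, (g p)⁻¹ j b * ∑ i, g p b i * l i = l j := by
      simp only [Finset.mul_sum, ← mul_assoc]
      rw [Finset.sum_comm]
      simp only [← Finset.sum_mul, hg.inv_mul_apply]
      simp
    rw [← h1]
    simp only [hlow, Finset.mul_sum]
    exact Finset.sum_congr rfl fun b _ => by ring
  refine ⟨_, fun h0 => hl (funext fun j => ?_), hup⟩
  rw [hup j, h0, zero_mul]; rfl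

/-- The data of a null hypersurface near one of its points: the conditions on a null normal hold
for one defining function, at all nearby points. -/
theorem IsNullHypersurface.exists_defining {g : Pt m → Comp m} {U M : Set (Pt m)}
    {l : Pt m → Pt m} (hl : IsNullHypersurface g M l) (hU : IsOpen U) (hMU : M ⊆ U)
    (hg : IsPseudoMetric U g) {p : Pt m} (hp : p ∈ M) :
    ∃ φ : Pt m → ℝ, ContDiffAt ℝ 2 φ p ∧ fderiv ℝ φ p ≠ 0 ∧ (∀ᶠ y in 𝓝 p, y ∈ M ↔ φ y = 0) ∧
      (∃ c, ∀ j, l p j = c * ∑ b, (g p)⁻¹ j b * lineDeriv ℝ φ p (basis m b)) ∧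
      ∀ᶠ y in 𝓝 p, φ y = 0 → contract (g y)⁻¹
        (fun a b => lineDeriv ℝ φ y (basis m a) * lineDeriv ℝ φ y (basis m b)) = 0 := by
  obtain ⟨hl0, V, φ, hV, hpV, hφ, hM, hφ0, htan, hn⟩ := hl p hp
  have hφs : ∀ y ∈ V, ContDiffAt ℝ 2 φ y := fun y hy => hφ.contDiffAt (hV.mem_nhds hy)
  refine ⟨φ, hφs p hpV, hφ0 p hpV, ?_, ?_, ?_⟩
  · filter_upwards [hV.mem_nhds hpV] with y hy using hM y hy
  · obtain ⟨c, -, hc⟩ := exists_eq_mul_gradient (hg.metricAt hU (hMU hp))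
      ((hφs p hpV).differentiableAt (by decide)) (hφ0 p hpV) hl0 hn
    exact ⟨c, hc⟩
  · filter_upwards [hV.mem_nhds hpV] with y hy h0
    have hyM : y ∈ M := (hM y hy).2 h0
    -- At a nearby point the normal is described by its own defining function `φ'`. The gradients of
    -- `φ` and `φ'` are proportional there, so the nullity of one passes to the other.
    obtain ⟨hl0', V', φ', hV', hyV', hφ', hM', hφ0', htan', hn'⟩ := hl y hyM
    have hφs' : ContDiffAt ℝ 2 φ' y := hφ'.contDiffAt (hV'.mem_nhds hyV')
    obtain ⟨k, hk⟩ := exists_lineDeriv_eq_mul ((hφs y hy).of_le (by norm_num))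
      (hφs'.of_le (by norm_num)) (hφ0' y hyV') ((hM' y hyV').1 hyM) (by
        filter_upwards [hV.mem_nhds hy, hV'.mem_nhds hyV'] with z hz hz' h
        exact (hM z hz).1 ((hM' z hz').2 h))
    obtain ⟨c, hc0, hc⟩ := exists_eq_mul_gradient (hg.metricAt hU (hMU hyM))
      (hφs'.differentiableAt (by decide)) (hφ0' y hyV') hl0' hn'
    have h1 : c * contract (g y)⁻¹
        (fun a b => lineDeriv ℝ φ' y (basis m a) * lineDeriv ℝ φ' y (basis m b)) = 0 := by
      rw [fderiv_eq_sum] at htan'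
      simp only [hc, ← (hφs'.differentiableAt (by decide)).lineDeriv_eq_fderiv] at htan'
      rw [← htan']
      simp only [contract, Finset.mul_sum, Finset.sum_mul]
      exact Finset.sum_congr rfl fun i _ => Finset.sum_congr rfl fun j _ => by ring
    have h2 := (mul_eq_zero.1 h1).resolve_left hc0
    have h3 : ∀ a b, lineDeriv ℝ φ y (basis m a) * lineDeriv ℝ φ y (basis m b)
        = k ^ 2 * (lineDeriv ℝ φ' y (basis m a) * lineDeriv ℝ φ' y (basis m b)) := fun a b => by
      rw [hk, hk]; ring
    simp only [h3, contract_mul_left, h2, mul_zero]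

/-- On a null hypersurface with null normal `l`, the covector `S_{αβ} l^β` is determined by the
metric and the contracted Christoffel symbols on the hypersurface. -/
theorem einstein_null_eq {g g' : Pt m → Comp m} {U U' M : Set (Pt m)} {l l' : Pt m → Pt m}
    (hU : IsOpen U) (hU' : IsOpen U') (hMU : M ⊆ U) (hMU' : M ⊆ U') (hg : IsPseudoMetric U g)
    (hg' : IsPseudoMetric U' g') (hl : IsNullHypersurface g M l)
    (hgg : ∀ y ∈ M, g' y = g y) (hll : ∀ y ∈ M, l' y = l y)
    (hV : ∀ y ∈ M, christoffelTrace g' y = christoffelTrace g y) {p : Pt m} (hp : p ∈ M)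
    (α : Fin (m + 2)) :
    ∑ β, einstein (basis m) g' p α β * l' p β = ∑ β, einstein (basis m) g p α β * l p β := by
  obtain ⟨φ, hφ, hφ0, hM, ⟨c, hc⟩, hnull⟩ := hl.exists_defining hU hMU hg hp
  have hM0 := hg.metricAt hU (hMU hp)
  have hpair : MetricPair (basis m) g g' φ p :=
    { left := hM0
      right := hg'.metricAt hU' (hMU' hp)
      smooth := hφ
      regular := hφ0
      zero := hM.self_of_nhds.1 hp
      eq_on := by filter_upwards [hM] with y hy h0 using hgg y (hy.2 h0)
      trace_eq := by
        filter_upwards [hM] with y hy h0 a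
        exact congrFun (hV y (hy.2 h0)) a
      null := hnull }
  have key := hpair.einstein_jump α
  rw [hll p hp]
  have h1 : ∑ β, g p α β * l p β = c * lineDeriv ℝ φ p (basis m α) := by
    simp only [hc, Finset.mul_sum]
    rw [Finset.sum_comm]
    have : ∀ b, ∑ a, g p α a * (c * ((g p)⁻¹ a b * lineDeriv ℝ φ p (basis m b)))
        = c * lineDeriv ℝ φ p (basis m b) * ∑ a, g p α a * (g p)⁻¹ a b := fun b => by
      rw [Finset.mul_sum]
      exact Finset.sum_congr rfl fun a _ => by ring
    simp only [this, hM0.mul_inv_apply]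
    simp
  have h2 : contract (g p)⁻¹ (fun b c => ricci (basis m) g' p b c - ricci (basis m) g p b c)
      = scalarCurv (basis m) g' p - scalarCurv (basis m) g p := by
    rw [contract_sub, scalarCurv, scalarCurv, hgg p hp]; rfl
  have h3 : ∑ β, (ricci (basis m) g' p α β - ricci (basis m) g p α β) * l p β
      = c * contract (g p)⁻¹ (fun c b => lineDeriv ℝ φ p (basis m c)
          * (ricci (basis m) g' p α b - ricci (basis m) g p α b)) := by
    rw [← contract_swap _ hM0.symm_at.inv]
    simp only [hc, contract, Finset.mul_sum]
    exact Finset.sum_congr rfl fun i _ => Finset.sum_congr rfl fun j _ => by ring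
  have h4 : ∑ β, einstein (basis m) g' p α β * l p β - ∑ β, einstein (basis m) g p α β * l p β
      = ∑ β, (ricci (basis m) g' p α β - ricci (basis m) g p α β) * l p β
        - (1 / 2) * (scalarCurv (basis m) g' p - scalarCurv (basis m) g p)
          * ∑ β, g p α β * l p β := by
    rw [Finset.mul_sum, ← Finset.sum_sub_distrib, ← Finset.sum_sub_distrib]
    exact Finset.sum_congr rfl fun β _ => by rw [einstein, einstein, hgg p hp]; ring
  rw [h2] at key
  rw [h1, h3] at h4
  linear_combination h4 + c * key

end NullNormal

/-! ### The constraint operators depend only on values on the slice. -/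

section Congruence

variable {m : ℕ} {U : Set (Pt m)} (hU : IsOpen U) {q q' : Pt m → Matrix (Fin m) (Fin m) ℝ}
  {n0 n0' : Pt m → ℝ} {nu nu' : Pt m → Fin m → ℝ} {g11 g11' : Pt m → ℝ}
  {W0 W0' W1 W1' : Pt m → ℝ} {WA WA' : Pt m → Fin m → ℝ}
  (hq : ∀ y ∈ slice U, q y = q' y) (hn0 : ∀ y ∈ slice U, n0 y = n0' y)
  (hnu : ∀ y ∈ slice U, nu y = nu' y) (hg11 : ∀ y ∈ slice U, g11 y = g11' y)
  (hW0 : ∀ y ∈ slice U, W0 y = W0' y) (hW1 : ∀ y ∈ slice U, W1 y = W1' y)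
  (hWA : ∀ y ∈ slice U, WA y = WA' y)
include hU

section Metric
include hq

theorem chi_congr : ∀ y ∈ slice U, chi q y = chi q' y := by
  intro y hy
  ext A B
  simp only [chi, hq y hy]
  congr 1
  exact Finset.sum_congr rfl fun C _ => by
    rw [d1_congr_slice hU (fun z hz => by rw [hq z hz]) hy]

theorem tau_congr : ∀ y ∈ slice U, tau q y = tau q' y := by
  intro y hy
  simp only [tau, chi_congr hU hq y hy]

theorem sigmaSq_congr : ∀ y ∈ slice U, sigmaSq q y = sigmaSq q' y := by
  intro y hy
  simp only [sigmaSq, sigma, chi_congr hU hq y hy, tau_congr hU hq y hy]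

theorem chrS_congr : ∀ y ∈ slice U, chrS q y = chrS q' y := by
  intro y hy
  have h : ∀ A B C, lineDeriv ℝ (fun z => q z A B) y (angBasis m C)
      = lineDeriv ℝ (fun z => q' z A B) y (angBasis m C) := fun A B C =>
    dA_congr_slice hU (fun z hz => by rw [hq z hz]) hy C
  ext A B C
  simp only [chrS, christoffel, hq y hy, h]

theorem chrTrace_congr : ∀ y ∈ slice U, chrTrace q y = chrTrace q' y := by
  intro y hy
  ext A
  simp only [chrTrace, chrS_congr hU hq y hy, hq y hy]

theorem divChi_congr : ∀ y ∈ slice U, divChi q y = divChi q' y := by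
  intro y hy
  ext A
  simp only [divChi, chrS_congr hU hq y hy, chi_congr hU hq y hy]
  exact Finset.sum_congr rfl fun B _ => by
    rw [dA_congr_slice hU (fun z hz => by rw [chi_congr hU hq z hz]) hy]

theorem scalarCurv_congr :
    ∀ y ∈ slice U, scalarCurv (angBasis m) q y = scalarCurv (angBasis m) q' y := by
  intro y hy
  have h0 : ∀ z ∈ slice U, ∀ A B C, christoffel (angBasis m) q z A B C
      = christoffel (angBasis m) q' z A B C := fun z hz A B C =>
    congrFun (congrFun (congrFun (chrS_congr hU hq z hz) A) B) C
  have h1 : ∀ A B C D, lineDeriv ℝ (fun z => christoffel (angBasis m) q z A B C) y (angBasis m D)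
      = lineDeriv ℝ (fun z => christoffel (angBasis m) q' z A B C) y (angBasis m D) :=
    fun A B C D => dA_congr_slice hU (fun z hz => h0 z hz A B C) hy D
  simp only [scalarCurv, ricci, h1, h0 y hy, hq y hy]

omit hU in
include hnu in
theorem nuUp_congr : ∀ y ∈ slice U, nuUp q nu y = nuUp q' nu' y := by
  intro y hy
  ext A
  simp only [nuUp, hq y hy, hnu y hy]

include hn0 hW0

theorem kappa_congr : ∀ y ∈ slice U, kappa q n0 W0 y = kappa q' n0' W0' y := by
  intro y hy
  simp only [kappa, tau_congr hU hq y hy, hn0 y hy, hW0 y hy, d1_congr_slice hU hn0 hy]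

theorem opC1_congr : ∀ y ∈ slice U, opC1 q n0 W0 y = opC1 q' n0' W0' y := by
  intro y hy
  simp only [opC1, tau_congr hU hq y hy, kappa_congr hU hq hn0 hW0 y hy, sigmaSq_congr hU hq y hy,
    d1_congr_slice hU (tau_congr hU hq) hy]

include hnu hWA

theorem xi_congr : ∀ y ∈ slice U, xi q n0 nu W0 WA y = xi q' n0' nu' W0' WA' y := by
  intro y hy
  ext A
  simp only [xi, lowerAng, chi_congr hU hq y hy, hn0 y hy, hW0 y hy, hnu y hy, hWA y hy,
    hq y hy, chrTrace_congr hU hq y hy]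
  rw [d1_congr_slice hU (fun z hz => by rw [hnu z hz]) hy]

theorem opCA_congr : ∀ y ∈ slice U, opCA q n0 nu W0 WA y = opCA q' n0' nu' W0' WA' y := by
  intro y hy
  have hxi := xi_congr hU hq hn0 hnu hW0 hWA
  ext A
  simp only [opCA, tau_congr hU hq y hy, hxi y hy, divChi_congr hU hq y hy]
  rw [d1_congr_slice hU (fun z hz => by rw [hxi z hz]) hy,
    dA_congr_slice hU (fun z hz => by
      rw [tau_congr hU hq z hz, hn0 z hz, hW0 z hz, d1_congr_slice hU hn0 hz]) hy]

theorem divXi_congr : ∀ y ∈ slice U, divXi q n0 nu W0 WA y = divXi q' n0' nu' W0' WA' y := by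
  intro y hy
  have hxi := xi_congr hU hq hn0 hnu hW0 hWA
  simp only [divXi, hq y hy, hxi y hy, chrS_congr hU hq y hy]
  refine Finset.sum_congr rfl fun A _ => Finset.sum_congr rfl fun B _ => ?_
  rw [dA_congr_slice hU (fun z hz => by rw [hxi z hz]) hy]

include hg11 hW1

theorem opC0_congr : ∀ y ∈ slice U,
    opC0 q n0 nu g11 W0 W1 WA y = opC0 q' n0' nu' g11' W0' W1' WA' y := by
  intro y hy
  have hxi := xi_congr hU hq hn0 hnu hW0 hWA
  have hd : ∀ z ∈ slice U, d1 g11 z = d1 g11' z := fun z hz => d1_congr_slice hU hg11 hz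
  simp only [opC0, xiSq, hq y hy, hxi y hy, hn0 y hy, hg11 y hy, hW1 y hy, hd y hy,
    nuUp_congr hq hnu y hy, kappa_congr hU hq hn0 hW0 y hy, tau_congr hU hq y hy,
    scalarCurv_congr hU hq y hy, divXi_congr hU hq hn0 hnu hW0 hWA y hy,
    opC1_congr hU hq hn0 hW0 y hy, opCA_congr hU hq hn0 hnu hW0 hWA y hy]
  rw [d1_congr_slice hU (fun z hz => by
      rw [hd z hz, kappa_congr hU hq hn0 hW0 z hz, tau_congr hU hq z hz, hg11 z hz, hW1 z hz]) hy]

end Metric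

/-- Only `∂₁` and `∂_A` occur, including in nested derivatives. This permits replacing fields by
their extension by zero off the hypersurface, and `W` by its explicit form on the slice. -/
theorem constraintC_congr {g g' : Pt m → Comp m} {W W' : Pt m → Pt m}
    (hg : ∀ y ∈ slice U, g y = g' y) (hW : ∀ y ∈ slice U, W y = W' y) :
    ∀ y ∈ slice U, constraintC g W y = constraintC g' W' y := by
  intro y hy
  have hq : ∀ z ∈ slice U, angMetric g z = angMetric g' z := fun z hz => by
    simp only [angMetric, hg z hz]
  have hn0 : ∀ z ∈ slice U, nuZero g z = nuZero g' z := fun z hz => by simp only [nuZero, hg z hz]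
  have hnu : ∀ z ∈ slice U, nuAng g z = nuAng g' z := fun z hz => by
    ext A; simp only [nuAng, hg z hz]
  have hg11 : ∀ z ∈ slice U, gUp g z = gUp g' z := fun z hz => by simp only [gUp, hg z hz]
  have hW0 : ∀ z ∈ slice U, W z 0 = W' z 0 := fun z hz => by rw [hW z hz]
  have hW1 : ∀ z ∈ slice U, W z 1 = W' z 1 := fun z hz => by rw [hW z hz]
  have hWA : ∀ z ∈ slice U, (fun A => W z (ang A)) = fun A => W' z (ang A) := fun z hz => by
    rw [hW z hz]
  rw [constraintC, constraintC, opC0_congr hU hq hn0 hnu hg11 hW0 hW1 hWA y hy,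
    opC1_congr hU hq hn0 hW0 y hy, opCA_congr hU hq hn0 hnu hW0 hWA y hy]

end Congruence

/-! ### Lowering indices and divergences on the sections. -/

section Divergence

variable {m : ℕ}

namespace MetricAt

variable {q : Pt m → Matrix (Fin m) (Fin m) ℝ} {x : Pt m} (hq : MetricAt q x)
include hq

theorem lowerAng_differentiableAt {V : Pt m → Fin m → ℝ}
    (hV : ∀ A, DifferentiableAt ℝ (fun y => V y A) x) (A : Fin m) :
    DifferentiableAt ℝ (fun y => lowerAng q V y A) x :=
  DifferentiableAt.fun_sum fun B _ => (hq.differentiableAt A B).fun_mul (hV B)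

theorem chrTrace_differentiableAt (A : Fin m) :
    DifferentiableAt ℝ (fun y => chrTrace q y A) x :=
  DifferentiableAt.fun_sum fun D _ => DifferentiableAt.fun_sum fun B _ =>
    DifferentiableAt.fun_sum fun C _ => ((hq.differentiableAt A D).fun_mul
      (hq.inv_differentiableAt B C)).fun_mul (hq.christoffel_differentiableAt (angBasis m) D B C)

theorem sum_inv_mul_lowerAng (c : Fin m → ℝ) (V : Pt m → Fin m → ℝ) :
    ∑ A, ∑ B, (q x)⁻¹ A B * c A * lowerAng q V x B = ∑ A, c A * V x A := by
  refine Finset.sum_congr rfl fun A _ => ?_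
  have h : ∀ D, ∑ B, (q x)⁻¹ A B * (c A * (q x B D * V x D))
      = if A = D then c A * V x D else 0 := fun D => by
    have h1 : ∀ B, (q x)⁻¹ A B * (c A * (q x B D * V x D))
      = (q x)⁻¹ A B * q x B D * (c A * V x D) := fun B => by ring
    simp only [h1, ← Finset.sum_mul, hq.inv_mul_apply, ite_mul, one_mul, zero_mul]
  simp only [lowerAng, Finset.mul_sum, mul_assoc]
  rw [Finset.sum_comm]
  simp only [h, Finset.sum_ite_eq, Finset.mem_univ, if_true]

/-- The divergence of a vector field on the sections, from its covariant components. -/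
theorem sum_inv_mul_cov_lowerAng {V : Pt m → Fin m → ℝ}
    (hV : ∀ A, DifferentiableAt ℝ (fun y => V y A) x) :
    ∑ A, ∑ B, (q x)⁻¹ A B * (dA A (fun y => lowerAng q V y B) x
      - ∑ C, chrS q x C A B * lowerAng q V x C) = divHA q V x := by
  have h1 : ∀ A B, dA A (fun y => lowerAng q V y B) x
      = ∑ D, ((christoffelLow (angBasis m) q x A B D + christoffelLow (angBasis m) q x A D B)
          * V x D + q x B D * dA A (fun y => V y D) x) := by
    intro A B
    simp only [lowerAng]
    rw [dA_fun_sum A fun D => (hq.differentiableAt B D).fun_mul (hV D)]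
    refine Finset.sum_congr rfl fun D _ => ?_
    rw [dA_fun_mul (hq.differentiableAt B D) (hV D), dA, hq.lineDeriv_eq_christoffelLow]
  have h2 : ∀ A B, ∑ C, chrS q x C A B * lowerAng q V x C
      = ∑ D, christoffelLow (angBasis m) q x A B D * V x D := by
    intro A B
    simp only [← hq.sum_mul_christoffel, lowerAng, Finset.mul_sum, Finset.sum_mul, chrS]
    rw [Finset.sum_comm]
    exact Finset.sum_congr rfl fun C _ => Finset.sum_congr rfl fun D _ => by
      rw [hq.comm_at C D]; ring
  have h3 : ∀ A B, dA A (fun y => lowerAng q V y B) x - ∑ C, chrS q x C A B * lowerAng q V x C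
      = ∑ D, (christoffelLow (angBasis m) q x A D B * V x D
          + q x B D * dA A (fun y => V y D) x) := by
    intro A B
    rw [h1, h2, ← Finset.sum_sub_distrib]
    exact Finset.sum_congr rfl fun D _ => by ring
  have h4 : ∀ A D, ∑ B, (q x)⁻¹ A B * (q x B D * dA A (fun y => V y D) x)
      = if A = D then dA A (fun y => V y D) x else 0 := fun A D => by
    simp only [← mul_assoc, ← Finset.sum_mul, hq.inv_mul_apply, ite_mul, one_mul, zero_mul]
  simp only [h3, Finset.mul_sum, mul_add, Finset.sum_add_distrib, divHA]
  rw [add_comm]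
  congr 1
  · refine Finset.sum_congr rfl fun A _ => ?_
    rw [Finset.sum_comm]
    simp only [h4, Finset.sum_ite_eq, Finset.mem_univ, if_true]
  · refine Finset.sum_congr rfl fun A _ => ?_
    rw [Finset.sum_comm]
    refine Finset.sum_congr rfl fun D _ => ?_
    rw [chrS, christoffel_eq, Finset.sum_mul]
    exact Finset.sum_congr rfl fun B _ => by ring


end MetricAt

end Divergence

/-! ### Regularity of the coefficients and the derivative of `g^{11}`. -/

section Splitting

variable {m : ℕ}

namespace AdaptedMetric

variable {U : Set (Pt m)} {g : Pt m → Comp m} (hg : AdaptedMetric U g) {x : Pt m}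
  (hx : x ∈ slice U)
include hg hx

theorem nuZero_differentiableAt : DifferentiableAt ℝ (nuZero g) x :=
  (hg.metricAt hx).differentiableAt 0 1

theorem nuZero_inv_differentiableAt : DifferentiableAt ℝ (fun y => (nuZero g y)⁻¹) x :=
  (hg.nuZero_differentiableAt hx).fun_inv (hg.nuZero_ne hx)

theorem nuAng_differentiableAt (A : Fin m) : DifferentiableAt ℝ (fun y => nuAng g y A) x :=
  (hg.metricAt hx).differentiableAt 0 (ang A)

theorem gUp_differentiableAt : DifferentiableAt ℝ (gUp g) x :=
  (hg.metricAt hx).inv_differentiableAt 1 1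

theorem d1_nuZero_differentiableAt : DifferentiableAt ℝ (d1 (nuZero g)) x :=
  ((hg.metricAt hx).lineDeriv_smooth 0 1 _).differentiableAt (by decide)

theorem d1_nuAng_differentiableAt (A : Fin m) :
    DifferentiableAt ℝ (fun y => d1 (fun z => nuAng g z A) y) x :=
  ((hg.metricAt hx).lineDeriv_smooth 0 (ang A) _).differentiableAt (by decide)

theorem d1_gUp_differentiableAt : DifferentiableAt ℝ (d1 (gUp g)) x :=
  (ContDiffAt.lineDeriv_right (n := 2) (k := 1) _ ((hg.metricAt hx).inv_smooth 1 1) (by norm_num)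
    (by decide)).differentiableAt (by decide)

theorem kappa_differentiableAt {W0 : Pt m → ℝ} (hW : DifferentiableAt ℝ W0 x) :
    DifferentiableAt ℝ (kappa (angMetric g) (nuZero g) W0) x :=
  ((hg.nuZero_inv_differentiableAt hx).fun_mul (hg.d1_nuZero_differentiableAt hx)).fun_sub
    ((((hg.nuZero_differentiableAt hx).fun_mul hW).fun_add
      (hg.angMetricAt hx).tau_differentiableAt).const_mul _)

theorem xi_differentiableAt {W0 : Pt m → ℝ} {WA : Pt m → Fin m → ℝ}
    (hW : DifferentiableAt ℝ W0 x) (hWA : ∀ A, DifferentiableAt ℝ (fun y => WA y A) x)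
    (A : Fin m) :
    DifferentiableAt ℝ (fun y => xi (angMetric g) (nuZero g) (nuAng g) W0 WA y A) x := by
  have hi := hg.nuZero_inv_differentiableAt hx
  have hn := hg.nuAng_differentiableAt hx
  have hq := hg.angMetricAt hx
  exact (((((hi.const_mul (-2)).fun_mul (hg.d1_nuAng_differentiableAt hx A)).fun_add
    ((hi.const_mul 4).fun_mul (DifferentiableAt.fun_sum fun B _ =>
      (hn B).fun_mul (hq.chi_differentiableAt A B)))).fun_add
    ((hi.fun_mul (hn A)).fun_mul ((hg.nuZero_differentiableAt hx).fun_mul hW))).fun_add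
    (hq.lowerAng_differentiableAt hWA A)).fun_sub (hq.chrTrace_differentiableAt A)

theorem sq_nuZero_mul_gUp : nuZero g x ^ 2 * gUp g x
    = (∑ A, nuUp (angMetric g) (nuAng g) x A * nuAng g x A) - g x 0 0 := by
  rw [hg.gUp_eq hx]
  field_simp [hg.nuZero_ne hx]

/-- Product rule for `g^{AB} ν_A ν_B`, with `∂₁ g^{AB} = -2 χ^{AB}`. -/
theorem d1_normSq_nuAng : d1 (fun y => ∑ A, nuUp (angMetric g) (nuAng g) y A * nuAng g y A) x
    = 2 * (∑ A, nuUp (angMetric g) (nuAng g) x A * d1 (fun y => nuAng g y A) x)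
      - 2 * ∑ A, nuUp (angMetric g) (nuAng g) x A
          * ∑ B, nuAng g x B * chi (angMetric g) x A B := by
  have hq := hg.angMetricAt hx
  have hn := hg.nuAng_differentiableAt hx
  set q := angMetric g
  set nu := nuAng g
  have hd : ∀ A B, DifferentiableAt ℝ (fun y => (q y)⁻¹ A B * nu y B) x := fun A B =>
    (hq.inv_differentiableAt A B).fun_mul (hn B)
  have hd' : ∀ A, DifferentiableAt ℝ (fun y => nuUp q nu y A) x := fun A =>
    DifferentiableAt.fun_sum fun B _ => hd A B
  have h1 : ∀ A, d1 (fun y => nuUp q nu y A) x = ∑ B, (q x)⁻¹ A B * d1 (fun y => nu y B) x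
      - 2 * ∑ B, nuUp q nu x B * chi q x B A := by
    intro A
    simp only [nuUp]
    rw [d1_fun_sum (hd A)]
    have h2 : ∀ B, d1 (fun y => (q y)⁻¹ A B) x = -2 * ∑ C, chi q x C A * (q x)⁻¹ C B := by
      intro B
      rw [d1, hq.lineDeriv_inv, Finset.sum_comm, Finset.mul_sum, ← Finset.sum_neg_distrib]
      refine Finset.sum_congr rfl fun C _ => ?_
      simp only [chi, Finset.mul_sum, Finset.sum_mul, ← Finset.sum_neg_distrib]
      refine Finset.sum_congr rfl fun D _ => ?_
      rw [d1, hq.lineDeriv_comm_at C D]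
      ring
    simp only [fun B => d1_fun_mul (hq.inv_differentiableAt A B) (hn B), h2,
      Finset.sum_add_distrib, Finset.mul_sum, Finset.sum_mul]
    rw [Finset.sum_comm, add_comm, sub_eq_add_neg, ← Finset.sum_neg_distrib]
    congr 1
    refine Finset.sum_congr rfl fun B _ => ?_
    rw [← Finset.sum_neg_distrib]
    exact Finset.sum_congr rfl fun C _ => by ring
  rw [d1_fun_sum fun A => (hd' A).fun_mul (hn A)]
  simp only [fun A => d1_fun_mul (hd' A) (hn A), h1, Finset.sum_add_distrib, sub_mul,
    Finset.sum_sub_distrib]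
  have h5 : ∑ A, (∑ B, (q x)⁻¹ A B * d1 (fun y => nu y B) x) * nu x A
      = ∑ A, nuUp q nu x A * d1 (fun y => nu y A) x := by
    simp only [nuUp, Finset.sum_mul]
    rw [Finset.sum_comm]
    exact Finset.sum_congr rfl fun B _ => Finset.sum_congr rfl fun A _ => by
      rw [hq.inv_comm_at A B]; ring
  have h6 : ∑ A, 2 * (∑ B, nuUp q nu x B * chi q x B A) * nu x A
      = 2 * ∑ A, nuUp q nu x A * ∑ B, nu x B * chi q x A B := by
    simp only [Finset.mul_sum, Finset.sum_mul]
    rw [Finset.sum_comm]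
    exact Finset.sum_congr rfl fun B _ => Finset.sum_congr rfl fun A _ => by ring
  rw [h5, h6]
  ring

/-- The relation between `g^{11}` and `g₀₀` holds along the slice and may be differentiated; it
trades the term `∂₁g₀₀` of `L₀` for `∂₁g^{11}`. -/
theorem d1_sq_nuZero_mul_gUp :
    2 * nuZero g x * d1 (nuZero g) x * gUp g x + nuZero g x ^ 2 * d1 (gUp g) x
      = 2 * (∑ A, nuUp (angMetric g) (nuAng g) x A * d1 (fun y => nuAng g y A) x)
        - 2 * (∑ A, nuUp (angMetric g) (nuAng g) x A
            * ∑ B, nuAng g x B * chi (angMetric g) x A B) - d1 (fun y => g y 0 0) x := by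
  have hn := hg.nuZero_differentiableAt hx
  have h : d1 (fun y => nuZero g y * nuZero g y * gUp g y) x
      = d1 (fun y => (∑ A, nuUp (angMetric g) (nuAng g) y A * nuAng g y A) - g y 0 0) x :=
    d1_congr_slice hg.isOpen (fun y hy => by rw [← hg.sq_nuZero_mul_gUp hy]; ring) hx
  have hd : ∀ A, DifferentiableAt ℝ (fun y => nuUp (angMetric g) (nuAng g) y A) x := fun A =>
    DifferentiableAt.fun_sum fun B _ =>
      ((hg.angMetricAt hx).inv_differentiableAt A B).fun_mul (hg.nuAng_differentiableAt hx B)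
  rw [d1_fun_mul (hn.fun_mul hn) (hg.gUp_differentiableAt hx), d1_fun_mul hn hn,
    d1_fun_sub (DifferentiableAt.fun_sum fun A _ => (hd A).fun_mul (hg.nuAng_differentiableAt hx A))
      ((hg.metricAt hx).differentiableAt 0 0), hg.d1_normSq_nuAng hx] at h
  linear_combination h

end AdaptedMetric

end Splitting

/-! ### The constraint operators evaluated at `W + H`. -/

section Splitting

variable {m : ℕ}

theorem kappa_add (q : Pt m → Matrix (Fin m) (Fin m) ℝ) (n0 W0 H0 : Pt m → ℝ) (x : Pt m) :
    kappa q n0 (fun y => W0 y + H0 y) x = kappa q n0 W0 x - (1 / 2) * (n0 x * H0 x) := by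
  simp only [kappa]
  ring

/-- `κ` is affine in `W⁰` and `C₁` is affine in `κ`; `L₁` is the resulting linear part. -/
theorem opC1_add (q : Pt m → Matrix (Fin m) (Fin m) ℝ) (n0 W0 H0 : Pt m → ℝ) (x : Pt m) :
    opC1 q n0 (fun y => W0 y + H0 y) x = opC1 q n0 W0 x + opL1 q n0 H0 x := by
  simp only [opC1, opL1, kappa_add]
  ring

theorem xi_add (q : Pt m → Matrix (Fin m) (Fin m) ℝ) {n0 : Pt m → ℝ} (nu : Pt m → Fin m → ℝ)
    (W0 H0 : Pt m → ℝ) (WA HA : Pt m → Fin m → ℝ) {x : Pt m} (h0 : n0 x ≠ 0) (A : Fin m) :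
    xi q n0 nu (fun y => W0 y + H0 y) (fun y B => WA y B + HA y B) x A
      = xi q n0 nu W0 WA x A + (lowerAng q HA x A + nu x A * H0 x) := by
  simp only [xi, lowerAng, mul_add, Finset.sum_add_distrib]
  field_simp
  ring

namespace AdaptedMetric

variable {U : Set (Pt m)} {g : Pt m → Comp m} (hg : AdaptedMetric U g) {x : Pt m}
  (hx : x ∈ slice U) {W0 W1 H0 H1 : Pt m → ℝ} {WA HA : Pt m → Fin m → ℝ}
  (hW0 : DifferentiableAt ℝ W0 x) (hWA : ∀ A, DifferentiableAt ℝ (fun y => WA y A) x)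
  (hH0 : DifferentiableAt ℝ H0 x) (hHA : ∀ A, DifferentiableAt ℝ (fun y => HA y A) x)
include hg hx hH0

theorem shift_differentiableAt (A : Fin m) : DifferentiableAt ℝ (fun y => nuAng g y A * H0 y) x :=
  (hg.nuAng_differentiableAt hx A).fun_mul hH0

theorem nuZero_mul_differentiableAt : DifferentiableAt ℝ (fun y => nuZero g y * H0 y) x :=
  (hg.nuZero_differentiableAt hx).fun_mul hH0

include hHA

theorem lowerAng_add_differentiableAt (A : Fin m) :
    DifferentiableAt ℝ (fun y => lowerAng (angMetric g) HA y A + nuAng g y A * H0 y) x :=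
  ((hg.angMetricAt hx).lowerAng_differentiableAt hHA A).fun_add
    (hg.shift_differentiableAt hx hH0 A)

include hW0

/-- `ξ_A` is affine in `W` with increment `H_A + ν_A H⁰`, and `C_A` is affine in `ξ_A` and `W₁`. -/
theorem opCA_add (hWA : ∀ A, DifferentiableAt ℝ (fun y => WA y A) x) (A : Fin m) :
    opCA (angMetric g) (nuZero g) (nuAng g) (fun y => W0 y + H0 y)
        (fun y B => WA y B + HA y B) x A
      = opCA (angMetric g) (nuZero g) (nuAng g) W0 WA x A
        + opLA (angMetric g) (nuZero g) (nuAng g) H0 HA x A := by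
  have h1 := d1_congr_slice hg.isOpen (fun y hy =>
    xi_add (angMetric g) (nuAng g) W0 H0 WA HA (hg.nuZero_ne hy) A) hx
  rw [d1_fun_add (hg.xi_differentiableAt hx hW0 hWA A)
    (hg.lowerAng_add_differentiableAt hx hH0 hHA A)] at h1
  have h2 : (fun y => tau (angMetric g) y - nuZero g y * (W0 y + H0 y)
      + 2 * (nuZero g y)⁻¹ * d1 (nuZero g) y)
      = fun y => (tau (angMetric g) y - nuZero g y * W0 y
        + 2 * (nuZero g y)⁻¹ * d1 (nuZero g) y) - nuZero g y * H0 y := by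
    ext y; ring
  have h3 : DifferentiableAt ℝ (fun y => tau (angMetric g) y - nuZero g y * W0 y
        + 2 * (nuZero g y)⁻¹ * d1 (nuZero g) y) x :=
    ((hg.angMetricAt hx).tau_differentiableAt.fun_sub
      (hg.nuZero_mul_differentiableAt hx hW0)).fun_add
      (((hg.nuZero_inv_differentiableAt hx).const_mul 2).fun_mul
        (hg.d1_nuZero_differentiableAt hx))
  rw [opCA, opCA, opLA, h1, h2, dA_fun_sub h3 (hg.nuZero_mul_differentiableAt hx hH0),
    xi_add _ _ _ _ _ _ (hg.nuZero_ne hx)]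
  ring

omit hW0

-- Besides the polarisation term, the increment `H_A + ν_A H⁰` contributes its own square. In it,
-- `|ν|²` multiplies `(H⁰)²`, to be completed to `g₀₀` in `C₀`.
omit hH0 hHA in
theorem xiSq_add : xiSq (angMetric g) (nuZero g) (nuAng g) (fun y => W0 y + H0 y)
        (fun y B => WA y B + HA y B) x
      = xiSq (angMetric g) (nuZero g) (nuAng g) W0 WA x
        + 2 * ((∑ A, xi (angMetric g) (nuZero g) (nuAng g) W0 WA x A * HA x A)
          + (∑ A, nuUp (angMetric g) (nuAng g) x A
              * xi (angMetric g) (nuZero g) (nuAng g) W0 WA x A) * H0 x)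
        + ((∑ A, ∑ B, angMetric g x A B * HA x A * HA x B)
          + 2 * (∑ A, nuAng g x A * H0 x * HA x A)
          + (∑ A, nuUp (angMetric g) (nuAng g) x A * nuAng g x A) * H0 x ^ 2) := by
  have hq := hg.angMetricAt hx
  simp only [xiSq, xi_add _ _ _ _ _ _ (hg.nuZero_ne hx)]
  set ξ := xi (angMetric g) (nuZero g) (nuAng g) W0 WA x
  set q := angMetric g
  set nu := nuAng g
  have hsym : ∀ c d : Fin m → ℝ, ∑ A, ∑ B, (q x)⁻¹ A B * c A * d B
      = ∑ A, ∑ B, (q x)⁻¹ A B * d A * c B := fun c d => by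
    rw [Finset.sum_comm]
    exact Finset.sum_congr rfl fun A _ => Finset.sum_congr rfl fun B _ => by
      rw [hq.inv_comm_at A B]; ring
  have hnu : ∀ c : Fin m → ℝ, ∑ A, ∑ B, (q x)⁻¹ A B * c A * (nu x B * H0 x)
      = (∑ A, nuUp q nu x A * c A) * H0 x := fun c => by
    simp only [nuUp, Finset.sum_mul]
    exact Finset.sum_congr rfl fun A _ => Finset.sum_congr rfl fun B _ => by ring
  have h1 := hq.sum_inv_mul_lowerAng ξ HA
  have h2 := hnu ξ
  have h3 := hq.sum_inv_mul_lowerAng (lowerAng q HA x) HA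
  have h4 := hq.sum_inv_mul_lowerAng (fun A => nu x A * H0 x) HA
  have h5 := hnu (fun A => nu x A * H0 x)
  have h6 := hsym ξ (lowerAng q HA x)
  have h7 := hsym ξ (fun A => nu x A * H0 x)
  have h8 := hsym (lowerAng q HA x) (fun A => nu x A * H0 x)
  have h9 : ∑ A, lowerAng q HA x A * HA x A = ∑ A, ∑ B, q x A B * HA x A * HA x B := by
    simp only [lowerAng, Finset.sum_mul]
    exact Finset.sum_congr rfl fun A _ => Finset.sum_congr rfl fun B _ => by ring
  have h10 : (∑ A, nuUp q nu x A * (nu x A * H0 x)) = (∑ A, nuUp q nu x A * nu x A) * H0 x := by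
    rw [Finset.sum_mul]
    exact Finset.sum_congr rfl fun A _ => by ring
  rw [h9] at h3
  rw [h10] at h5
  have key : ∀ A B, (q x)⁻¹ A B * (ξ A + (lowerAng q HA x A + nu x A * H0 x))
      * (ξ B + (lowerAng q HA x B + nu x B * H0 x))
    = (q x)⁻¹ A B * ξ A * ξ B + (q x)⁻¹ A B * ξ A * lowerAng q HA x B
      + (q x)⁻¹ A B * ξ A * (nu x B * H0 x)
      + (q x)⁻¹ A B * lowerAng q HA x A * ξ B
      + (q x)⁻¹ A B * (nu x A * H0 x) * ξ B
      + (q x)⁻¹ A B * lowerAng q HA x A * lowerAng q HA x B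
      + (q x)⁻¹ A B * lowerAng q HA x A * (nu x B * H0 x)
      + (q x)⁻¹ A B * (nu x A * H0 x) * lowerAng q HA x B
      + (q x)⁻¹ A B * (nu x A * H0 x) * (nu x B * H0 x) := fun A B => by ring
  simp only [key, Finset.sum_add_distrib]
  rw [← h6, ← h7, h8, h1, h2, h3, h4, h5]
  ring

include hW0 hWA

/-- The divergence of the increment `H_A + ν_A H⁰`: its first part is `∇̃_A H^A`, its second is
expanded by the product rule, with the trace of `Γ̃` appearing. -/
theorem divXi_add : divXi (angMetric g) (nuZero g) (nuAng g) (fun y => W0 y + H0 y)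
        (fun y B => WA y B + HA y B) x
      = divXi (angMetric g) (nuZero g) (nuAng g) W0 WA x + divHA (angMetric g) HA x
        + ((∑ A, ∑ B, (angMetric g x)⁻¹ A B * dA A (fun y => nuAng g y B) x)
          - ∑ A, nuUp (angMetric g) (nuAng g) x A * chrTrace (angMetric g) x A) * H0 x
        + ∑ A, nuUp (angMetric g) (nuAng g) x A * dA A H0 x := by
  have hq := hg.angMetricAt hx
  have h1 : ∀ A B, dA A (fun y => xi (angMetric g) (nuZero g) (nuAng g) (fun y => W0 y + H0 y)
        (fun y B => WA y B + HA y B) y B) x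
      = dA A (fun y => xi (angMetric g) (nuZero g) (nuAng g) W0 WA y B) x
        + (dA A (fun y => lowerAng (angMetric g) HA y B) x
          + (dA A (fun y => nuAng g y B) x * H0 x + nuAng g x B * dA A H0 x)) := by
    intro A B
    rw [dA_congr_slice hg.isOpen (fun y hy =>
        xi_add (angMetric g) (nuAng g) W0 H0 WA HA (hg.nuZero_ne hy) B) hx,
      dA_fun_add (hg.xi_differentiableAt hx hW0 hWA B)
        (hg.lowerAng_add_differentiableAt hx hH0 hHA B),
      dA_fun_add (hq.lowerAng_differentiableAt hHA B) (hg.shift_differentiableAt hx hH0 B),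
      dA_fun_mul (hg.nuAng_differentiableAt hx B) hH0]
  simp only [divXi, h1, xi_add _ _ _ _ _ _ (hg.nuZero_ne hx)]
  rw [← hq.sum_inv_mul_cov_lowerAng hHA]
  have h2 : ∑ A, nuUp (angMetric g) (nuAng g) x A * dA A H0 x
      = ∑ A, ∑ B, (angMetric g x)⁻¹ A B * (nuAng g x B * dA A H0 x) := by
    simp only [nuUp, Finset.sum_mul]
    exact Finset.sum_congr rfl fun A _ => Finset.sum_congr rfl fun B _ => by ring
  have h3 : ∑ A, nuUp (angMetric g) (nuAng g) x A * chrTrace (angMetric g) x A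
      = ∑ A, ∑ B, (angMetric g x)⁻¹ A B
        * ∑ C, chrS (angMetric g) x C A B * nuAng g x C := by
    have h4 : ∀ D, ∑ A, nuUp (angMetric g) (nuAng g) x A * angMetric g x A D = nuAng g x D := by
      intro D
      simp only [nuUp, Finset.sum_mul]
      rw [Finset.sum_comm]
      have h5 : ∀ B, ∑ A, (angMetric g x)⁻¹ A B * nuAng g x B * angMetric g x A D
          = nuAng g x B * (if B = D then 1 else 0) := fun B => by
        rw [← hq.inv_mul_apply, Finset.mul_sum]
        exact Finset.sum_congr rfl fun A _ => by rw [hq.inv_comm_at A B]; ring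
      simp [h5]
    have h5 : ∀ D, ∑ A, nuUp (angMetric g) (nuAng g) x A * (∑ B, ∑ C, angMetric g x A D
          * (angMetric g x)⁻¹ B C * chrS (angMetric g) x D B C)
        = ∑ B, ∑ C, (angMetric g x)⁻¹ B C * (chrS (angMetric g) x D B C * nuAng g x D) := by
      intro D
      simp only [← h4 D, Finset.mul_sum]
      rw [← sum_rotate]
      exact Finset.sum_congr rfl fun B _ => Finset.sum_congr rfl fun C _ =>
        Finset.sum_congr rfl fun A _ => by ring
    rw [Finset.sum_congr rfl fun A _ => by rw [chrTrace, Finset.mul_sum], Finset.sum_comm]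
    simp only [h5]
    rw [← sum_rotate]
    simp only [Finset.mul_sum]
  rw [h2, h3]
  simp only [sub_mul, Finset.sum_mul, ← Finset.sum_add_distrib, ← Finset.sum_sub_distrib]
  refine Finset.sum_congr rfl fun A _ => Finset.sum_congr rfl fun B _ => ?_
  have h6 : ∑ C, chrS (angMetric g) x C A B * (xi (angMetric g) (nuZero g) (nuAng g) W0 WA x C
        + (lowerAng (angMetric g) HA x C + nuAng g x C * H0 x))
      = ∑ C, chrS (angMetric g) x C A B * xi (angMetric g) (nuZero g) (nuAng g) W0 WA x C
        + ∑ C, chrS (angMetric g) x C A B * lowerAng (angMetric g) HA x C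
        + (∑ C, chrS (angMetric g) x C A B * nuAng g x C) * H0 x := by
    rw [Finset.sum_mul, ← Finset.sum_add_distrib, ← Finset.sum_add_distrib]
    exact Finset.sum_congr rfl fun C _ => by ring
  rw [h6]
  ring

/-- `C₀` is quadratic in `W`, through `ξ²` and the products of `κ` with `κ g^{11}` and `W¹`. Hence
`L₀` depends on `W` and is quadratic in `H`. -/
theorem opC0_add (hW1 : DifferentiableAt ℝ W1 x) (hH1 : DifferentiableAt ℝ H1 x) :
    opC0 (angMetric g) (nuZero g) (nuAng g) (gUp g) (fun y => W0 y + H0 y)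
        (fun y => W1 y + H1 y) (fun y B => WA y B + HA y B) x
      = opC0 (angMetric g) (nuZero g) (nuAng g) (gUp g) W0 W1 WA x
        + opL0 (angMetric g) (nuZero g) (nuAng g) (gUp g) (fun y => g y 0 0) W0 W1 WA
            H0 H1 HA x := by
  have hq := hg.angMetricAt hx
  have h0 := hg.nuZero_ne hx
  have hn := hg.nuZero_differentiableAt hx
  have hG := hg.gUp_differentiableAt hx
  have ht : DifferentiableAt ℝ (fun y => tau (angMetric g) y / 2) x := by
    simpa only [div_eq_mul_inv] using hq.tau_differentiableAt.mul_const _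
  have hB : DifferentiableAt ℝ (fun y => d1 (gUp g) y + (kappa (angMetric g) (nuZero g) W0 y
      + tau (angMetric g) y / 2) * gUp g y + W1 y) x :=
    ((hg.d1_gUp_differentiableAt hx).fun_add (((hg.kappa_differentiableAt hx hW0).fun_add
      ht).fun_mul hG)).fun_add hW1
  have h1 : d1 (fun y => d1 (gUp g) y + (kappa (angMetric g) (nuZero g) (fun y => W0 y + H0 y) y
      + tau (angMetric g) y / 2) * gUp g y + (W1 y + H1 y)) x
      = d1 (fun y => d1 (gUp g) y + (kappa (angMetric g) (nuZero g) W0 y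
        + tau (angMetric g) y / 2) * gUp g y + W1 y) x
        + (d1 H1 x - (1 / 2) * ((d1 (nuZero g) x * H0 x + nuZero g x * d1 H0 x) * gUp g x
          + nuZero g x * H0 x * d1 (gUp g) x)) := by
    have h2 : (fun y => d1 (gUp g) y + (kappa (angMetric g) (nuZero g) (fun y => W0 y + H0 y) y
        + tau (angMetric g) y / 2) * gUp g y + (W1 y + H1 y))
        = fun y => (d1 (gUp g) y + (kappa (angMetric g) (nuZero g) W0 y
          + tau (angMetric g) y / 2) * gUp g y + W1 y)
          + (H1 y - (1 / 2) * (nuZero g y * H0 y * gUp g y)) := by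
      ext y
      rw [kappa_add]
      ring
    have h3 := hn.fun_mul hH0
    rw [h2, d1_fun_add hB (hH1.fun_sub ((h3.fun_mul hG).const_mul _)),
      d1_fun_sub hH1 ((h3.fun_mul hG).const_mul _), d1_const_mul, d1_fun_mul h3 hG,
      d1_fun_mul hn hH0]
  have hCA : ∑ A, (-(nuZero g x)⁻¹ * nuUp (angMetric g) (nuAng g) x A)
        * (opCA (angMetric g) (nuZero g) (nuAng g) W0 WA x A
          + opLA (angMetric g) (nuZero g) (nuAng g) H0 HA x A)
      = ∑ A, (-(nuZero g x)⁻¹ * nuUp (angMetric g) (nuAng g) x A)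
        * opCA (angMetric g) (nuZero g) (nuAng g) W0 WA x A
        + ∑ A, (-(nuZero g x)⁻¹ * nuUp (angMetric g) (nuAng g) x A)
        * opLA (angMetric g) (nuZero g) (nuAng g) H0 HA x A := by
    simp only [mul_add, Finset.sum_add_distrib]
  -- `|ν|² - ν₀² g^{11} = g₀₀` is what turns the quadratic terms from `κ²`, `κ W¹` and `ξ²` into
  -- `g_{μν} H^μ H^ν`.
  have hsq := hg.sq_nuZero_mul_gUp hx
  have hsq' := hg.d1_sq_nuZero_mul_gUp hx
  have hxi : ∑ A, nuUp (angMetric g) (nuAng g) x A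
        * xi (angMetric g) (nuZero g) (nuAng g) W0 WA x A
      = -2 * (nuZero g x)⁻¹ * (∑ A, nuUp (angMetric g) (nuAng g) x A
            * d1 (fun y => nuAng g y A) x)
        + 4 * (nuZero g x)⁻¹ * (∑ A, nuUp (angMetric g) (nuAng g) x A
            * ∑ B, nuAng g x B * chi (angMetric g) x A B)
        + (∑ A, nuUp (angMetric g) (nuAng g) x A * nuAng g x A) * W0 x
        + (∑ A, nuAng g x A * WA x A)
        - ∑ A, nuUp (angMetric g) (nuAng g) x A * chrTrace (angMetric g) x A := by
    have h4 : ∑ A, nuAng g x A * WA x A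
        = ∑ A, nuUp (angMetric g) (nuAng g) x A * lowerAng (angMetric g) WA x A := by
      rw [← hq.sum_inv_mul_lowerAng, Finset.sum_comm]
      simp only [nuUp, Finset.sum_mul]
      exact Finset.sum_congr rfl fun A _ => Finset.sum_congr rfl fun B _ => by
        rw [hq.inv_comm_at A B]
    rw [h4]
    have h5 : ∀ A, nuUp (angMetric g) (nuAng g) x A
          * xi (angMetric g) (nuZero g) (nuAng g) W0 WA x A
        = -2 * (nuZero g x)⁻¹ * (nuUp (angMetric g) (nuAng g) x A
            * d1 (fun y => nuAng g y A) x)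
          + 4 * (nuZero g x)⁻¹ * (nuUp (angMetric g) (nuAng g) x A
            * ∑ B, nuAng g x B * chi (angMetric g) x A B)
          + nuUp (angMetric g) (nuAng g) x A * nuAng g x A * W0 x
          + nuUp (angMetric g) (nuAng g) x A * lowerAng (angMetric g) WA x A
          - nuUp (angMetric g) (nuAng g) x A * chrTrace (angMetric g) x A := fun A => by
      rw [xi]; field_simp
    simp only [h5, Finset.sum_add_distrib, Finset.sum_sub_distrib, ← Finset.mul_sum,
      ← Finset.sum_mul]
  rw [opC0, opC0, opL0, h1, hg.xiSq_add hx, hg.divXi_add hx hW0 hWA hH0 hHA, kappa_add,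
    opC1_add]
  simp only [hg.opCA_add hx hW0 hH0 hHA hWA]
  rw [hCA, hxi]
  have hk : kappa (angMetric g) (nuZero g) W0 x = (nuZero g x)⁻¹ * d1 (nuZero g) x
    - (1 / 2) * (nuZero g x * W0 x + tau (angMetric g) x) := rfl
  rw [hk]
  have hi : nuZero g x * (nuZero g x)⁻¹ = 1 := mul_inv_cancel₀ h0
  linear_combination (-(1 / 2) * nuZero g x) * ((W0 x * H0 x + (1 / 2) * H0 x ^ 2) * hsq
    - 2 * (nuZero g x)⁻¹ * H0 x * hsq'
    + (2 * d1 (nuZero g) x * gUp g x + 2 * nuZero g x * d1 (gUp g) x) * H0 x * hi)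

end AdaptedMetric

end Splitting

theorem forall_index {m : ℕ} {P : Fin (m + 2) → Prop} (h0 : P 0) (h1 : P 1)
    (hA : ∀ A, P (ang A)) : ∀ α, P α :=
  Fin.cases h0 (Fin.cases h1 hA)

/-! ### Components of the constraint covectors. -/

section Components

variable {m : ℕ} (g : Pt m → Comp m) (W H : Pt m → Pt m) (x : Pt m)

theorem constraintC_zero : constraintC g W x 0
    = opC0 (angMetric g) (nuZero g) (nuAng g) (gUp g) (fun y => W y 0) (fun y => W y 1)
      (fun y A => W y (ang A)) x := rfl

theorem constraintC_one : constraintC g W x 1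
    = opC1 (angMetric g) (nuZero g) (fun y => W y 0) x := rfl

theorem constraintC_ang (A : Fin m) : constraintC g W x (ang A)
    = opCA (angMetric g) (nuZero g) (nuAng g) (fun y => W y 0) (fun y A => W y (ang A)) x A := rfl

theorem constraintL_zero : constraintL g W H x 0
    = opL0 (angMetric g) (nuZero g) (nuAng g) (gUp g) (fun y => g y 0 0)
      (fun y => W y 0) (fun y => W y 1) (fun y A => W y (ang A))
      (fun y => H y 0) (fun y => H y 1) (fun y A => H y (ang A)) x := rfl

theorem constraintL_one : constraintL g W H x 1
    = opL1 (angMetric g) (nuZero g) (fun y => H y 0) x := rfl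

theorem constraintL_ang (A : Fin m) : constraintL g W H x (ang A)
    = opLA (angMetric g) (nuZero g) (nuAng g) (fun y => H y 0) (fun y A => H y (ang A)) x A := rfl

end Components

/-! ### The wave-gauge vector and the reduced Einstein tensor. -/

section Gauge

variable {X ι : Type*} [NormedAddCommGroup X] [NormedSpace ℝ X] [Fintype ι] [DecidableEq ι]
  {g gh : X → Matrix ι ι ℝ} {x : X}

theorem MetricAt.gaugeW_differentiableAt (hg : MetricAt g x) (hgh : MetricAt gh x) (e : ι → X)
    (l : ι) : DifferentiableAt ℝ (fun y => gaugeW e g gh y l) x :=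
  DifferentiableAt.fun_sum fun a _ => DifferentiableAt.fun_sum fun b _ =>
    (hg.inv_differentiableAt a b).fun_mul (hgh.christoffel_differentiableAt e l a b)

theorem MetricAt.gaugeH_differentiableAt (hg : MetricAt g x) (hgh : MetricAt gh x) (e : ι → X)
    (l : ι) : DifferentiableAt ℝ (fun y => gaugeH e g gh y l) x :=
  (hg.gaugeW_differentiableAt hg e l).fun_sub (hg.gaugeW_differentiableAt hgh e l)

/-- Each half of the symmetrised term `g_{aλ} D̂_b H^λ` has trace `D̂_λ H^λ`, so reversing the trace
leaves one divergence. -/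
theorem MetricAt.reducedEinstein_eq (hg : MetricAt g x) (gh : X → Matrix ι ι ℝ) (e : ι → X)
    (a b : ι) : reducedEinstein e g gh x a b = einstein e g x a b
      - (1 / 2) * ((∑ k, g x a k * gaugeDH e g gh x b k) + (∑ k, g x b k * gaugeDH e g gh x a k)
        - g x a b * ∑ k, gaugeDH e g gh x k k) := by
  have h1 : ∑ k, ∑ l, (g x)⁻¹ k l * ∑ j, g x k j * gaugeDH e g gh x l j
      = ∑ k, gaugeDH e g gh x k k := by
    rw [Finset.sum_comm]
    refine Finset.sum_congr rfl fun l _ => ?_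
    have h2 : ∀ j, ∑ k, (g x)⁻¹ k l * (g x k j * gaugeDH e g gh x l j)
        = if l = j then gaugeDH e g gh x l j else 0 := fun j => by
      simp only [← mul_assoc, ← Finset.sum_mul, hg.inv_comm_at _ l, hg.inv_mul_apply, ite_mul,
        one_mul, zero_mul]
    simp only [Finset.mul_sum]
    rw [Finset.sum_comm]
    simp only [h2, Finset.sum_ite_eq, Finset.mem_univ, if_true]
  have h3 : ∑ k, ∑ l, (g x)⁻¹ k l * ∑ j, g x l j * gaugeDH e g gh x k j
      = ∑ k, gaugeDH e g gh x k k := by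
    rw [← h1, Finset.sum_comm]
    exact Finset.sum_congr rfl fun k _ => Finset.sum_congr rfl fun l _ => by
      rw [hg.inv_comm_at l k]
  have h4 : ∑ k, ∑ l, (g x)⁻¹ k l * reducedRicci e g gh x k l
      = scalarCurv e g x - ∑ k, gaugeDH e g gh x k k := by
    have h5 : ∀ k l, (g x)⁻¹ k l * reducedRicci e g gh x k l = (g x)⁻¹ k l * ricci e g x k l
        - (1 / 2) * ((g x)⁻¹ k l * ∑ j, g x k j * gaugeDH e g gh x l j)
        - (1 / 2) * ((g x)⁻¹ k l * ∑ j, g x l j * gaugeDH e g gh x k j) := fun k l => by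
      rw [reducedRicci, Finset.sum_add_distrib]; ring
    simp only [h5, Finset.sum_sub_distrib, ← Finset.mul_sum, h1, h3, scalarCurv]
    ring
  rw [reducedEinstein, h4, reducedRicci, einstein, Finset.sum_add_distrib]
  ring

end Gauge

/-! ### The splitting in adapted coordinates and the equations for the wave-gauge vector. -/

section Hierarchy

variable {m : ℕ} {U : Set (Pt m)} {g gh : Pt m → Comp m} {x : Pt m}

theorem christoffelTrace_eq_add (g gh : Pt m → Comp m) :
    christoffelTrace g = fun y => gaugeW (basis m) g gh y + gaugeH (basis m) g gh y := by
  ext y l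
  simp [gaugeH, christoffelTrace]

namespace AdaptedMetric

variable (hg : AdaptedMetric U g) (hx : x ∈ slice U)
include hg hx

theorem constraintC_add {W H : Pt m → Pt m} (hW : ∀ l, DifferentiableAt ℝ (fun y => W y l) x)
    (hH : ∀ l, DifferentiableAt ℝ (fun y => H y l) x) :
    constraintC g (fun y => W y + H y) x = constraintC g W x + constraintL g W H x := by
  funext α
  revert α
  refine forall_index ?_ ?_ fun A => ?_
  · exact hg.opC0_add hx (hW 0) (fun A => hW _) (hH 0) (fun A => hH _) (hW 1) (hH 1)
  · exact opC1_add _ _ _ _ x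
  · exact hg.opCA_add hx (hW 0) (hH 0) (fun A => hH _) (fun A => hW _) A

theorem einstein_eq (hm : 1 ≤ m) (α : Fin (m + 2)) :
    einstein (basis m) g x α 1 = constraintC g (christoffelTrace g) x α := by
  revert α
  exact forall_index (hg.einstein01 hx hm) (hg.einstein11 hx hm) fun A => hg.einsteinA1 hx A

theorem einstein_splitting (hm : 1 ≤ m) (hgh : IsPseudoMetric U gh) (α : Fin (m + 2)) :
    einstein (basis m) g x α 1 = constraintC g (gaugeW (basis m) g gh) x α
      + constraintL g (gaugeW (basis m) g gh) (gaugeH (basis m) g gh) x α := by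
  have hM := hg.metricAt hx
  have hMh := hgh.metricAt hg.isOpen hx.1
  rw [hg.einstein_eq hx hm, christoffelTrace_eq_add g gh,
    hg.constraintC_add hx (fun l => hM.gaugeW_differentiableAt hMh _ l)
      fun l => hM.gaugeH_differentiableAt hMh _ l, Pi.add_apply]

theorem reducedEinstein_splitting (hm : 1 ≤ m) (hgh : IsPseudoMetric U gh) (α : Fin (m + 2)) :
    reducedEinstein (basis m) g gh x α 1 - constraintC g (gaugeW (basis m) g gh) x α
      = constraintL g (gaugeW (basis m) g gh) (gaugeH (basis m) g gh) x α
        - (1 / 2) * ((∑ k, g x α k * gaugeDH (basis m) g gh x 1 k)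
          + (∑ k, g x 1 k * gaugeDH (basis m) g gh x α k)
          - g x α 1 * ∑ k, gaugeDH (basis m) g gh x k k) := by
  rw [(hg.metricAt hx).reducedEinstein_eq, hg.einstein_splitting hx hm hgh]
  ring

theorem sum_g1 (V : Pt m) : ∑ k, g x 1 k * V k = nuZero g x * V 0 := by
  rw [sum_univ_ang, hg.g11 hx, (hg.metricAt hx).comm_at]
  simp [hg.g1A hx, nuZero]

theorem sum_gA (A : Fin m) (V : Pt m) : ∑ k, g x (ang A) k * V k
    = nuAng g x A * V 0 + ∑ B, angMetric g x A B * V (ang B) := by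
  rw [sum_univ_ang, hg.gA1 hx, (hg.metricAt hx).comm_at]
  simp [nuAng, angMetric]

/-- `∂₁q = 2 χ q`, so taking the angular metric inside the derivative costs the `χ` term. -/
theorem sum_mul_d1 {V : Pt m → Fin m → ℝ} (hV : ∀ A, DifferentiableAt ℝ (fun y => V y A) x)
    (A : Fin m) : ∑ B, angMetric g x A B * d1 (fun y => V y B) x
      = d1 (fun y => lowerAng (angMetric g) V y A) x
        - 2 * ∑ B, chi (angMetric g) x A B * lowerAng (angMetric g) V x B := by
  have hq := hg.angMetricAt hx
  have h1 : ∀ D, d1 (fun y => angMetric g y A D) x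
      = 2 * ∑ B, chi (angMetric g) x A B * angMetric g x B D := by
    intro D
    have h2 : ∀ E, ∑ B, (angMetric g x)⁻¹ B E * d1 (fun y => angMetric g y A E) x
          * angMetric g x B D = if E = D then d1 (fun y => angMetric g y A E) x else 0 := by
      intro E
      have h3 : ∀ B, (angMetric g x)⁻¹ B E * d1 (fun y => angMetric g y A E) x
          * angMetric g x B D = (angMetric g x)⁻¹ E B * angMetric g x B D
            * d1 (fun y => angMetric g y A E) x := fun B => by rw [hq.inv_comm_at B E]; ring
      simp only [h3, ← Finset.sum_mul, hq.inv_mul_apply, ite_mul, one_mul, zero_mul]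
    simp only [chi, mul_assoc, ← Finset.mul_sum]
    simp only [Finset.sum_mul]
    rw [Finset.sum_comm]
    simp only [h2, Finset.sum_ite_eq', Finset.mem_univ, if_true]
    ring
  simp only [lowerAng]
  rw [d1_fun_sum fun B => (hq.differentiableAt A B).fun_mul (hV B)]
  simp only [fun B => d1_fun_mul (hq.differentiableAt A B) (hV B), Finset.sum_add_distrib, h1,
    Finset.mul_sum, Finset.sum_mul]
  rw [Finset.sum_comm]
  simp only [mul_assoc]
  ring

variable (hh : AdaptedMetric U gh)
include hh

-- For an adapted target `Γ̂⁰₁₁` and `Γ̂⁰_{1A}` vanish, so `D̂₁H⁰` involves only `H⁰`; thus the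
-- first equation of the hierarchy closes.
omit hg in
theorem gaugeDH_one_zero : gaugeDH (basis m) g gh x 1 0
    = d1 (fun y => gaugeH (basis m) g gh y 0) x
      + christoffel (basis m) gh x 0 0 1 * gaugeH (basis m) g gh x 0 := by
  rw [gaugeDH, sum_univ_ang, hh.chr011 hx, (hh.metricAt hx).christoffel_comm]
  simp [hh.chr01A hx, d1]

theorem reducedEinstein11 (hm : 1 ≤ m) :
    reducedEinstein (basis m) g gh x 1 1 - constraintC g (gaugeW (basis m) g gh) x 1
      = -nuZero g x * (d1 (fun y => gaugeH (basis m) g gh y 0) x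
        + ((1 / 2) * tau (angMetric g) x + christoffel (basis m) gh x 0 0 1)
          * gaugeH (basis m) g gh x 0) := by
  rw [hg.reducedEinstein_splitting hx hm hh.metric, hg.sum_g1 hx, hg.g11 hx,
    hh.gaugeDH_one_zero hx]
  rw [constraintL_one, opL1]
  ring

/-- The term `½ ν₀ ∂_A H⁰` in `L_A` cancels the one in `½ ν₀ D̂_A H⁰`, so only derivatives along the
generators remain. -/
theorem reducedEinsteinA1 (hm : 1 ≤ m) (A : Fin m) :
    reducedEinstein (basis m) g gh x (ang A) 1 - constraintC g (gaugeW (basis m) g gh) x (ang A)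
      = -d1 (fun y => lowerAng (angMetric g)
            (fun z B => gaugeH (basis m) g gh z (ang B)) y A) x
        - (1 / 2) * tau (angMetric g) x * lowerAng (angMetric g)
            (fun z B => gaugeH (basis m) g gh z (ang B)) x A
        + (∑ B, chi (angMetric g) x A B * lowerAng (angMetric g)
            (fun z D => gaugeH (basis m) g gh z (ang D)) x B)
        - (1 / 2) * nuZero g x * (∑ B, christoffel (basis m) gh x 0 (ang A) (ang B)
            * gaugeH (basis m) g gh x (ang B))
        - (1 / 2) * (∑ B, ∑ D, angMetric g x A B
            * christoffel (basis m) gh x (ang B) 1 (ang D)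
            * gaugeH (basis m) g gh x (ang D))
        - nuAng g x A * d1 (fun y => gaugeH (basis m) g gh y 0) x
        + (1 / 2) * (dA A (nuZero g) x - d1 (fun y => nuAng g y A) x
            - tau (angMetric g) x * nuAng g x A
            - nuZero g x * christoffel (basis m) gh x 0 0 (ang A)
            - nuAng g x A * christoffel (basis m) gh x 0 0 1
            - ∑ B, angMetric g x A B * christoffel (basis m) gh x (ang B) 0 1)
          * gaugeH (basis m) g gh x 0 := by
  have hM := hg.metricAt hx
  have hMh := hh.metricAt hx
  have hH := fun l => hM.gaugeH_differentiableAt hMh (basis m) l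
  have h1 : ∀ B, gaugeDH (basis m) g gh x 1 (ang B)
      = d1 (fun y => gaugeH (basis m) g gh y (ang B)) x
        + christoffel (basis m) gh x (ang B) 0 1 * gaugeH (basis m) g gh x 0
        + ∑ D, christoffel (basis m) gh x (ang B) 1 (ang D) * gaugeH (basis m) g gh x (ang D) := by
    intro B
    rw [gaugeDH, sum_univ_ang, hh.chrA11 hx, hMh.christoffel_comm, d1]
    ring
  have h2 : gaugeDH (basis m) g gh x (ang A) 0 = dA A (fun y => gaugeH (basis m) g gh y 0) x
      + christoffel (basis m) gh x 0 0 (ang A) * gaugeH (basis m) g gh x 0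
      + ∑ B, christoffel (basis m) gh x 0 (ang A) (ang B) * gaugeH (basis m) g gh x (ang B) := by
    rw [gaugeDH, sum_univ_ang, hh.chr0A1 hx, hMh.christoffel_comm, dA, angBasis]
    ring
  have h3 := hg.sum_mul_d1 hx (V := fun z B => gaugeH (basis m) g gh z (ang B))
    (fun B => hH _) A
  have h4 : ∑ B, angMetric g x A B * gaugeDH (basis m) g gh x 1 (ang B)
      = (∑ B, angMetric g x A B * d1 (fun y => gaugeH (basis m) g gh y (ang B)) x)
        + (∑ B, angMetric g x A B * christoffel (basis m) gh x (ang B) 0 1)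
          * gaugeH (basis m) g gh x 0
        + ∑ B, ∑ D, angMetric g x A B * christoffel (basis m) gh x (ang B) 1 (ang D)
            * gaugeH (basis m) g gh x (ang D) := by
    simp only [h1, mul_add, Finset.sum_add_distrib, Finset.mul_sum, Finset.sum_mul, mul_assoc]
  rw [hg.reducedEinstein_splitting hx hm hh.metric, hg.sum_g1 hx, hg.sum_gA hx, hg.gA1 hx,
    hh.gaugeDH_one_zero hx, h2, h4, h3]
  rw [constraintL_ang, opLA, d1_fun_add (
      (hg.angMetricAt hx).lowerAng_differentiableAt (fun B => hH _) A)
    (hg.shift_differentiableAt hx (hH 0) A), d1_fun_mul (hg.nuAng_differentiableAt hx A) (hH 0),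
    dA_fun_mul (hg.nuZero_differentiableAt hx) (hH 0)]
  ring

theorem reducedEinstein01 (hm : 1 ≤ m)
    (h0 : ∀ y ∈ slice U, gaugeH (basis m) g gh y 0 = 0
      ∧ ∀ A : Fin m, gaugeH (basis m) g gh y (ang A) = 0) :
    reducedEinstein (basis m) g gh x 0 1 - constraintC g (gaugeW (basis m) g gh) x 0
      = -d1 (fun y => nuZero g y * gaugeH (basis m) g gh y 1) x
        + (1 / 2) * (nuZero g x * gaugeW (basis m) g gh x 0 - tau (angMetric g) x
            + ∑ A, christoffel (basis m) gh x (ang A) (ang A) 1)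
          * (nuZero g x * gaugeH (basis m) g gh x 1) := by
  have hU := hg.isOpen
  have hM := hg.metricAt hx
  have hMh := hh.metricAt hx
  have hH := fun l => hM.gaugeH_differentiableAt hMh (basis m) l
  have hn := hg.nuZero_ne hx
  have h00 := (h0 x hx).1
  have h0A := (h0 x hx).2
  -- Since `H⁰` and `H^A` vanish on the whole slice, so do their tangential derivatives.
  have e0 : d1 (fun y => gaugeH (basis m) g gh y 0) x = 0 :=
    d1_eq_zero_slice hU (fun y hy => (h0 y hy).1) hx
  have e1 : ∀ A, d1 (fun y => gaugeH (basis m) g gh y (ang A)) x = 0 := fun A =>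
    d1_eq_zero_slice hU (fun y hy => (h0 y hy).2 A) hx
  have e2 : ∀ A, dA A (fun y => gaugeH (basis m) g gh y 0) x = 0 := fun A =>
    dA_eq_zero_slice hU (fun y hy => (h0 y hy).1) hx A
  have e3 : ∀ A B, dA B (fun y => gaugeH (basis m) g gh y (ang A)) x = 0 := fun A B =>
    dA_eq_zero_slice hU (fun y hy => (h0 y hy).2 A) hx B
  have hLA : ∀ A, opLA (angMetric g) (nuZero g) (nuAng g) (fun y => gaugeH (basis m) g gh y 0)
      (fun y A => gaugeH (basis m) g gh y (ang A)) x A = 0 := by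
    intro A
    have e4 : d1 (fun y => lowerAng (angMetric g) (fun y A => gaugeH (basis m) g gh y (ang A)) y A
        + nuAng g y A * gaugeH (basis m) g gh y 0) x = 0 :=
      d1_eq_zero_slice hU (fun y hy => by simp [lowerAng, h0 y hy]) hx
    have e5 : dA A (fun y => nuZero g y * gaugeH (basis m) g gh y 0) x = 0 :=
      dA_eq_zero_slice hU (fun y hy => by simp [h0 y hy]) hx A
    rw [opLA, e4, e5]
    simp [lowerAng, h00, h0A]
  have hL : constraintL g (gaugeW (basis m) g gh) (gaugeH (basis m) g gh) x 0
      = (1 / 2) * nuZero g x * (-2 * d1 (fun y => gaugeH (basis m) g gh y 1) x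
        - (tau (angMetric g) x + 2 * (nuZero g x)⁻¹ * d1 (nuZero g) x
          - nuZero g x * gaugeW (basis m) g gh x 0) * gaugeH (basis m) g gh x 1) := by
    rw [constraintL_zero, opL0]
    simp only [hLA, opL1, divHA, h00, h0A, e0, e2, e3]
    simp
  have t0 : gaugeDH (basis m) g gh x 1 0 = 0 := by
    rw [hh.gaugeDH_one_zero hx, e0, h00]; ring
  have t1 : gaugeDH (basis m) g gh x 1 1 = d1 (fun y => gaugeH (basis m) g gh y 1) x
      + christoffel (basis m) gh x 1 1 1 * gaugeH (basis m) g gh x 1 := by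
    rw [gaugeDH, sum_univ_ang, h00]
    simp [h0A, d1]
  have t2 : ∀ A, gaugeDH (basis m) g gh x 1 (ang A) = 0 := by
    intro A
    have := e1 A
    rw [d1] at this
    rw [gaugeDH, sum_univ_ang, h00, hh.chrA11 hx, this]
    simp [h0A]
  have t3 : ∀ A, gaugeDH (basis m) g gh x (ang A) (ang A)
      = christoffel (basis m) gh x (ang A) (ang A) 1 * gaugeH (basis m) g gh x 1 := by
    intro A
    have := e3 A A
    rw [dA, angBasis] at this
    rw [gaugeDH, sum_univ_ang, h00, this]
    simp [h0A]
  have s1 : ∑ k, g x 0 k * gaugeDH (basis m) g gh x 1 k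
      = nuZero g x * gaugeDH (basis m) g gh x 1 1 := by
    rw [sum_univ_ang, t0]
    simp [t2, nuZero]
  -- `D̂₀H⁰`, the only entry with a transversal derivative, is left unevaluated: it cancels against
  -- `g_{1λ} D̂₀H^λ = ν₀ D̂₀H⁰`.
  have s2 : ∑ k, gaugeDH (basis m) g gh x k k = gaugeDH (basis m) g gh x 0 0
      + gaugeDH (basis m) g gh x 1 1
      + (∑ A, christoffel (basis m) gh x (ang A) (ang A) 1) * gaugeH (basis m) g gh x 1 := by
    rw [sum_univ_ang, Finset.sum_mul]
    simp only [t3]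
  rw [hg.reducedEinstein_splitting hx hm hh.metric, s1, hg.sum_g1 hx, s2, hL, t1,
    d1_fun_mul (hg.nuZero_differentiableAt hx) (hH 1)]
  rw [show g x 0 1 = nuZero g x from rfl]
  linear_combination (-gaugeH (basis m) g gh x 1 * d1 (nuZero g) x) * mul_inv_cancel₀ hn

end AdaptedMetric

end Hierarchy

/-! ### The constraints as ordinary differential operators for an adapted target. -/

section Hierarchy

variable {m : ℕ} {U : Set (Pt m)} {g gh : Pt m → Comp m} {x : Pt m}

namespace AdaptedMetric

variable (hg : AdaptedMetric U g) (hh : AdaptedMetric U gh) (hx : x ∈ slice U)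
include hg hh hx

/-- The vanishing of `Γ̂⁰₁₁` and `Γ̂⁰_{1A}` removes `g^{11}` and `ν_A` from `W⁰`. Likewise `Γ̂^A₁₁ =
0` removes `g^{11}` from `W^A`, while `W¹` stays affine in it. -/
theorem gaugeW_zero : gaugeW (basis m) g gh x 0
    = targetW0 (christoffel (basis m) gh) (angMetric g) (nuZero g) x := by
  rw [gaugeW, hg.sum_inv_mul_mul hx _ fun a b => (hh.metricAt hx).christoffel_comm _ _ _ _,
    targetW0, hh.chr011 hx]
  simp [hh.chr01A hx]

theorem gaugeW_ang (A : Fin m) : gaugeW (basis m) g gh x (ang A)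
    = targetWA (christoffel (basis m) gh) (angMetric g) (nuZero g) (nuAng g) x A := by
  rw [gaugeW, hg.sum_inv_mul_mul hx _ fun a b => (hh.metricAt hx).christoffel_comm _ _ _ _,
    targetWA, hh.chrA11 hx]
  ring

omit hh in
theorem gaugeW_one (hgh : IsPseudoMetric U gh) : gaugeW (basis m) g gh x 1
    = christoffel (basis m) gh x 1 1 1 * gUp g x
      + targetW1 (christoffel (basis m) gh) (angMetric g) (nuZero g) (nuAng g) x := by
  rw [gaugeW, hg.sum_inv_mul_mul hx _ fun a b =>
    (hgh.metricAt hg.isOpen hx.1).christoffel_comm _ _ _ _, targetW1]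
  ring

theorem constraintC_one_eq : constraintC g (gaugeW (basis m) g gh) x 1
    = tau (angMetric g) x * (nuZero g x)⁻¹ * d1 (nuZero g) x
      - (1 / 2) * tau (angMetric g) x * (∑ A, ∑ B, (angMetric g x)⁻¹ A B
          * christoffel (basis m) gh x 0 (ang A) (ang B)) * nuZero g x
      - (d1 (tau (angMetric g)) x
          + tau (angMetric g) x * christoffel (basis m) gh x 0 0 1
          + (1 / 2) * tau (angMetric g) x ^ 2 + sigmaSq (angMetric g) x
          + tau (angMetric g) x ^ 2 / m) := by
  rw [constraintC_one, opC1, kappa, hg.gaugeW_zero hh hx, targetW0]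
  linear_combination (-tau (angMetric g) x * christoffel (basis m) gh x 0 0 1)
    * mul_inv_cancel₀ (hg.nuZero_ne hx)

omit hh in
theorem nuUp_differentiableAt (A : Fin m) :
    DifferentiableAt ℝ (fun y => nuUp (angMetric g) (nuAng g) y A) x :=
  DifferentiableAt.fun_sum fun B _ =>
    ((hg.angMetricAt hx).inv_differentiableAt A B).fun_mul (hg.nuAng_differentiableAt hx B)

theorem targetW0_differentiableAt : DifferentiableAt ℝ
    (targetW0 (christoffel (basis m) gh) (angMetric g) (nuZero g)) x :=
  have hc := (hh.metricAt hx).christoffel_differentiableAt (basis m)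
  (((hg.nuZero_inv_differentiableAt hx).const_mul 2).fun_mul (hc 0 0 1)).fun_add
    (DifferentiableAt.fun_sum fun A _ => DifferentiableAt.fun_sum fun B _ =>
      ((hg.angMetricAt hx).inv_differentiableAt A B).fun_mul (hc 0 (ang A) (ang B)))

theorem targetW1_differentiableAt : DifferentiableAt ℝ
    (targetW1 (christoffel (basis m) gh) (angMetric g) (nuZero g) (nuAng g)) x :=
  have hc := (hh.metricAt hx).christoffel_differentiableAt (basis m)
  have hi := (hg.nuZero_inv_differentiableAt hx).const_mul 2
  ((hi.fun_mul (hc 1 0 1)).fun_sub (hi.fun_mul (DifferentiableAt.fun_sum fun B _ =>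
    (hg.nuUp_differentiableAt hx B).fun_mul (hc 1 1 (ang B))))).fun_add
    (DifferentiableAt.fun_sum fun A _ => DifferentiableAt.fun_sum fun B _ =>
      ((hg.angMetricAt hx).inv_differentiableAt A B).fun_mul (hc 1 (ang A) (ang B)))

theorem shiftP_differentiableAt (A B : Fin m) : DifferentiableAt ℝ
    (fun y => shiftP (christoffel (basis m) gh) (angMetric g) (nuZero g) y A B) x := by
  have hc := (hh.metricAt hx).christoffel_differentiableAt (basis m)
  have hi := hg.nuZero_inv_differentiableAt hx
  have hq := hg.angMetricAt hx
  have hW : DifferentiableAt ℝ (fun y => if A = B then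
      targetW0 (christoffel (basis m) gh) (angMetric g) (nuZero g) y else 0) x := by
    split_ifs
    exacts [hg.targetW0_differentiableAt hh hx, differentiableAt_const _]
  exact (((hi.const_mul 4).fun_mul (hq.chi_differentiableAt A B)).fun_add hW).fun_sub
    ((hi.const_mul 2).fun_mul (DifferentiableAt.fun_sum fun C _ => DifferentiableAt.fun_sum
      fun D _ => ((hq.differentiableAt A C).fun_mul (hc (ang C) 1 (ang D))).fun_mul
        (hq.inv_differentiableAt D B)))

theorem shiftQ_differentiableAt (A : Fin m) : DifferentiableAt ℝ
    (fun y => shiftQ (christoffel (basis m) gh) (angMetric g) (nuZero g) y A) x :=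
  have hc := (hh.metricAt hx).christoffel_differentiableAt (basis m)
  have hq := hg.angMetricAt hx
  (DifferentiableAt.fun_sum fun B _ => (hq.differentiableAt A B).fun_mul
    ((((hg.nuZero_inv_differentiableAt hx).const_mul 2).fun_mul (hc (ang B) 0 1)).fun_add
      (DifferentiableAt.fun_sum fun C _ => DifferentiableAt.fun_sum fun D _ =>
        (hq.inv_differentiableAt C D).fun_mul (hc (ang B) (ang C) (ang D))))).fun_sub
    (hq.chrTrace_differentiableAt A)

-- Collects `ξ_A` by its dependence on the shift: `W^A` is affine in `ν`, so `ξ_A` is affine in `ν`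
-- and `∂₁ν`.
omit hh in
theorem xi_target_eq (A : Fin m) :
    xi (angMetric g) (nuZero g) (nuAng g)
        (targetW0 (christoffel (basis m) gh) (angMetric g) (nuZero g))
        (targetWA (christoffel (basis m) gh) (angMetric g) (nuZero g) (nuAng g)) x A
      = -2 * ((nuZero g x)⁻¹ * d1 (fun y => nuAng g y A) x)
        + (∑ B, shiftP (christoffel (basis m) gh) (angMetric g) (nuZero g) x A B * nuAng g x B)
        + shiftQ (christoffel (basis m) gh) (angMetric g) (nuZero g) x A := by
  have hn := hg.nuZero_ne hx
  set q := angMetric g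
  set n0 := nuZero g
  set nu := nuAng g
  set Γ := christoffel (basis m) gh
  have h1 : lowerAng q (targetWA Γ q n0 nu) x A
      = (∑ B, q x A B * (2 * (n0 x)⁻¹ * Γ x (ang B) 0 1
          + ∑ C, ∑ D, (q x)⁻¹ C D * Γ x (ang B) (ang C) (ang D)))
        - 2 * (n0 x)⁻¹ * ∑ B, (∑ C, ∑ D, q x A C * Γ x (ang C) 1 (ang D) * (q x)⁻¹ D B)
          * nu x B := by
    have h2 : ∑ B, (∑ C, ∑ D, q x A C * Γ x (ang C) 1 (ang D) * (q x)⁻¹ D B) * nu x B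
        = ∑ C, q x A C * ∑ D, nuUp q nu x D * Γ x (ang C) 1 (ang D) := by
      simp only [nuUp, Finset.sum_mul, Finset.mul_sum]
      rw [← sum_rotate]
      exact Finset.sum_congr rfl fun C _ => Finset.sum_congr rfl fun D _ =>
        Finset.sum_congr rfl fun B _ => by ring
    rw [h2, lowerAng, Finset.mul_sum, ← Finset.sum_sub_distrib]
    exact Finset.sum_congr rfl fun B _ => by rw [targetWA]; ring
  have h3 : ∑ B, shiftP Γ q n0 x A B * nu x B
      = 4 * (n0 x)⁻¹ * (∑ B, nu x B * chi q x A B) + targetW0 Γ q n0 x * nu x A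
        - 2 * (n0 x)⁻¹ * ∑ B, (∑ C, ∑ D, q x A C * Γ x (ang C) 1 (ang D) * (q x)⁻¹ D B)
          * nu x B := by
    have h4 : ∀ B, shiftP Γ q n0 x A B * nu x B
        = 4 * (n0 x)⁻¹ * (nu x B * chi q x A B)
          + (if A = B then targetW0 Γ q n0 x * nu x B else 0)
          - 2 * (n0 x)⁻¹ * ((∑ C, ∑ D, q x A C * Γ x (ang C) 1 (ang D) * (q x)⁻¹ D B)
            * nu x B) := fun B => by
      rw [shiftP, ← zero_mul (nu x B), ← ite_mul, zero_mul]
      ring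
    simp only [h4, Finset.sum_sub_distrib, Finset.sum_add_distrib, Finset.sum_ite_eq,
      Finset.mem_univ, if_true, ← Finset.mul_sum]
  rw [xi, h1, h3, shiftQ]
  linear_combination (nu x A * targetW0 Γ q n0 x) * mul_inv_cancel₀ hn

theorem constraintC_ang_eq (A : Fin m) : constraintC g (gaugeW (basis m) g gh) x (ang A)
    = (nuZero g x)⁻¹ * d1 (d1 (fun y => nuAng g y A)) x
      + (∑ B, coeffA1 (christoffel (basis m) gh) (angMetric g) (nuZero g) x A B
          * d1 (fun y => nuAng g y B) x)
      + (∑ B, coeffA0 (christoffel (basis m) gh) (angMetric g) (nuZero g) x A B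
          * nuAng g x B)
      + sourceA (christoffel (basis m) gh) (angMetric g) (nuZero g) x A := by
  have hW0 : ∀ y ∈ slice U, gaugeW (basis m) g gh y 0
    = targetW0 (christoffel (basis m) gh) (angMetric g) (nuZero g) y := fun y hy =>
      hg.gaugeW_zero hh hy
  have hWA : ∀ y ∈ slice U, (fun A => gaugeW (basis m) g gh y (ang A))
    = targetWA (christoffel (basis m) gh) (angMetric g) (nuZero g) (nuAng g) y := fun y hy =>
      funext (hg.gaugeW_ang hh hy)
  have hi := hg.nuZero_inv_differentiableAt hx
  have hd := hg.d1_nuAng_differentiableAt hx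
  have hn := hg.nuAng_differentiableAt hx
  have hP := hg.shiftP_differentiableAt hh hx
  have hQ := hg.shiftQ_differentiableAt hh hx
  have h1 : d1 (fun y => xi (angMetric g) (nuZero g) (nuAng g)
        (targetW0 (christoffel (basis m) gh) (angMetric g) (nuZero g))
        (targetWA (christoffel (basis m) gh) (angMetric g) (nuZero g) (nuAng g)) y A) x
      = -2 * (d1 (fun y => (nuZero g y)⁻¹) x * d1 (fun y => nuAng g y A) x
          + (nuZero g x)⁻¹ * d1 (d1 (fun y => nuAng g y A)) x)
        + (∑ B, (d1 (fun y => shiftP (christoffel (basis m) gh) (angMetric g) (nuZero g) y A B) x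
            * nuAng g x B
          + shiftP (christoffel (basis m) gh) (angMetric g) (nuZero g) x A B
            * d1 (fun y => nuAng g y B) x))
        + d1 (fun y => shiftQ (christoffel (basis m) gh) (angMetric g) (nuZero g) y A) x := by
    rw [d1_congr_slice hg.isOpen (fun y hy => hg.xi_target_eq hy A) hx,
      d1_fun_add (((hi.fun_mul (hd A)).const_mul _).fun_add
        (DifferentiableAt.fun_sum fun B _ => (hP A B).fun_mul (hn B))) (hQ A),
      d1_fun_add ((hi.fun_mul (hd A)).const_mul _)
        (DifferentiableAt.fun_sum fun B _ => (hP A B).fun_mul (hn B)),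
      d1_const_mul, d1_fun_mul hi (hd A), d1_fun_sum fun B => (hP A B).fun_mul (hn B)]
    simp only [fun B => d1_fun_mul (hP A B) (hn B)]
  rw [constraintC_ang, opCA_congr hg.isOpen (fun _ _ => rfl) (fun _ _ => rfl) (fun _ _ => rfl)
    hW0 hWA x hx, opCA, h1, hg.xi_target_eq hx]
  simp only [coeffA1, coeffA0, sourceA, sub_mul, ite_mul, zero_mul, Finset.sum_sub_distrib,
    Finset.sum_ite_eq, Finset.mem_univ, if_true, Finset.sum_add_distrib, mul_assoc,
    ← Finset.mul_sum, add_mul, mul_add]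
  ring

/-- The term `Γ̂¹₁₁ g^{11}` of `W¹` joins `κ + τ/2` in `innerJ`; then `2 (∂₁ + κ + τ)` is applied to
`(∂₁ + innerJ) g^{11}` plus a term free of `g^{11}`. -/
theorem constraintC_zero_eq : -2 * (nuZero g x)⁻¹ * constraintC g (gaugeW (basis m) g gh) x 0
    = 2 * d1 (d1 (gUp g)) x
      + coeffZ1 (christoffel (basis m) gh) (angMetric g) (nuZero g) x * d1 (gUp g) x
      + coeffZ0 (christoffel (basis m) gh) (angMetric g) (nuZero g) x * gUp g x
      + sourceZ (christoffel (basis m) gh) (angMetric g) (nuZero g) (nuAng g) x := by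
  have hW0 : ∀ y ∈ slice U, gaugeW (basis m) g gh y 0
    = targetW0 (christoffel (basis m) gh) (angMetric g) (nuZero g) y := fun y hy =>
      hg.gaugeW_zero hh hy
  have hW1 : ∀ y ∈ slice U, gaugeW (basis m) g gh y 1
    = christoffel (basis m) gh y 1 1 1 * gUp g y
      + targetW1 (christoffel (basis m) gh) (angMetric g) (nuZero g) (nuAng g) y := fun y hy =>
      hg.gaugeW_one hy hh.metric
  have hWA : ∀ y ∈ slice U, (fun A => gaugeW (basis m) g gh y (ang A))
    = targetWA (christoffel (basis m) gh) (angMetric g) (nuZero g) (nuAng g) y := fun y hy =>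
      funext (hg.gaugeW_ang hh hy)
  rw [constraintC_zero, opC0_congr hg.isOpen (fun _ _ => rfl) (fun _ _ => rfl) (fun _ _ => rfl)
    (fun _ _ => rfl) hW0 hW1 hWA x hx]
  set q := angMetric g
  set n0 := nuZero g
  set nu := nuAng g
  set Γ := christoffel (basis m) gh
  have hG := hg.gUp_differentiableAt hx
  have hJ : DifferentiableAt ℝ (innerJ Γ q n0) x := by
    have h1 := hg.kappa_differentiableAt hx (hg.targetW0_differentiableAt hh hx)
    have h2 := (hg.angMetricAt hx).tau_differentiableAt
    have h3 := (hh.metricAt hx).christoffel_differentiableAt (basis m) 1 1 1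
    exact (h1.fun_add (by simpa only [div_eq_mul_inv] using h2.mul_const _)).fun_add h3
  have h1 : d1 (fun y => d1 (gUp g) y + (kappa q n0 (targetW0 Γ q n0) y + tau q y / 2) * gUp g y
        + (Γ y 1 1 1 * gUp g y + targetW1 Γ q n0 nu y)) x
      = d1 (d1 (gUp g)) x + (d1 (innerJ Γ q n0) x * gUp g x + innerJ Γ q n0 x * d1 (gUp g) x)
        + d1 (targetW1 Γ q n0 nu) x := by
    have h2 : (fun y => d1 (gUp g) y + (kappa q n0 (targetW0 Γ q n0) y + tau q y / 2) * gUp g y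
        + (Γ y 1 1 1 * gUp g y + targetW1 Γ q n0 nu y))
        = fun y => d1 (gUp g) y + innerJ Γ q n0 y * gUp g y + targetW1 Γ q n0 nu y := by
      ext y
      rw [innerJ]
      ring
    rw [h2, d1_fun_add ((hg.d1_gUp_differentiableAt hx).fun_add (hJ.fun_mul hG))
        (hg.targetW1_differentiableAt hh hx),
      d1_fun_add (hg.d1_gUp_differentiableAt hx) (hJ.fun_mul hG), d1_fun_mul hJ hG]
  have h3 : ∀ f : Fin m → ℝ, ∑ A, (-(n0 x)⁻¹ * nuUp q nu x A) * f A
      = -(n0 x)⁻¹ * ∑ A, nuUp q nu x A * f A := fun f => by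
    rw [Finset.mul_sum]
    exact Finset.sum_congr rfl fun A _ => by ring
  have h4 : ∀ y : ℝ, -2 * (n0 x)⁻¹ * (-(1 / 2) * n0 x * y) = y := fun y => by
    linear_combination y * mul_inv_cancel₀ (hg.nuZero_ne hx)
  rw [opC0, h4, h1, h3, coeffZ1, coeffZ0, sourceZ, outerK]
  have h5 : innerJ Γ q n0 x = kappa q n0 (targetW0 Γ q n0) x + tau q x / 2 + Γ x 1 1 1 := rfl
  rw [h5]
  ring

end AdaptedMetric

end Hierarchy

/-! ### The operators on an arbitrary null hypersurface. -/

section Operators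

variable {m : ℕ}

/-- Extension by zero of a field on `M`. -/
def extendZero {E : Type*} [Zero E] (M : Set (Pt m)) (f : M → E) (y : Pt m) : E :=
  open Classical in if h : y ∈ M then f ⟨y, h⟩ else 0

theorem extendZero_domRestrict {E : Type*} [Zero E] {M : Set (Pt m)} (f : Pt m → E) {y : Pt m}
    (hy : y ∈ M) : extendZero M (M.domRestrict f) y = f y := by
  simp [extendZero, hy]

/-- The data `γ`, `l` on `M` are those of adapted null coordinates. -/
def IsAdaptedData (M : Set (Pt m)) (γ : M → Comp m) (l : M → Pt m) : Prop :=
  (∃ U : Set (Pt m), IsOpen U ∧ M = slice U) ∧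
    ∀ p, l p = basis m 1 ∧ γ p 1 1 = 0 ∧ ∀ A : Fin m, γ p 1 (ang A) = 0

/-- The metric `g` on the neighbourhood `U` of the null hypersurface `M` induces the data `γ`, `l`,
`V` on `M`, where `V` stands for the contracted Christoffel symbols. -/
structure Realizes (M : Set (Pt m)) (γ : M → Comp m) (l V : M → Pt m) (U : Set (Pt m))
    (g : Pt m → Comp m) (k : Pt m → Pt m) : Prop where
  isOpen : IsOpen U
  subset : M ⊆ U
  metric : IsPseudoMetric U g
  null : IsNullHypersurface g M k
  metric_eq : ∀ p : M, g p = γ p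
  normal_eq : ∀ p : M, k p = l p
  trace_eq : ∀ p : M, christoffelTrace g p = V p

open Classical in
/-- The covector `S_{αβ} l^β` on the null hypersurface `M`, as an operator on the metric `γ` on `M`,
the null normal `l` and the contracted Christoffel symbols `V` on `M`. -/
def nullEinstein (M : Set (Pt m)) (γ : M → Comp m) (l V : M → Pt m) (p : M) : Pt m :=
  -- The adapted case comes first, so that the explicit formula holds for every field `V`; `W` need
  -- not be the contracted Christoffel symbols of any metric with these data.
  if IsAdaptedData M γ l then constraintC (extendZero M γ) (extendZero M V) p
  -- By `einstein_null_eq` the choice of the realising metric does not affect the value.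
  else if h : ∃ U g k, Realizes M γ l V U g k then
    fun α => ∑ β, einstein (basis m) h.choose_spec.choose p α β
      * h.choose_spec.choose_spec.choose p β
  -- Data realised by no metric get a default value. This is harmless: in `L + C` the value at `W`
  -- cancels, and `W + H` is realised by the given metric.
  else 0

theorem nullEinstein_of_isAdapted {U : Set (Pt m)} (hU : IsOpen U) {g : Pt m → Comp m}
    (hg : IsAdapted g (slice U)) (V : Pt m → Pt m) (p : slice U) :
    nullEinstein (slice U) ((slice U).domRestrict g) (fun _ => basis m 1)
      ((slice U).domRestrict V) p = constraintC g V p := by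
  rw [nullEinstein, if_pos ⟨⟨U, hU, rfl⟩, fun p => ⟨rfl, hg p p.2⟩⟩]
  exact constraintC_congr hU (fun y hy => extendZero_domRestrict g hy)
    (fun y hy => extendZero_domRestrict V hy) p p.2

/-- On adapted data this is the computation `einstein_eq`; otherwise the given metric realises the
data, and the chosen one has the same Einstein covector by `einstein_null_eq`. -/
theorem nullEinstein_eq (hm : 1 ≤ m) {U M : Set (Pt m)} {g : Pt m → Comp m} {l : Pt m → Pt m}
    (hU : IsOpen U) (hMU : M ⊆ U) (hg : IsPseudoMetric U g) (hl : IsNullHypersurface g M l)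
    (p : M) (α : Fin (m + 2)) :
    nullEinstein M (M.domRestrict g) (M.domRestrict l) (M.domRestrict (christoffelTrace g)) p α
      = ∑ β, einstein (basis m) g p α β * l p β := by
  by_cases hA : IsAdaptedData M (M.domRestrict g) (M.domRestrict l)
  · obtain ⟨⟨U', hU', hM⟩, hd⟩ := hA
    -- The domain `U'` of the adapted coordinates may exceed the domain `U` of the metric, hence the
    -- intersection.
    have hM' : M = slice (U ∩ U') := by
      ext y
      constructor
      · exact fun hy => ⟨⟨hMU hy, (hM ▸ hy : y ∈ slice U').1⟩, (hM ▸ hy : y ∈ slice U').2⟩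
      · exact fun hy => hM ▸ ⟨hy.1.2, hy.2⟩
    subst hM'
    have hl' : (slice (U ∩ U')).domRestrict l = fun _ => basis m 1 := funext fun q => (hd q).1
    have hg' : AdaptedMetric (U ∩ U') g :=
      { isOpen := hU.inter hU'
        metric :=
          { contDiffOn := fun i j => (hg.contDiffOn i j).mono Set.inter_subset_left
            symm := fun y hy => hg.symm y hy.1
            nondegenerate := fun y hy => hg.nondegenerate y hy.1 }
        adapted := fun y hy => (hd ⟨y, hy⟩).2 }
    rw [hl', nullEinstein_of_isAdapted hg'.isOpen hg'.adapted, ← hg'.einstein_eq p.2 hm,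
      show l p = basis m 1 from (hd p).1]
    simp [basis, Pi.single_apply]
  · have h : ∃ U' g' k, Realizes M (M.domRestrict g) (M.domRestrict l)
        (M.domRestrict (christoffelTrace g)) U' g' k :=
      ⟨U, g, l, hU, hMU, hg, hl, fun _ => rfl, fun _ => rfl, fun _ => rfl⟩
    rw [nullEinstein, if_neg hA, dif_pos h]
    have hr := h.choose_spec.choose_spec.choose_spec
    exact einstein_null_eq hU hr.isOpen hMU hr.subset hg hr.metric hl
      (fun y hy => hr.metric_eq ⟨y, hy⟩) (fun y hy => hr.normal_eq ⟨y, hy⟩)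
      (fun y hy => hr.trace_eq ⟨y, hy⟩) p.2 α

end Operators

end NullConstraints

theorem mainTheorem2 (m : ℕ) (hm : 1 ≤ m) :
    ∃ (C : (M : Set (Pt m)) → (M → Comp m) → (M → Pt m) → (M → Pt m) → M → Pt m)
      (L : (M : Set (Pt m)) → (M → Comp m) → (M → Pt m) → (M → Pt m) → (M → Pt m) → M → Pt m),
      -- the splitting on an arbitrary null hypersurface, for an arbitrary null normal `l`
      (∀ M γ l W, L M γ l W 0 = 0) ∧
      (∀ (U M : Set (Pt m)) (g gh : Pt m → Comp m) (l : Pt m → Pt m), IsOpen U → M ⊆ U →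
        IsLorentzMetric U g → IsPseudoMetric U gh → IsNullHypersurface g M l →
        ∀ (p : M) (α : Fin (m + 2)),
          ∑ β, einstein (basis m) g p α β * l p β
            = L M (M.domRestrict g) (M.domRestrict l) (M.domRestrict (gaugeW (basis m) g gh))
                (M.domRestrict (gaugeH (basis m) g gh)) p α
              + C M (M.domRestrict g) (M.domRestrict l) (M.domRestrict (gaugeW (basis m) g gh)) p α) ∧
      -- adapted null coordinates, `l = ∂/∂x¹`
      (∀ (U : Set (Pt m)) (g gh : Pt m → Comp m), IsOpen U →
        IsLorentzMetric U g → IsPseudoMetric U gh → IsAdapted g (slice U) →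
        -- explicit form of the operators
        (∀ p : slice U,
          C (slice U) ((slice U).domRestrict g) (fun _ => basis m 1)
              ((slice U).domRestrict (gaugeW (basis m) g gh)) p
            = constraintC g (gaugeW (basis m) g gh) p ∧
          L (slice U) ((slice U).domRestrict g) (fun _ => basis m 1)
              ((slice U).domRestrict (gaugeW (basis m) g gh))
              ((slice U).domRestrict (gaugeH (basis m) g gh)) p
            = constraintL g (gaugeW (basis m) g gh) (gaugeH (basis m) g gh) p) ∧
        -- a) the hierarchy of ordinary differential operators along the generators
        (IsAdapted gh (slice U) → ∀ x ∈ slice U,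
          constraintC g (gaugeW (basis m) g gh) x 1
            = tau (angMetric g) x * (nuZero g x)⁻¹ * d1 (nuZero g) x
              - (1 / 2) * tau (angMetric g) x * (∑ A, ∑ B, (angMetric g x)⁻¹ A B
                  * christoffel (basis m) gh x 0 (ang A) (ang B)) * nuZero g x
              - (d1 (tau (angMetric g)) x
                  + tau (angMetric g) x * christoffel (basis m) gh x 0 0 1
                  + (1 / 2) * tau (angMetric g) x ^ 2 + sigmaSq (angMetric g) x
                  + tau (angMetric g) x ^ 2 / m) ∧
          (∀ A : Fin m, constraintC g (gaugeW (basis m) g gh) x (ang A)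
            = (nuZero g x)⁻¹ * d1 (d1 (fun y => nuAng g y A)) x
              + (∑ B, coeffA1 (christoffel (basis m) gh) (angMetric g) (nuZero g) x A B
                  * d1 (fun y => nuAng g y B) x)
              + (∑ B, coeffA0 (christoffel (basis m) gh) (angMetric g) (nuZero g) x A B
                  * nuAng g x B)
              + sourceA (christoffel (basis m) gh) (angMetric g) (nuZero g) x A) ∧
          gUp g x = ((nuZero g x)⁻¹) ^ 2
            * ((∑ A, nuUp (angMetric g) (nuAng g) x A * nuAng g x A) - g x 0 0) ∧
          -2 * (nuZero g x)⁻¹ * constraintC g (gaugeW (basis m) g gh) x 0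
            = 2 * d1 (d1 (gUp g)) x
              + coeffZ1 (christoffel (basis m) gh) (angMetric g) (nuZero g) x * d1 (gUp g) x
              + coeffZ0 (christoffel (basis m) gh) (angMetric g) (nuZero g) x * gUp g x
              + sourceZ (christoffel (basis m) gh) (angMetric g) (nuZero g) (nuAng g) x) ∧
        -- b) the hierarchy for the wave-gauge vector when the reduced equations hold
        (∀ T : Pt m → Comp m,
          (∀ x ∈ slice U, ∀ α β, reducedEinstein (basis m) g gh x α β = T x α β) →
          (∀ x ∈ slice U, ∀ α : Fin (m + 2),
            T x α 1 - constraintC g (gaugeW (basis m) g gh) x α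
              = constraintL g (gaugeW (basis m) g gh) (gaugeH (basis m) g gh) x α
                - (1 / 2) * ((∑ k, g x α k * gaugeDH (basis m) g gh x 1 k)
                  + (∑ k, g x 1 k * gaugeDH (basis m) g gh x α k)
                  - g x α 1 * ∑ k, gaugeDH (basis m) g gh x k k)) ∧
          (IsAdapted gh (slice U) →
            (∀ x ∈ slice U, T x 1 1 - constraintC g (gaugeW (basis m) g gh) x 1
              = -nuZero g x * (d1 (fun y => gaugeH (basis m) g gh y 0) x
                  + ((1 / 2) * tau (angMetric g) x + christoffel (basis m) gh x 0 0 1)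
                    * gaugeH (basis m) g gh x 0)) ∧
            (∀ x ∈ slice U, ∀ A : Fin m,
              T x (ang A) 1 - constraintC g (gaugeW (basis m) g gh) x (ang A)
              = -d1 (fun y => lowerAng (angMetric g)
                    (fun z B => gaugeH (basis m) g gh z (ang B)) y A) x
                - (1 / 2) * tau (angMetric g) x * lowerAng (angMetric g)
                    (fun z B => gaugeH (basis m) g gh z (ang B)) x A
                + (∑ B, chi (angMetric g) x A B * lowerAng (angMetric g)
                    (fun z D => gaugeH (basis m) g gh z (ang D)) x B)
                - (1 / 2) * nuZero g x * (∑ B, christoffel (basis m) gh x 0 (ang A) (ang B)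
                    * gaugeH (basis m) g gh x (ang B))
                - (1 / 2) * (∑ B, ∑ D, angMetric g x A B
                    * christoffel (basis m) gh x (ang B) 1 (ang D)
                    * gaugeH (basis m) g gh x (ang D))
                - nuAng g x A * d1 (fun y => gaugeH (basis m) g gh y 0) x
                + (1 / 2) * (dA A (nuZero g) x - d1 (fun y => nuAng g y A) x
                    - tau (angMetric g) x * nuAng g x A
                    - nuZero g x * christoffel (basis m) gh x 0 0 (ang A)
                    - nuAng g x A * christoffel (basis m) gh x 0 0 1
                    - ∑ B, angMetric g x A B * christoffel (basis m) gh x (ang B) 0 1)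
                  * gaugeH (basis m) g gh x 0) ∧
            ((∀ y ∈ slice U, gaugeH (basis m) g gh y 0 = 0
                ∧ ∀ A : Fin m, gaugeH (basis m) g gh y (ang A) = 0) →
              ∀ x ∈ slice U, T x 0 1 - constraintC g (gaugeW (basis m) g gh) x 0
                = -d1 (fun y => nuZero g y * gaugeH (basis m) g gh y 1) x
                  + (1 / 2) * (nuZero g x * gaugeW (basis m) g gh x 0 - tau (angMetric g) x
                      + ∑ A, christoffel (basis m) gh x (ang A) (ang A) 1)
                    * (nuZero g x * gaugeH (basis m) g gh x 1)))))
      := by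
  have split : ∀ (M : Set (Pt m)) (g gh : Pt m → Comp m),
      M.domRestrict (gaugeW (basis m) g gh) + M.domRestrict (gaugeH (basis m) g gh)
        = M.domRestrict (christoffelTrace g) := fun M g gh => by
    rw [christoffelTrace_eq_add g gh]
    rfl
  -- `L` is the difference of the operator at `W + H` and at `W`, so it vanishes at `H = 0` and `L +
  -- C` is the operator at `W + H`.
  refine ⟨nullEinstein, fun M γ l W H => nullEinstein M γ l (W + H) - nullEinstein M γ l W,
    fun M γ l W => by simp, ?_, ?_⟩
  · intro U M g gh l hU hMU hg _ hl p α
    beta_reduce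
    rw [split, Pi.sub_apply, Pi.sub_apply, sub_add_cancel,
      nullEinstein_eq hm hU hMU hg.isPseudoMetric hl]
  · intro U g gh hU hg hgh hA
    have hga : AdaptedMetric U g := ⟨hU, hg.isPseudoMetric, hA⟩
    refine ⟨fun p => ⟨nullEinstein_of_isAdapted hU hA _ p, ?_⟩, fun hAh x hx => ?_, fun T hT => ?_⟩
    · have hM := hga.metricAt p.2
      have hMh := hgh.metricAt hU p.2.1
      beta_reduce
      rw [split, Pi.sub_apply, nullEinstein_of_isAdapted hU hA, nullEinstein_of_isAdapted hU hA,
        christoffelTrace_eq_add g gh,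
        hga.constraintC_add p.2 (fun l => hM.gaugeW_differentiableAt hMh _ l)
          fun l => hM.gaugeH_differentiableAt hMh _ l, add_sub_cancel_left]
    · have hh : AdaptedMetric U gh := ⟨hU, hgh, hAh⟩
      exact ⟨hga.constraintC_one_eq hh hx, hga.constraintC_ang_eq hh hx, hga.gUp_eq hx,
        hga.constraintC_zero_eq hh hx⟩
    · refine ⟨fun x hx α => ?_, fun hAh => ?_⟩
      · rw [← hT x hx]
        exact hga.reducedEinstein_splitting hx hm hgh α
      · have hh : AdaptedMetric U gh := ⟨hU, hgh, hAh⟩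
        refine ⟨fun x hx => ?_, fun x hx A => ?_, fun h0 x hx => ?_⟩
        · rw [← hT x hx]
          exact hga.reducedEinstein11 hx hh hm
        · rw [← hT x hx]
          exact hga.reducedEinsteinA1 hx hh hm A
        · rw [← hT x hx]
          exact hga.reducedEinstein01 hx hh hm h0
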